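/- Let $R$ be an integral domain of characteristic zero with fraction field $Q(R)$ and let $G=(G^{(1)},\dots,G^{(m)})$ be an $m$-dimensional formal group law over $R$: $G^{(j)}(X,Y)=X_j+Y_j+\sum_{l,k}\gamma^j_{lk}X_lY_k+O(\deg\ge 3)$ and $G(G(X,Y),Z)=G(X,G(Y,Z))$. Let $\mathfrak g$ be its Lie algebra, free over $R$ with basis $e_1,\dots,e_m$ and bracket $[e_l,e_k]=\sum_j(\gamma^j_{lk}-\gamma^j_{kl})e_j$, let $\mathcal U=\mathcal U(\mathfrak g)$ with its standard Hopf algebra structure (counit $\epsilon$), and $\mathcal U^*=\operatorname{Hom}_R(\mathcal U,R)$. Let $\mathcal O(G)=R[[t^{(1)},\dots,t^{(m)}]]$ and $$\tilde{\mathcal O}(G)=\Big\{\sum_{\underline j} b_{\underline j}\,\underline t^{\underline j}\in Q(R)[[\underline t]] \ \Big|\ \underline j!\,b_{\underline j}\in R\Big\},$$ both with the complete Hopf algebra structure given by $\mu(t^{(i)})=G^{(i)}(\underline t_1,\underline t_2)$, $f\mapsto f(0)$ and $f\mapsto f\circ s$, where $G(\underline t,s(\underline t))=0$. Let $\mathcal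 D$ be the continuous dual of $\mathcal O(G)$ with the convolution product $(\varphi\psi)(f)=(\varphi\otimes\psi)(\mu(f))$, and let $\alpha:\mathcal U\to\mathcal D$ be the algebra homomorphism with $\alpha(e_j)(f)=\frac{\partial f}{\partial t^{(j)}}(0)$. Put $\alpha^*:\mathcal O(G)\to\mathcal U^*$, $\alpha^*(f)(u)=\alpha(u)(f)$, and let $\tilde\alpha^*$ be its extension to $\tilde{\mathcal O}(G)$ given by the same formula. Let $K^n=\mathcal O(G)^{\hat\otimes n}=R[[\underline t_1,\dots,\underline t_n]]$ and let $\tilde K^n=\tilde{\mathcal O}(G)^{\hat\otimes n}$, which is the ring of all $\sum b_{d}\,t^{d}\in Q(R)[[\underline t_1,\dots,\underline t_n]]$ with $d!\,b_d\in R$. Both carry the cobar differential $$\partial f=f(\underline t_2,\dots,\underline t_{n+1})+\sum_{i=1}^n(-1)^if(\underline t_1,\dots,G(\underline t_i,\underline t_{i+1}),\dots,\underline t_{n+1})+(-1)^{n+1}f(\underline t_1,\dots,\underline t_n).$$ Consider moreover, with $R$ as trivial module: * $\operatorname{Hom}_R(\mathcal U^{\otimes n},R)$ with $(\partial_uf)(u_1,\dots,u_{n+1})=\epsilon(u_1)f(u_2,\dots,u_{n+1})+\sum_{i=1}^n(-1)^if(\dots,u_iu_{i+1},\dots)+(-1)^{n+1}\epsilon(u_{n+1})f(u_1,\dots,u_n)$;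 * $\operatorname{Hom}_{\mathcal U}(\mathcal U^{\otimes(n+1)},R)$, with $\mathcal U$ acting on the first factor, the maps $\iota^n(f)(u_0,\dots,u_n)=\epsilon(u_0)f(u_1,\dots,u_n)$ and the differential $\partial_{u_h}=\iota\,\partial_u\,\iota^{-1}$; * $\operatorname{Hom}_{\mathcal U}(V_n(\mathfrak g),R)$, $V_n(\mathfrak g)=\mathcal U\otimes\bigwedge^n\mathfrak g$, with the differential dual to $u\otimes e_{i_1}\wedge\dots\wedge e_{i_n}\mapsto\sum_{k<l}(-1)^{k+l}u\otimes[e_{i_k},e_{i_l}]\wedge\cdots\widehat{e_{i_k}}\cdots\widehat{e_{i_l}}\cdots+\sum_j(-1)^{j+1}ue_{i_j}\otimes\cdots\widehat{e_{i_j}}\cdots$ (where $i_1<\dots<i_n$); * $C^n(\mathfrak g,R)=\operatorname{Hom}_R(\bigwedge^n\mathfrak g,R)$ with the Chevalley–Eilenberg differential $(\partial'\omega)(e_{i_1}\wedge\dots\wedge e_{i_{n+1}})=\sum_{k<l}(-1)^{k+l}\omega([e_{i_k},e_{i_l}]\wedge\cdots\widehat{e_{i_k}}\cdots\widehat{e_{i_l}}\cdots)$.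 Then: 1. $\tilde\alpha^*$ takes values in $\mathcal U^*$ and is an isomorphism of complete Hopf algebras $\tilde{\mathcal O}(G)\to\mathcal U^*$. It identifies the filtration by total degree with the filtration of $\mathcal U^*$ whose $i$-th step consists of the functionals vanishing on all $e_1^{j_1}\cdots e_m^{j_m}$ with $|\underline j|<i$. 2. All the above are cochain complexes. The map $\tilde\alpha^*$ extends to $f\mapsto\big(u_1\otimes\cdots\otimes u_n\mapsto(\alpha(u_1)\otimes\cdots\otimes\alpha(u_n))(f)\big)$ on $\tilde K^n$, with $f_1\otimes\cdots\otimes f_n\mapsto\prod_i\tilde\alpha^*(f_i)(u_i)$, and the maps in $$(\tilde K^\bullet,\partial)\xrightarrow{\tilde\alpha^*}(\operatorname{Hom}_R(\mathcal U^{\otimes\bullet},R),\partial_u)\xrightarrow{\iota}(\operatorname{Hom}_{\mathcal U}(\mathcal U^{\otimes(\bullet+1)},R),\partial_{u_h})\xrightarrow{\nu}(\operatorname{Hom}_{\mathcal U}(V_\bullet(\mathfrak g),R),d)\xrightarrow{\kappa}(C^\bullet(\mathfrak g,R),\partial')$$ are morphisms of complexes. Here $\nu$ is induced by the antisymmetrisation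 $x_1\wedge\dots\wedge x_n\mapsto\sum_{\sigma\in S_n}\operatorname{sgn}(\sigma)\,x_{\sigma(1)}\otimes\cdots\otimes x_{\sigma(n)}$ and $\kappa(f)=f(1\otimes-)$. The maps $\tilde\alpha^*$, $\iota$ and $\kappa$ are isomorphisms of complexes and $\nu$ is a quasi-isomorphism. In particular the composite $\tilde\varphi:\tilde K^\bullet\to C^\bullet(\mathfrak g,R)$ is a quasi-isomorphism. 3. $\tilde\alpha^*$ restricts to $\alpha^*$ on $K^\bullet\subset\tilde K^\bullet$, where $\alpha^*$ satisfies $f_1\otimes\cdots\otimes f_n\mapsto\prod_i\alpha^*(f_i)(u_i)$. The map $\varphi=\kappa\,\nu\,\iota\,\alpha^*:(K^\bullet,\partial)\to(C^\bullet(\mathfrak g,R),\partial')$ is a morphism of complexes and equals the restriction of $\tilde\varphi$ to $K^\bullet$. -/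

import Mathlib

open scoped TensorProduct

universe u

noncomputable section

section Exponents

variable {m n : ℕ}

/-- The exponent of `n * m` variables `t_k^{(j)}` whose `k`-th block is the multi-index `p k`. -/
def joinExp (p : Fin n → (Fin m →₀ ℕ)) : Fin n × Fin m →₀ ℕ :=
  Finsupp.equivFunOnFinite.symm fun q => p q.1 q.2

/-- The family indexed by `Fin 2 × Fin m` with first block `P` and second block `Q`. -/
def pairBlocks {A : Type*} (P Q : Fin m → A) : Fin 2 × Fin m → A :=
  fun q => (![P, Q] : Fin 2 → Fin m → A) q.1 q.2

end Exponents

/-- An `m`-dimensional formal group law over `R`.  The variable `(0, j)` is `X_j` and `(1, j)` is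
`Y_j`. -/
structure FormalGroupLaw (R : Type u) [CommRing R] (m : ℕ) where
  /-- The power series `G^{(j)}(X, Y)`. -/
  series : Fin m → MvPowerSeries (Fin 2 × Fin m) R
  /-- `G^{(j)}(X, Y) = X_j + Y_j + ∑ γ_{lk}^j X_l Y_k + O(d ≥ 3)`. -/
  low_degree : ∃ γ : Fin m → Fin m → Fin m → R, ∀ j, ∀ d : Fin 2 × Fin m →₀ ℕ, d.degree < 3 →
    MvPowerSeries.coeff d (series j) = MvPowerSeries.coeff d
      (MvPowerSeries.X (0, j) + MvPowerSeries.X (1, j) +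
        ∑ l, ∑ k, MvPowerSeries.C (γ l k j) *
          (MvPowerSeries.X (0, l) * MvPowerSeries.X (1, k)))
  /-- `G^{(j)}(G(X, Y), Z) = G^{(j)}(X, G(Y, Z))`, in the three blocks of variables
  `(0, ·)`, `(1, ·)`, `(2, ·)`. -/
  assoc : ∀ j,
    MvPowerSeries.subst
      (pairBlocks
        (fun i => MvPowerSeries.subst
          (pairBlocks (fun k => MvPowerSeries.X (0, k)) (fun k => MvPowerSeries.X (1, k)))
          (series i))
        (fun k => MvPowerSeries.X (2, k)) : Fin 2 × Fin m → MvPowerSeries (Fin 3 × Fin m) R)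
      (series j) =
    MvPowerSeries.subst
      (pairBlocks
        (fun k => MvPowerSeries.X (0, k))
        (fun i => MvPowerSeries.subst
          (pairBlocks (fun k => MvPowerSeries.X (1, k)) (fun k => MvPowerSeries.X (2, k)))
          (series i)) : Fin 2 × Fin m → MvPowerSeries (Fin 3 × Fin m) R)
      (series j)

namespace FormalGroupLaw

variable {R : Type u} [CommRing R] {m : ℕ} (G : FormalGroupLaw R m)

/-- The coefficient `γ_{lk}^j` of `X_l Y_k` in `G^{(j)}`. -/
def γ (l k j : Fin m) : R :=
  MvPowerSeries.coeff (joinExp ![Finsupp.single l 1, Finsupp.single k 1]) (G.series j)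

/-- The power series `μ(t^d) = G(X, Y)^d` for a multi-index `d`. -/
def monomialImage (d : Fin m →₀ ℕ) : MvPowerSeries (Fin 2 × Fin m) R :=
  ∏ i, G.series i ^ d i

section Aux

open MvPowerSeries

lemma joinExp_apply {n m : ℕ} (p : Fin n → (Fin m →₀ ℕ)) (q) : joinExp p q = p q.1 q.2 := rfl

lemma joinExp_injective {n m : ℕ} : Function.Injective (joinExp (n := n) (m := m)) := by
  intro p p' h
  funext i
  ext j
  exact DFunLike.congr_fun h (i, j)

lemma joinExp_surjective {n m : ℕ} : Function.Surjective (joinExp (n := n) (m := m)) := by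
  intro d
  refine ⟨fun i => Finsupp.equivFunOnFinite.symm fun j => d (i, j), ?_⟩
  ext q
  rfl

lemma degree_joinExp {n m : ℕ} (p : Fin n → (Fin m →₀ ℕ)) :
    (joinExp p).degree = ∑ i, (p i).degree := by
  simp only [Finsupp.degree_eq_sum, joinExp_apply, Fintype.sum_prod_type]

lemma degree_joinExp_two {m : ℕ} (x y : Fin m →₀ ℕ) :
    (joinExp ![x, y]).degree = x.degree + y.degree := by
  simp [degree_joinExp]

/-- `series j - X_j - Y_j` vanishes to order two. -/
lemma two_le_order (j : Fin m) : 2 ≤ (G.series j - (X (0, j) + X (1, j))).order := by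
  obtain ⟨γ, hγ⟩ := G.low_degree
  refine MvPowerSeries.le_order fun d hd => ?_
  have hd' : d.degree < 2 := by exact_mod_cast hd
  rw [map_sub, hγ j d (by omega), map_add, add_sub_cancel_left, map_sum]
  refine Finset.sum_eq_zero fun l _ => ?_
  rw [map_sum]
  refine Finset.sum_eq_zero fun k _ => ?_
  rw [coeff_C_mul, X, X, monomial_mul_monomial, coeff_monomial, if_neg, mul_zero]
  rintro rfl
  simp at hd'

lemma one_le_order (j : Fin m) : 1 ≤ (G.series j).order := by
  have h1 : 1 ≤ (X (0, j) + X (1, j) : MvPowerSeries (Fin 2 × Fin m) R).order := by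
    rw [one_le_order_iff_constCoeff_eq_zero]; simp
  have h2 := G.two_le_order j
  have h3 : G.series j = (G.series j - (X (0, j) + X (1, j))) + (X (0, j) + X (1, j)) := by ring
  rw [h3]
  exact le_trans (le_min (le_trans (by norm_num) h2) h1) min_order_le_add

lemma constantCoeff_series (j : Fin m) : constantCoeff (G.series j) = 0 :=
  one_le_order_iff_constCoeff_eq_zero.mp (G.one_le_order j)

lemma degree_le_order (d : Fin m →₀ ℕ) : (d.degree : ℕ∞) ≤ (G.monomialImage d).order := by
  unfold monomialImage
  refine le_trans ?_ (le_order_prod _ _)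
  rw [Finsupp.degree_eq_sum]
  push_cast
  exact Finset.sum_le_sum fun i _ =>
    le_order_pow_of_constantCoeff_eq_zero _ (G.constantCoeff_series i)

lemma coeff_monomialImage_eq_zero {d : Fin m →₀ ℕ} {e : Fin 2 × Fin m →₀ ℕ}
    (h : e.degree < d.degree) : coeff e (G.monomialImage d) = 0 :=
  coeff_of_lt_order (lt_of_lt_of_le (by exact_mod_cast h) (G.degree_le_order d))

lemma monomialImage_zero : G.monomialImage 0 = 1 := by simp [monomialImage]

lemma monomialImage_single (j : Fin m) : G.monomialImage (Finsupp.single j 1) = G.series j := by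
  classical
  unfold monomialImage
  rw [Finset.prod_eq_single j]
  · simp
  · intro b _ hb
    rw [Finsupp.single_eq_of_ne hb, pow_zero]
  · simp

lemma monomialImage_add (d e : Fin m →₀ ℕ) :
    G.monomialImage (d + e) = G.monomialImage d * G.monomialImage e := by
  simp [monomialImage, pow_add, Finset.prod_mul_distrib]

/-- In the lowest possible degree, `G^{(j)}` may be replaced by `X_j + Y_j`. -/
lemma coeff_series_mul (j : Fin m) (d : Fin m →₀ ℕ) (e : Fin 2 × Fin m →₀ ℕ)
    (h : e.degree ≤ d.degree + 1) :
    coeff e (G.series j * G.monomialImage d) =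
      coeff e (X (0, j) * G.monomialImage d) + coeff e (X (1, j) * G.monomialImage d) := by
  have : G.series j * G.monomialImage d =
      (G.series j - (X (0, j) + X (1, j))) * G.monomialImage d +
        (X (0, j) * G.monomialImage d + X (1, j) * G.monomialImage d) := by ring
  rw [this, map_add, map_add, coeff_of_lt_order, zero_add]
  refine lt_of_lt_of_le ?_ (le_trans (add_le_add (G.two_le_order j) (G.degree_le_order d))
    le_order_mul)
  have : ((e.degree : ℕ) : ℕ∞) < ((2 + d.degree : ℕ) : ℕ∞) := by
    exact_mod_cast (by omega : e.degree < 2 + d.degree)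
  simpa using this

lemma coeff_X_mul' {σ : Type*} (s : σ) (f : MvPowerSeries σ R) (e : σ →₀ ℕ) :
    coeff e (X s * f) = if e s = 0 then 0 else coeff (e - Finsupp.single s 1) f := by
  classical
  rw [X, coeff_monomial_mul, one_mul]
  by_cases h : e s = 0
  · rw [if_pos h, if_neg]
    intro h'
    have := h' s
    simp [h] at this
  · rw [if_neg h, if_pos]
    rw [Finsupp.single_le_iff]
    omega

lemma exists_add_single (d : Fin m →₀ ℕ) (n : ℕ) (h : d.degree = n + 1) :
    ∃ j d', d = Finsupp.single j 1 + d' ∧ d'.degree = n := by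
  have h0 : d ≠ 0 := by rintro rfl; simp at h
  obtain ⟨j, hj⟩ := Finsupp.ne_iff.mp h0
  have hle : Finsupp.single j 1 ≤ d := by
    rw [Finsupp.single_le_iff]
    have : d j ≠ 0 := hj
    omega
  refine ⟨j, d - Finsupp.single j 1, (add_tsub_cancel_of_le hle).symm, ?_⟩
  have h2 := congrArg Finsupp.degree (add_tsub_cancel_of_le hle)
  rw [map_add, Finsupp.degree_single] at h2
  omega

lemma joinExp_sub_single {n : ℕ} [DecidableEq (Fin n)] (p : Fin n → (Fin m →₀ ℕ)) (a : Fin n)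
    (j : Fin m) : joinExp p - Finsupp.single (a, j) 1 =
      joinExp (Function.update p a (p a - Finsupp.single j 1)) := by
  classical
  ext ⟨b, k⟩
  rw [Finsupp.tsub_apply, joinExp_apply, joinExp_apply]
  by_cases hb : b = a
  · subst hb
    by_cases hk : k = j
    · subst hk; simp
    · simp [Ne.symm hk]
  · simp [hb]

lemma coeff_block (a : Fin 2) (y d : Fin m →₀ ℕ) (h : y.degree ≤ d.degree) :
    coeff (joinExp (Pi.single a y)) (G.monomialImage d) = if y = d then 1 else 0 := by
  classical
  induction hn : d.degree generalizing y d with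
  | zero =>
    have hd : d = 0 := (Finsupp.degree_eq_zero_iff d).mp hn
    have hy : y = 0 := by
      exact (Finsupp.degree_eq_zero_iff y).mp (by omega)
    subst hd hy
    rw [monomialImage_zero, if_pos rfl, Pi.single_zero]
    have : joinExp (0 : Fin 2 → (Fin m →₀ ℕ)) = 0 := by ext; rfl
    rw [this]; simp
  | succ n ih =>
    obtain ⟨j, d', rfl, hd'⟩ := exists_add_single d n hn
    rw [G.monomialImage_add, G.monomialImage_single, G.coeff_series_mul]
    swap
    · rw [degree_joinExp]
      have : ∑ i, ((Pi.single a y : Fin 2 → (Fin m →₀ ℕ)) i).degree = y.degree := by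
        rw [Finset.sum_eq_single a] <;> simp +contextual
      omega
    have key : ∀ b : Fin 2, coeff (joinExp (Pi.single a y)) (X (b, j) * G.monomialImage d') =
        if b = a then (if y = Finsupp.single j 1 + d' then 1 else 0) else 0 := by
      intro b
      rw [coeff_X_mul', joinExp_apply]
      by_cases hb : b = a
      · subst hb
        rw [if_pos rfl, Pi.single_eq_same]
        by_cases hy : y j = 0
        · rw [if_pos hy, if_neg]
          rintro rfl
          simp at hy
        · have hle : Finsupp.single j 1 ≤ y := by
            rw [Finsupp.single_le_iff]; omega
          rw [if_neg hy, joinExp_sub_single, Pi.single_eq_same]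
          have : Function.update (Pi.single b y : Fin 2 → (Fin m →₀ ℕ)) b
              (y - Finsupp.single j 1) = Pi.single b (y - Finsupp.single j 1) := by
            simp [Pi.single]
          have h2 := congrArg Finsupp.degree (add_tsub_cancel_of_le hle)
          rw [map_add, Finsupp.degree_single] at h2
          rw [this, ih _ _ _ hd']
          · refine if_congr ?_ rfl rfl
            constructor
            · rintro h; rw [← h, add_tsub_cancel_of_le hle]
            · rintro h; rw [h, add_tsub_cancel_left]
          · omega
      · rw [if_neg hb, if_pos]
        simp [Pi.single_eq_of_ne hb]
    rw [key, key]
    fin_cases a <;> simp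

/-- The structure constants of the product on distributions. -/
def structureConst (x y d : Fin m →₀ ℕ) : R := coeff (joinExp ![x, y]) (G.monomialImage d)

lemma structureConst_eq_zero {x y d : Fin m →₀ ℕ} (h : x.degree + y.degree < d.degree) :
    G.structureConst x y d = 0 :=
  G.coeff_monomialImage_eq_zero (by rwa [degree_joinExp_two])

lemma structureConst_zero_left {y d : Fin m →₀ ℕ} (h : y.degree ≤ d.degree) :
    G.structureConst 0 y d = if y = d then 1 else 0 := by
  rw [← G.coeff_block 1 y d h, structureConst]
  congr 3
  funext i; fin_cases i <;> rfl

lemma structureConst_zero_right {x d : Fin m →₀ ℕ} (h : x.degree ≤ d.degree) :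
    G.structureConst x 0 d = if x = d then 1 else 0 := by
  rw [← G.coeff_block 0 x d h, structureConst]
  congr 3
  funext i; fin_cases i <;> rfl

lemma finite_structureConst (x y : Fin m →₀ ℕ) :
    (Function.support fun d => G.structureConst x y d).Finite := by
  refine (Finsupp.finite_of_degree_le (x.degree + y.degree)).subset fun d hd => ?_
  by_contra h
  exact hd (G.structureConst_eq_zero (by simpa using h))

/-- Antisymmetrising the structure constants of two tangent vectors only leaves linear terms. -/
lemma structureConst_comm (l k : Fin m) (d : Fin m →₀ ℕ) (h : d.degree ≠ 1) :
    G.structureConst (Finsupp.single l 1) (Finsupp.single k 1) d =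
      G.structureConst (Finsupp.single k 1) (Finsupp.single l 1) d := by
  classical
  rcases lt_trichotomy d.degree 1 with h0 | h0 | h0
  · have hd : d = 0 := (Finsupp.degree_eq_zero_iff d).mp (by omega)
    subst hd
    have : ∀ l k : Fin m,
        G.structureConst (Finsupp.single l 1) (Finsupp.single k 1) 0 = 0 := by
      intro l k
      rw [structureConst, monomialImage_zero, coeff_one, if_neg]
      intro h
      have := congrArg Finsupp.degree h
      simp [degree_joinExp_two] at this
    rw [this, this]
  · exact absurd h0 h
  · by_cases h2 : 2 < d.degree
    · rw [structureConst_eq_zero, structureConst_eq_zero] <;> simpa using h2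
    · obtain ⟨j, d', rfl, hd'⟩ := exists_add_single d 1 (by omega)
      obtain ⟨i, d'', rfl, hd''⟩ := exists_add_single d' 0 hd'
      have : d'' = 0 := (Finsupp.degree_eq_zero_iff d'').mp hd''
      subst this
      rw [add_zero]
      have key : ∀ l k : Fin m, G.structureConst (Finsupp.single l 1) (Finsupp.single k 1)
          (Finsupp.single j 1 + Finsupp.single i 1) =
            (if l = j then (if k = i then 1 else 0) else 0) +
              (if k = j then (if l = i then 1 else 0) else 0) := by
        intro l k
        rw [structureConst, G.monomialImage_add, G.monomialImage_single, G.coeff_series_mul _ _ _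
          (by rw [degree_joinExp_two]; simp), coeff_X_mul', coeff_X_mul', joinExp_apply,
          joinExp_apply, joinExp_sub_single, joinExp_sub_single]
        congr 1
        · by_cases hl : l = j
          · subst hl
            have := G.structureConst_zero_left (y := Finsupp.single k 1)
              (d := Finsupp.single i 1) (by simp)
            rw [structureConst] at this
            simp only [Matrix.cons_val_zero, Finsupp.single_eq_same, one_ne_zero, if_false, if_true,
              tsub_self]
            convert this using 2
            · congr 2; funext q; fin_cases q <;> simp
            · simp [Finsupp.single_left_inj]
          · simp [hl]
        · by_cases hl : k = j
          · subst hl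
            have := G.structureConst_zero_right (x := Finsupp.single l 1)
              (d := Finsupp.single i 1) (by simp)
            rw [structureConst] at this
            simp only [Matrix.cons_val_one, Matrix.cons_val_fin_one, Finsupp.single_eq_same,
              one_ne_zero, if_false, if_true, tsub_self]
            convert this using 2
            · congr 2; funext q; fin_cases q <;> simp
            · simp [Finsupp.single_left_inj]
          · simp [hl]
      rw [key, key, add_comm]

/-- The embedding of the variables of two blocks into those of three blocks. -/
def blockEmb (m : ℕ) (φ : Fin 2 ↪ Fin 3) : Fin 2 × Fin m ↪ Fin 3 × Fin m :=
  φ.prodMap (Function.Embedding.refl _)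

lemma coeff_rename_mul (φ : Fin 2 ↪ Fin 3) (c : Fin 3) (hc : ∀ b, φ b ≠ c)
    (hφ : ∀ a, a ≠ c → ∃ b, φ b = a) (f : MvPowerSeries (Fin 2 × Fin m) R) (w : Fin m →₀ ℕ)
    (P : Fin 3 → (Fin m →₀ ℕ)) :
    coeff (joinExp P) (rename (blockEmb m φ) f * ∏ i, X (c, i) ^ w i) =
      if w = P c then coeff (joinExp (P ∘ φ)) f else 0 := by
  classical
  have hmon : (∏ i, X (c, i) ^ w i : MvPowerSeries (Fin 3 × Fin m) R) =
      monomial (joinExp (Pi.single c w)) 1 := by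
    simp only [X_pow_eq]
    rw [prod_monomial]
    congr 1
    · congr 1
      ext ⟨b, k⟩
      rw [Finsupp.finsetSum_apply, joinExp_apply]
      by_cases hb : b = c
      · subst hb
        rw [Finset.sum_eq_single k] <;> simp +contextual
      · simp [hb]
    · simp
  rw [hmon, coeff_mul_monomial, mul_one]
  by_cases hw : w = P c
  · rw [if_pos hw, if_pos, ← coeff_embDomain_rename (blockEmb m φ)]
    · congr 1
      congr 1
      ext ⟨b, k⟩
      rw [Finsupp.tsub_apply, joinExp_apply, joinExp_apply]
      by_cases hb : b = c
      · subst hb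
        rw [Finsupp.embDomain_of_notMem_range]
        · simp [hw]
        · rintro ⟨⟨b', k'⟩, h⟩
          exact hc b' (congrArg Prod.fst h)
      · obtain ⟨b', rfl⟩ := hφ b hb
        have := Finsupp.embDomain_apply_self (blockEmb m φ) (joinExp (P ∘ φ)) (b', k)
        rw [show blockEmb m φ (b', k) = (φ b', k) from rfl] at this
        rw [this, joinExp_apply]
        simp [Pi.single_eq_of_ne hb]
    · intro ⟨b, k⟩
      rw [joinExp_apply, joinExp_apply]
      by_cases hb : b = c
      · subst hb; simp [hw]
      · simp [Pi.single_eq_of_ne hb]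
  · rw [if_neg hw]
    split_ifs with h
    · apply coeff_rename_eq_zero
      rintro ⟨x, hx⟩
      apply hw
      ext k
      have h1 := h (c, k)
      have h2 := DFunLike.congr_fun hx (c, k)
      rw [joinExp_apply, joinExp_apply, Pi.single_eq_same] at h1
      rw [Finsupp.mapDomain_of_notMem_range, Finsupp.tsub_apply, joinExp_apply, joinExp_apply,
        Pi.single_eq_same] at h2
      · simp only at h1 h2; omega
      · rintro ⟨⟨b', k'⟩, h⟩
        exact hc b' (congrArg Prod.fst h)
    · rfl

lemma hasSubst_pairBlocks {n : ℕ} {P Q : Fin m → MvPowerSeries (Fin n × Fin m) R}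
    (hP : ∀ i, constantCoeff (P i) = 0) (hQ : ∀ i, constantCoeff (Q i) = 0) :
    HasSubst (pairBlocks P Q) := by
  refine hasSubst_of_constantCoeff_zero ?_
  rintro ⟨b, k⟩
  fin_cases b
  · exact hP k
  · exact hQ k

/-- The two embeddings used in the associativity law. -/
def embLeft : Fin 2 ↪ Fin 3 := ⟨![0, 1], by decide⟩

/-- The two embeddings used in the associativity law. -/
def embRight : Fin 2 ↪ Fin 3 := ⟨![1, 2], by decide⟩

lemma rename_blockEmb (φ : Fin 2 ↪ Fin 3) (f : MvPowerSeries (Fin 2 × Fin m) R) :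
    rename (blockEmb m φ) f =
      subst (pairBlocks (fun k => X (φ 0, k)) (fun k => X (φ 1, k)) :
        Fin 2 × Fin m → MvPowerSeries (Fin 3 × Fin m) R) f := by
  rw [rename_eq_subst]
  congr 1
  funext ⟨b, k⟩
  fin_cases b <;> rfl

lemma subst_monomialImage {n : ℕ} {a : Fin 2 × Fin m → MvPowerSeries (Fin n × Fin m) R}
    (ha : HasSubst a) (e : Fin m →₀ ℕ) :
    subst a (G.monomialImage e) = ∏ i, subst a (G.series i) ^ e i := by
  rw [monomialImage, ← coe_substAlgHom ha, map_prod]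
  exact Finset.prod_congr rfl fun i _ => map_pow _ _ _

lemma finsum_joinExp {n : ℕ} (f : (Fin n × Fin m →₀ ℕ) → R) :
    ∑ᶠ D, f D = ∑ᶠ p : Fin n → (Fin m →₀ ℕ), f (joinExp p) :=
  (finsum_comp (g := f) joinExp ⟨joinExp_injective, joinExp_surjective⟩).symm

lemma prod_joinExp_two {A : Type*} [CommSemiring A] (P Q : Fin m → A) (d w : Fin m →₀ ℕ) :
    ((joinExp ![d, w]).prod fun s e => pairBlocks P Q s ^ e) =
      (∏ i, P i ^ d i) * ∏ i, Q i ^ w i := by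
  rw [Finsupp.prod_fintype _ _ (by simp), Fintype.prod_prod_type]
  simp [pairBlocks, joinExp_apply]

lemma structureConst_assoc (x y z e : Fin m →₀ ℕ) :
    ∑ᶠ d, G.structureConst x y d * G.structureConst d z e =
      ∑ᶠ d, G.structureConst y z d * G.structureConst x d e := by
  have hX : ∀ n (b : Fin n) (k : Fin m), constantCoeff
      (X (b, k) : MvPowerSeries (Fin n × Fin m) R) = 0 := by simp
  have hR : ∀ φ i, constantCoeff (rename (blockEmb m φ) (G.series i)) = 0 := by
    intro φ i
    rw [constantCoeff_rename, G.constantCoeff_series]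
  have hass : ∀ j, subst (pairBlocks (fun i => rename (blockEmb m embLeft) (G.series i))
        (fun k => X (2, k)) : Fin 2 × Fin m → MvPowerSeries (Fin 3 × Fin m) R) (G.series j) =
      subst (pairBlocks (fun k => X (0, k))
        (fun i => rename (blockEmb m embRight) (G.series i)) :
          Fin 2 × Fin m → MvPowerSeries (Fin 3 × Fin m) R) (G.series j) := by
    intro j
    simp only [rename_blockEmb]
    exact G.assoc j
  have hL := hasSubst_pairBlocks (hR embLeft) (hX 3 2)
  have hL' := hasSubst_pairBlocks (hX 3 0) (hR embRight)
  have hmon : ∀ (φ : Fin 2 ↪ Fin 3) (d : Fin m →₀ ℕ),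
      ∏ i, rename (blockEmb m φ) (G.series i) ^ d i =
        rename (blockEmb m φ) (G.monomialImage d) := by
    intro φ d
    simp [monomialImage, map_prod]
  have key := congrArg (coeff (joinExp ![x, y, z])) (show
    subst (pairBlocks (fun i => rename (blockEmb m embLeft) (G.series i)) (fun k => X (2, k)) :
      Fin 2 × Fin m → MvPowerSeries (Fin 3 × Fin m) R) (G.monomialImage e) =
    subst (pairBlocks (fun k => X (0, k)) (fun i => rename (blockEmb m embRight) (G.series i)) :
      Fin 2 × Fin m → MvPowerSeries (Fin 3 × Fin m) R) (G.monomialImage e) by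
      rw [G.subst_monomialImage hL, G.subst_monomialImage hL']
      exact Finset.prod_congr rfl fun i _ => by rw [hass i])
  rw [coeff_subst hL, coeff_subst hL', finsum_joinExp, finsum_joinExp] at key
  have e1 : ∀ p : Fin 2 → (Fin m →₀ ℕ), p = ![p 0, p 1] := by
    intro p; funext b; fin_cases b <;> rfl
  have k1 : ∀ d w : Fin m →₀ ℕ, coeff (joinExp ![x, y, z])
      ((joinExp ![d, w]).prod fun s e => (pairBlocks
        (fun i => rename (blockEmb m embLeft) (G.series i)) (fun k => X (2, k)) :
          Fin 2 × Fin m → MvPowerSeries (Fin 3 × Fin m) R) s ^ e) =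
      if w = z then G.structureConst x y d else 0 := by
    intro d w
    rw [prod_joinExp_two, hmon, coeff_rename_mul embLeft 2 (by decide) (by decide)]
    refine if_congr Iff.rfl ?_ rfl
    rw [structureConst]
    congr 3
    funext b; fin_cases b <;> rfl
  have k2 : ∀ d w : Fin m →₀ ℕ, coeff (joinExp ![x, y, z])
      ((joinExp ![d, w]).prod fun s e => (pairBlocks
        (fun k => X (0, k)) (fun i => rename (blockEmb m embRight) (G.series i)) :
          Fin 2 × Fin m → MvPowerSeries (Fin 3 × Fin m) R) s ^ e) =
      if d = x then G.structureConst y z w else 0 := by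
    intro d w
    rw [prod_joinExp_two, hmon, mul_comm,
      coeff_rename_mul embRight 0 (by decide) (by decide)]
    refine if_congr Iff.rfl ?_ rfl
    rw [structureConst]
    congr 3
    funext b; fin_cases b <;> rfl
  have collapse : ∀ (g : (Fin 2 → (Fin m →₀ ℕ)) → R) (ψ : (Fin m →₀ ℕ) → (Fin 2 → (Fin m →₀ ℕ))),
      Function.Injective ψ → (∀ p, p ∉ Set.range ψ → g p = 0) → ∑ᶠ p, g p = ∑ᶠ d, g (ψ d) := by
    intro g ψ hψ hg
    rw [← finsum_mem_range hψ, ← finsum_mem_univ]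
    apply finsum_mem_inter_support_eq
    ext p
    simp only [Set.univ_inter, Set.mem_inter_iff, Function.mem_support]
    constructor
    · intro h
      refine ⟨?_, h⟩
      by_contra h'
      exact h (hg p h')
    · exact fun h => h.2
  rw [collapse _ (fun d => ![d, z]), collapse _ (fun d => ![x, d])] at key
  · simp only [k1, k2, if_true, smul_eq_mul] at key
    exact (finsum_congr fun d => mul_comm _ _).trans
      (key.trans (finsum_congr fun d => mul_comm _ _))
  · intro d d' h; exact congrFun h 1
  · intro p hp
    rw [e1 p, k2, if_neg, smul_zero]
    rintro rfl
    exact hp ⟨p 1, (e1 p).symm⟩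
  · intro d d' h; exact congrFun h 0
  · intro p hp
    rw [e1 p, k1, if_neg, smul_zero]
    rintro rfl
    exact hp ⟨p 0, (e1 p).symm⟩

end Aux

section Distributions

/-- The continuous dual `D` of the ring of functions `R[[t]]`: a continuous functional `φ` is
recorded by its finitely supported family of values `d ↦ φ(t^d)`. -/
def Distr (_G : FormalGroupLaw R m) : Type u := (Fin m →₀ ℕ) →₀ R

instance : AddCommGroup G.Distr := inferInstanceAs (AddCommGroup ((Fin m →₀ ℕ) →₀ R))

instance : Module R G.Distr := inferInstanceAs (Module R ((Fin m →₀ ℕ) →₀ R))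

/-- The functionals `δ_d`, "coefficient of `t^d`", form a basis of `D`. -/
def deltaBasis : Module.Basis (Fin m →₀ ℕ) R G.Distr := Module.Basis.ofRepr (LinearEquiv.refl R _)

/-- The functional `δ_d`, "coefficient of `t^d`". -/
def delta (d : Fin m →₀ ℕ) : G.Distr := G.deltaBasis d

/-- The value `φ(t^d)`. -/
def value (d : Fin m →₀ ℕ) : G.Distr →ₗ[R] R := G.deltaBasis.coord d

/-- The functional `f ↦ (δ_x ⊗ δ_y)(μ(f))`. -/
def deltaMul (x y : Fin m →₀ ℕ) : G.Distr :=
  G.deltaBasis.repr.symm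
    (Finsupp.ofSupportFinite (fun d => G.structureConst x y d) (G.finite_structureConst x y))

/-- The product of the dual Hopf algebra, `(φ * ψ)(f) = (φ ⊗ ψ)(μ(f))`. -/
def mulLin : G.Distr →ₗ[R] G.Distr →ₗ[R] G.Distr :=
  G.deltaBasis.constr R fun x => G.deltaBasis.constr R fun y => G.deltaMul x y

lemma mulLin_delta (x y : Fin m →₀ ℕ) : G.mulLin (G.delta x) (G.delta y) = G.deltaMul x y := by
  simp only [mulLin, delta, Module.Basis.constr_basis]

lemma value_ext {a b : G.Distr} (h : ∀ d, G.value d a = G.value d b) : a = b :=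
  G.deltaBasis.ext_elem h

lemma value_delta [DecidableEq (Fin m →₀ ℕ)] (d x : Fin m →₀ ℕ) :
    G.value d (G.delta x) = if x = d then 1 else 0 := by
  simp [value, delta, Finsupp.single_apply]

lemma value_deltaMul (x y d : Fin m →₀ ℕ) :
    G.value d (G.deltaMul x y) = G.structureConst x y d := by
  simp only [value, deltaMul, Module.Basis.coord_apply, LinearEquiv.apply_symm_apply]
  rfl

lemma apply_eq_finsum (f : G.Distr →ₗ[R] R) (a : G.Distr) :
    f a = ∑ᶠ d, G.value d a * f (G.delta d) := by
  have h := G.deltaBasis.linearCombination_repr a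
  conv_lhs => rw [← h]
  rw [Finsupp.linearCombination_apply, map_finsuppSum, Finsupp.sum,
    finsum_eq_sum_of_support_subset (s := (G.deltaBasis.repr a).support)]
  · simp [value, delta]
  · intro d hd
    simp only [Finset.mem_coe, Finsupp.mem_support_iff]
    intro h0
    apply hd
    simp [value, h0]

lemma mulLin_assoc (a b c : G.Distr) :
    G.mulLin (G.mulLin a b) c = G.mulLin a (G.mulLin b c) := by
  have h3 : ∀ x y z, G.mulLin (G.mulLin (G.delta x) (G.delta y)) (G.delta z) =
      G.mulLin (G.delta x) (G.mulLin (G.delta y) (G.delta z)) := by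
    intro x y z
    rw [mulLin_delta, mulLin_delta]
    apply G.value_ext
    intro e
    have h1 := G.apply_eq_finsum ((G.value e).comp (G.mulLin.flip (G.delta z))) (G.deltaMul x y)
    have h2 := G.apply_eq_finsum ((G.value e).comp (G.mulLin (G.delta x))) (G.deltaMul y z)
    simp only [LinearMap.comp_apply, LinearMap.flip_apply, mulLin_delta, value_deltaMul] at h1 h2
    rw [h1, h2, structureConst_assoc]
  have h2 : ∀ x y c, G.mulLin (G.mulLin (G.delta x) (G.delta y)) c =
      G.mulLin (G.delta x) (G.mulLin (G.delta y) c) := by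
    intro x y c
    exact LinearMap.congr_fun (G.deltaBasis.ext (f₁ := G.mulLin (G.mulLin (G.delta x) (G.delta y)))
      (f₂ := (G.mulLin (G.delta x)).comp (G.mulLin (G.delta y))) (h3 x y)) c
  have h1 : ∀ x b c, G.mulLin (G.mulLin (G.delta x) b) c =
      G.mulLin (G.delta x) (G.mulLin b c) := by
    intro x b c
    exact LinearMap.congr_fun (G.deltaBasis.ext
      (f₁ := (G.mulLin.flip c).comp (G.mulLin (G.delta x)))
      (f₂ := (G.mulLin (G.delta x)).comp (G.mulLin.flip c)) fun y => h2 x y c) b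
  exact LinearMap.congr_fun (G.deltaBasis.ext
      (f₁ := (G.mulLin.flip c).comp (G.mulLin.flip b))
      (f₂ := G.mulLin.flip (G.mulLin b c)) fun x => h1 x b c) a

lemma delta_zero_mulLin_self : G.mulLin (G.delta 0) (G.delta 0) = G.delta 0 := by
  classical
  rw [mulLin_delta]
  apply G.value_ext
  intro d
  rw [value_deltaMul, G.structureConst_zero_left (by simp), value_delta]

/-- A triangular idempotent endomorphism of `D` is the identity. -/
lemma eq_self_of_triangular (T : G.Distr →ₗ[R] G.Distr) (hT : ∀ a, T (T a) = T a)
    (h : ∀ y d : Fin m →₀ ℕ, y.degree ≤ d.degree →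
      G.value d (T (G.delta y)) = G.value d (G.delta y)) (a : G.Distr) : T a = a := by
  classical
  have hinj : ∀ b, T b = 0 → b = 0 := by
    intro b hb
    by_contra hne
    have hs : (G.deltaBasis.repr b).support.Nonempty := by
      rw [Finsupp.support_nonempty_iff]
      simpa using hne
    obtain ⟨d, hd, hmax⟩ := Finset.exists_max_image _ (fun d => Finsupp.degree d) hs
    have h1 := G.apply_eq_finsum ((G.value d).comp T) b
    have h2 := G.apply_eq_finsum (G.value d) b
    rw [LinearMap.comp_apply, hb, map_zero] at h1
    have h3 : G.value d b = 0 := by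
      rw [h2, h1]
      refine finsum_congr fun y => ?_
      by_cases hy : y ∈ (G.deltaBasis.repr b).support
      · rw [LinearMap.comp_apply, h y d (hmax y hy)]
      · have : G.value y b = 0 := by simpa [value] using hy
        rw [this, zero_mul, zero_mul]
    exact (Finsupp.mem_support_iff.mp hd) h3
  exact sub_eq_zero.mp (hinj _ (by rw [map_sub, hT, sub_self]))

lemma delta_zero_mulLin (a : G.Distr) : G.mulLin (G.delta 0) a = a := by
  classical
  refine G.eq_self_of_triangular (G.mulLin (G.delta 0)) (fun a => ?_) (fun y d h => ?_) a
  · rw [← mulLin_assoc, delta_zero_mulLin_self]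
  · rw [mulLin_delta, value_deltaMul, G.structureConst_zero_left h, value_delta]

lemma mulLin_delta_zero (a : G.Distr) : G.mulLin a (G.delta 0) = a := by
  classical
  refine G.eq_self_of_triangular (G.mulLin.flip (G.delta 0)) (fun a => ?_) (fun y d h => ?_) a
  · rw [LinearMap.flip_apply, LinearMap.flip_apply, mulLin_assoc, delta_zero_mulLin_self]
  · rw [LinearMap.flip_apply, mulLin_delta, value_deltaMul, G.structureConst_zero_right h,
      value_delta]

instance : Ring G.Distr where
  __ := (inferInstance : AddCommGroup G.Distr)
  mul a b := G.mulLin a b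
  one := G.delta 0
  left_distrib a b c := map_add (G.mulLin a) b c
  right_distrib a b c := G.mulLin.map_add₂ a b c
  zero_mul a := G.mulLin.map_zero₂ a
  mul_zero a := map_zero (G.mulLin a)
  mul_assoc := G.mulLin_assoc
  one_mul := G.delta_zero_mulLin
  mul_one := G.mulLin_delta_zero

instance : Algebra R G.Distr :=
  Algebra.ofModule (fun r a b => G.mulLin.map_smul₂ r a b) (fun r a b => map_smul (G.mulLin a) r b)

lemma mul_def (a b : G.Distr) : a * b = G.mulLin a b := rfl

end Distributions

section LieAlgebra

/-- The underlying module of the Lie algebra of `G`: the free module on `e_1, …, e_m`. -/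
def LieAlg (_G : FormalGroupLaw R m) : Type u := Fin m → R

instance : AddCommGroup G.LieAlg := inferInstanceAs (AddCommGroup (Fin m → R))

instance : Module R G.LieAlg := inferInstanceAs (Module R (Fin m → R))

/-- The basis `e_1, …, e_m` of the Lie algebra. -/
def lieBasis : Module.Basis (Fin m) R G.LieAlg := Pi.basisFun R (Fin m)

/-- The bracket, `[e_l, e_k] = ∑_j (γ_{lk}^j - γ_{kl}^j) e_j`. -/
def lieBracket : G.LieAlg →ₗ[R] G.LieAlg →ₗ[R] G.LieAlg :=
  G.lieBasis.constr R fun l => G.lieBasis.constr R fun k =>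
    ∑ j, (G.γ l k j - G.γ k l j) • G.lieBasis j

/-- The pairing `L ↦ (f ↦ L(f))`, sending `e_j` to the functional
`f ↦ (∂f / ∂t^{(j)})(0)`. -/
def tangent : G.LieAlg →ₗ[R] G.Distr :=
  G.lieBasis.constr R fun j => G.delta (Finsupp.single j 1)

lemma tangent_injective : Function.Injective G.tangent := by
  classical
  rw [injective_iff_map_eq_zero]
  intro x hx
  apply G.lieBasis.ext_elem
  intro j
  have := congrArg (G.value (Finsupp.single j 1)) hx
  rw [tangent, Module.Basis.constr_apply_fintype, map_sum] at this
  simpa [value_delta, Finsupp.single_left_inj] using this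

lemma tangent_bracket (x y : G.LieAlg) :
    G.tangent (G.lieBracket x y) = G.tangent x * G.tangent y - G.tangent y * G.tangent x := by
  classical
  have key : ∀ l k, G.tangent (G.lieBracket (G.lieBasis l) (G.lieBasis k)) =
      G.tangent (G.lieBasis l) * G.tangent (G.lieBasis k) -
        G.tangent (G.lieBasis k) * G.tangent (G.lieBasis l) := by
    intro l k
    simp only [lieBracket, tangent, Module.Basis.constr_basis, map_sum, map_smul, mul_def,
      mulLin_delta]
    apply G.value_ext
    intro d
    simp only [map_sum, map_smul, map_sub, value_delta, value_deltaMul, smul_eq_mul]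
    by_cases hd : d.degree = 1
    · obtain ⟨j, d', rfl, hd'⟩ := exists_add_single d 0 hd
      rw [(Finsupp.degree_eq_zero_iff d').mp hd', add_zero]
      simp [Finsupp.single_left_inj, structureConst, monomialImage_single, γ]
    · rw [G.structureConst_comm l k d hd, sub_self]
      refine Finset.sum_eq_zero fun j _ => ?_
      rw [if_neg, mul_zero]
      rintro rfl
      simp at hd
  have h2 : ∀ l y, G.tangent (G.lieBracket (G.lieBasis l) y) =
      G.tangent (G.lieBasis l) * G.tangent y - G.tangent y * G.tangent (G.lieBasis l) := by
    intro l y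
    exact LinearMap.congr_fun (G.lieBasis.ext
      (f₁ := G.tangent.comp (G.lieBracket (G.lieBasis l)))
      (f₂ := (G.mulLin (G.tangent (G.lieBasis l))).comp G.tangent -
        (G.mulLin.flip (G.tangent (G.lieBasis l))).comp G.tangent) (key l)) y
  exact LinearMap.congr_fun (G.lieBasis.ext
      (f₁ := G.tangent.comp (G.lieBracket.flip y))
      (f₂ := (G.mulLin.flip (G.tangent y)).comp G.tangent -
        (G.mulLin (G.tangent y)).comp G.tangent) fun l => h2 l y) x

instance : LieRing G.LieAlg where
  bracket x y := G.lieBracket x y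
  add_lie x y z := G.lieBracket.map_add₂ x y z
  lie_add x y z := map_add (G.lieBracket x) y z
  lie_self x := G.tangent_injective (by
    rw [tangent_bracket, sub_self, map_zero])
  leibniz_lie x y z := G.tangent_injective (by
    change G.tangent (G.lieBracket x (G.lieBracket y z)) =
      G.tangent (G.lieBracket (G.lieBracket x y) z + G.lieBracket y (G.lieBracket x z))
    simp only [map_add, tangent_bracket]
    noncomm_ring)

instance : LieAlgebra R G.LieAlg where
  lie_smul r x y := map_smul (G.lieBracket x) r y

attribute [local instance] LieRing.ofAssociativeRing

/-- The pairing as a morphism of Lie algebras from the Lie algebra of `G` to `D`. -/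
def tangentHom : G.LieAlg →ₗ⁅R⁆ G.Distr where
  __ := G.tangent
  map_lie' {x y} := by
    rw [LieRing.of_associative_ring_bracket]
    exact G.tangent_bracket x y

/-- The universal enveloping algebra of the Lie algebra of `G`. -/
abbrev U : Type u := UniversalEnvelopingAlgebra R G.LieAlg

/-- The algebra morphism `α` from the universal enveloping algebra to `D` induced by the
pairing. -/
def alpha : G.U →ₐ[R] G.Distr := UniversalEnvelopingAlgebra.lift R G.tangentHom

end LieAlgebra

end FormalGroupLaw

section Modified

open MvPowerSeries

variable (R : Type u) [CommRing R] (σ : Type) [Fintype σ]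

/-- The factorial `d! = ∏ d_i!` of a multi-index. -/
def multiFactorial {σ : Type} [Fintype σ] (d : σ →₀ ℕ) : ℕ := ∏ i, (d i).factorial

lemma multiFactorial_add {σ : Type} [Fintype σ] (a b : σ →₀ ℕ) :
    multiFactorial (a + b) = (∏ i, (a i + b i).choose (a i)) *
      (multiFactorial a * multiFactorial b) := by
  simp only [multiFactorial, ← Finset.prod_mul_distrib]
  refine Finset.prod_congr rfl fun i _ => ?_
  rw [← mul_assoc, Finsupp.add_apply,
    ← Nat.choose_mul_factorial_mul_factorial (Nat.le_add_right (a i) (b i)), Nat.add_sub_cancel_left]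

lemma multiFactorial_add_single {σ : Type} [Fintype σ] (d : σ →₀ ℕ) (i : σ) :
    multiFactorial (d + Finsupp.single i 1) = multiFactorial d * (d i + 1) := by
  classical
  simp only [multiFactorial]
  rw [← Finset.mul_prod_erase _ _ (Finset.mem_univ i),
    ← Finset.mul_prod_erase (s := Finset.univ) (f := fun j => (d j).factorial) (a := i)
      (Finset.mem_univ i)]
  have : ∀ j ∈ Finset.univ.erase i, (Nat.factorial ((d + Finsupp.single i 1 : σ →₀ ℕ) j)) =
      (d j).factorial := by
    intro j hj
    simp [(Finset.ne_of_mem_erase hj).symm]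
  rw [Finset.prod_congr rfl this]
  simp [Nat.factorial_succ]
  ring

lemma multiFactorial_ne_zero {σ : Type} [Fintype σ] (d : σ →₀ ℕ) : multiFactorial d ≠ 0 :=
  Finset.prod_ne_zero_iff.mpr fun _ _ => Nat.factorial_ne_zero _

/-- The modified ring of power series: `∑ b_d t^d` over the fraction field of `R` such that
`d! b_d ∈ R` for all `d`.  For the variables `t^{(1)}, …, t^{(m)}` this is the modified ring of
functions; for `n` blocks of `m` variables it is the `n`-fold completed tensor power of the
latter, whose topological basis is formed by the products of the `t_k^{d_k} / d_k!`. -/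
def modifiedSeries : Subalgebra R (MvPowerSeries σ (FractionRing R)) where
  carrier := {f | ∀ d, (multiFactorial d : FractionRing R) * coeff d f ∈
    (algebraMap R (FractionRing R)).range}
  mul_mem' {f g} hf hg d := by
    classical
    rw [coeff_mul, Finset.mul_sum]
    refine Subring.sum_mem _ fun p hp => ?_
    rw [← Finset.HasAntidiagonal.mem_antidiagonal.mp hp, multiFactorial_add]
    have := Subring.mul_mem _ (natCast_mem (algebraMap R (FractionRing R)).range
      (∏ i, (p.1 i + p.2 i).choose (p.1 i))) (Subring.mul_mem _ (hf p.1) (hg p.2))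
    convert this using 1
    push_cast
    ring
  add_mem' {f g} hf hg d := by
    rw [map_add, mul_add]
    exact Subring.add_mem _ (hf d) (hg d)
  algebraMap_mem' r d := by
    classical
    rw [MvPowerSeries.algebraMap_apply, coeff_C]
    refine Subring.mul_mem _ (natCast_mem _ _) ?_
    split_ifs
    · exact ⟨r, rfl⟩
    · exact Subring.zero_mem _

variable {R σ}

lemma map_mem_modifiedSeries (f : MvPowerSeries σ R) :
    MvPowerSeries.map (algebraMap R (FractionRing R)) f ∈ modifiedSeries R σ := by
  intro d
  rw [coeff_map]
  exact Subring.mul_mem _ (natCast_mem _ _) ⟨_, rfl⟩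

variable [IsDomain R] [CharZero R]

/-- Divided powers of series without constant term stay in the modified ring. -/
lemma divPow_mem {g : MvPowerSeries σ (FractionRing R)} (hg : g ∈ modifiedSeries R σ)
    (h0 : constantCoeff g = 0) (k : ℕ) :
    C ((k.factorial : FractionRing R)⁻¹) * g ^ k ∈ modifiedSeries R σ := by
  classical
  induction k with
  | zero => simp
  | succ k ih =>
    intro d
    by_cases hd : d = 0
    · subst hd
      have : coeff (0 : σ →₀ ℕ) (C (((k + 1).factorial : FractionRing R)⁻¹) * g ^ (k + 1)) = 0 := by
        rw [coeff_zero_eq_constantCoeff_apply, map_mul, map_pow, h0, zero_pow (by omega), mul_zero]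
      rw [this, mul_zero]
      exact Subring.zero_mem _
    obtain ⟨i, hi⟩ := Finsupp.ne_iff.mp hd
    have hle : Finsupp.single i 1 ≤ d := by
      rw [Finsupp.single_le_iff]
      have : d i ≠ 0 := hi
      omega
    obtain ⟨e, rfl⟩ : ∃ e, d = e + Finsupp.single i 1 :=
      ⟨d - Finsupp.single i 1, (tsub_add_cancel_of_le hle).symm⟩
    have hder : pderiv (FractionRing R) i g ∈ modifiedSeries R σ := by
      intro d
      have h1 := hg (d + Finsupp.single i 1)
      rw [multiFactorial_add_single] at h1
      rw [coeff_pderiv]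
      convert h1 using 1
      push_cast
      ring
    have h3 := Subalgebra.mul_mem _ ih hder e
    have h4 : pderiv (FractionRing R) i
        (C (((k + 1).factorial : FractionRing R)⁻¹) * g ^ (k + 1)) =
        C ((k.factorial : FractionRing R)⁻¹) * g ^ k * pderiv (FractionRing R) i g := by
      have hk : ((k + 1).factorial : FractionRing R) = (k + 1) * k.factorial := by
        rw [Nat.factorial_succ]; push_cast; ring
      have hne : ((k : FractionRing R) + 1) ≠ 0 := by exact_mod_cast Nat.succ_ne_zero k
      rw [Derivation.leibniz, pderiv_C, smul_zero, add_zero, smul_eq_mul, pderiv_pow, hk,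
        Nat.add_sub_cancel, mul_inv, map_mul]
      have h5 : (C ((k : FractionRing R) + 1)⁻¹ : MvPowerSeries σ (FractionRing R)) *
          ((k + 1 : ℕ) : MvPowerSeries σ (FractionRing R)) = 1 := by
        rw [← map_natCast (C (σ := σ) (R := FractionRing R)), ← map_mul]
        push_cast
        rw [inv_mul_cancel₀ hne, map_one]
      linear_combination (C ((k.factorial : FractionRing R)⁻¹) * g ^ k *
        pderiv (FractionRing R) i g) * h5
    rw [← h4, coeff_pderiv] at h3
    rw [multiFactorial_add_single]
    convert h3 using 1
    push_cast
    ring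

/-- Substituting series of the modified ring without constant term preserves the modified ring. -/
lemma subst_mem_modifiedSeries {τ : Type} [Fintype τ]
    {a : σ → MvPowerSeries τ (FractionRing R)} (ha : ∀ s, a s ∈ modifiedSeries R τ)
    (h0 : ∀ s, constantCoeff (a s) = 0) {f : MvPowerSeries σ (FractionRing R)}
    (hf : f ∈ modifiedSeries R σ) : subst a f ∈ modifiedSeries R τ := by
  classical
  intro e
  rw [coeff_subst (hasSubst_of_constantCoeff_zero h0), mul_finsum]
  refine finsum_induction (· ∈ (algebraMap R (FractionRing R)).range) (Subring.zero_mem _)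
    (fun _ _ => Subring.add_mem _) fun d => ?_
  have h1 : ∏ s, (C (((d s).factorial : FractionRing R)⁻¹) * a s ^ d s) ∈ modifiedSeries R τ :=
    Subalgebra.prod_mem _ fun s _ => divPow_mem (ha s) (h0 s) (d s)
  have h2 := Subring.mul_mem _ (hf d) (h1 e)
  rw [Finset.prod_mul_distrib, ← map_prod, coeff_C_mul, Finset.prod_inv_distrib] at h2
  have hne : (multiFactorial d : FractionRing R) ≠ 0 := by
    exact_mod_cast multiFactorial_ne_zero d
  rw [Finsupp.prod_fintype _ _ (by simp), smul_eq_mul]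
  convert h2 using 1
  have : (∏ i, ((d i).factorial : FractionRing R)) = multiFactorial d := by
    simp [multiFactorial]
  rw [this]
  field_simp

end Modified

namespace LieCochains

section

variable (R : Type u) [CommRing R] (L : Type u) [LieRing L] [LieAlgebra R L]

attribute [local instance] LieRing.ofAssociativeRing

/-- The counit `ε : U(L) → R`, the algebra morphism vanishing on `L`. -/
def counit : UniversalEnvelopingAlgebra R L →ₐ[R] R := UniversalEnvelopingAlgebra.lift R 0

/-- The comultiplication of `U(L)`, the algebra morphism with `x ↦ x ⊗ 1 + 1 ⊗ x` on `L`. -/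
def comul : UniversalEnvelopingAlgebra R L →ₐ[R]
    UniversalEnvelopingAlgebra R L ⊗[R] UniversalEnvelopingAlgebra R L :=
  UniversalEnvelopingAlgebra.lift R
    { toFun := fun x => UniversalEnvelopingAlgebra.ι R x ⊗ₜ[R] 1 +
        1 ⊗ₜ[R] UniversalEnvelopingAlgebra.ι R x
      map_add' := fun x y => by
        simp only [map_add, TensorProduct.add_tmul, TensorProduct.tmul_add]; abel
      map_smul' := fun r x => by
        simp only [map_smul, TensorProduct.smul_tmul', TensorProduct.tmul_smul, smul_add,
          RingHom.id_apply]
      map_lie' := fun {x y} => by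
        simp only [LieHom.map_lie, LieRing.of_associative_ring_bracket, mul_add, add_mul,
          Algebra.TensorProduct.tmul_mul_tmul, mul_one, one_mul, TensorProduct.sub_tmul,
          TensorProduct.tmul_sub]
        abel }

/-- The antipode of `U(L)` as an algebra morphism to the opposite algebra, `x ↦ -x` on `L`. -/
def antipodeOp : UniversalEnvelopingAlgebra R L →ₐ[R] (UniversalEnvelopingAlgebra R L)ᵐᵒᵖ :=
  UniversalEnvelopingAlgebra.lift R
    { toFun := fun x => MulOpposite.op (-UniversalEnvelopingAlgebra.ι R x)
      map_add' := fun x y => by simp only [map_add, neg_add, MulOpposite.op_add]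
      map_smul' := fun r x => by
        simp only [map_smul, RingHom.id_apply, ← MulOpposite.op_smul, smul_neg]
      map_lie' := fun {x y} => by
        simp only [LieHom.map_lie, LieRing.of_associative_ring_bracket, ← MulOpposite.op_mul,
          ← MulOpposite.op_sub, neg_mul_neg, neg_sub] }

/-- The antipode of `U(L)`. -/
def antipode (u : UniversalEnvelopingAlgebra R L) : UniversalEnvelopingAlgebra R L :=
  (antipodeOp R L u).unop

/-- The `n`-fold tensor power of `U(L)` over `R`. -/
abbrev UPow (n : ℕ) : Type u := ⨂[R] _ : Fin n, UniversalEnvelopingAlgebra R L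

/-! ### The inhomogeneous complex -/

/-- `u_1 ⊗ ⋯ ⊗ u_{n+1} ↦ ε(u_1) u_2 ⊗ ⋯ ⊗ u_{n+1}`. -/
def faceFirst (n : ℕ) : UPow R L (n + 1) →ₗ[R] UPow R L n :=
  PiTensorProduct.lift
    (LinearMap.uncurryLeft ((counit R L).toLinearMap.smulRight
      (PiTensorProduct.tprod R (s := fun _ : Fin n => UniversalEnvelopingAlgebra R L))))

/-- `u_1 ⊗ ⋯ ⊗ u_{n+1} ↦ ε(u_{n+1}) u_1 ⊗ ⋯ ⊗ u_n`. -/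
def faceLast (n : ℕ) : UPow R L (n + 1) →ₗ[R] UPow R L n :=
  PiTensorProduct.lift
    (MultilinearMap.uncurryRight
      (((LinearMap.lsmul R (UPow R L n)).comp (counit R L).toLinearMap).flip.compMultilinearMap
        (PiTensorProduct.tprod R (s := fun _ : Fin n => UniversalEnvelopingAlgebra R L))))

lemma faceFirst_tprod (n : ℕ) (u : Fin (n + 1) → UniversalEnvelopingAlgebra R L) :
    faceFirst R L n (PiTensorProduct.tprod R u) =
      counit R L (u 0) • PiTensorProduct.tprod R fun k => u k.succ := by
  simp [faceFirst, Fin.tail_def]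

lemma faceLast_tprod (n : ℕ) (u : Fin (n + 1) → UniversalEnvelopingAlgebra R L) :
    faceLast R L n (PiTensorProduct.tprod R u) =
      counit R L (u (Fin.last n)) • PiTensorProduct.tprod R fun k => u k.castSucc := by
  simp [faceLast, Fin.init_def]

/-- The contraction of the neighbouring entries `u_i`, `u_{i+1}` of `u` to the product
`u_i u_{i+1}`. -/
def mulNeighbours {n : ℕ} (i : Fin n) (u : Fin (n + 1) → UniversalEnvelopingAlgebra R L) (k : Fin n) :
    UniversalEnvelopingAlgebra R L :=
  if k < i then u k.castSucc else if k = i then u k.castSucc * u k.succ else u k.succ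

lemma mulNeighbours_update {n : ℕ} (i : Fin n) [DecidableEq (Fin (n + 1))]
    (u : Fin (n + 1) → UniversalEnvelopingAlgebra R L) (j : Fin (n + 1)) :
    ∃ (k : Fin n) (T : UniversalEnvelopingAlgebra R L →ₗ[R] UniversalEnvelopingAlgebra R L),
      ∀ x, mulNeighbours R L i (Function.update u j x) =
        Function.update (mulNeighbours R L i u) k (T x) := by
  classical
  rcases lt_trichotomy (j : ℕ) i with h | h | h
  · refine ⟨⟨j, by omega⟩, LinearMap.id, fun x => ?_⟩
    funext k
    by_cases hk : k = ⟨j, by omega⟩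
    · subst hk
      rw [Function.update_self, mulNeighbours, if_pos (by exact h)]
      simp
    · have h1 : (k : ℕ) ≠ j := fun h' => hk (Fin.ext h')
      rw [Function.update_of_ne hk, mulNeighbours, mulNeighbours]
      have h2 : k.castSucc ≠ j := fun h' => h1 (by rw [← h']; rfl)
      by_cases hki : k < i
      · rw [if_pos hki, if_pos hki, Function.update_of_ne h2]
      · have h3 : k.succ ≠ j := fun h' => by
          have := congrArg Fin.val h'
          simp only [Fin.val_succ] at this
          have : (i : ℕ) ≤ k := not_lt.mp hki
          omega
        simp [hki, h2, h3]
  · refine ⟨i, LinearMap.mulRight R (u i.succ), fun x => ?_⟩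
    have hj : j = i.castSucc := Fin.ext h
    subst hj
    funext k
    by_cases hk : k = i
    · subst hk
      simp [mulNeighbours, (Fin.castSucc_lt_succ (i := k)).ne']
    · rw [Function.update_of_ne hk, mulNeighbours, mulNeighbours]
      have h2 : k.castSucc ≠ i.castSucc := fun h' => hk (Fin.castSucc_injective _ h')
      by_cases hki : k < i
      · rw [if_pos hki, if_pos hki, Function.update_of_ne h2]
      · have h3 : k.succ ≠ i.castSucc := fun h' => by
          have := congrArg Fin.val h'
          simp only [Fin.val_succ, Fin.val_castSucc] at this
          have : (i : ℕ) ≤ k := not_lt.mp hki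
          omega
        simp [hki, hk, h3]
  · by_cases hj : (j : ℕ) = i + 1
    · refine ⟨i, LinearMap.mulLeft R (u i.castSucc), fun x => ?_⟩
      have hj : j = i.succ := Fin.ext hj
      subst hj
      funext k
      by_cases hk : k = i
      · subst hk
        simp [mulNeighbours, (Fin.castSucc_lt_succ (i := k)).ne]
      · rw [Function.update_of_ne hk, mulNeighbours, mulNeighbours]
        have h3 : k.succ ≠ i.succ := fun h' => hk (Fin.succ_injective _ h')
        by_cases hki : k < i
        · have h2 : k.castSucc ≠ i.succ := fun h' => by
            have := congrArg Fin.val h'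
            simp only [Fin.val_succ, Fin.val_castSucc] at this
            have : (k : ℕ) < i := hki
            omega
          rw [if_pos hki, if_pos hki, Function.update_of_ne h2]
        · simp [hki, hk, h3]
    · refine ⟨⟨j - 1, by omega⟩, LinearMap.id, fun x => ?_⟩
      funext k
      by_cases hk : k = ⟨j - 1, by omega⟩
      · have h4 : k.succ = j := by
          apply Fin.ext
          rw [hk, Fin.val_succ]
          simp only
          omega
        have h5 : ¬ k < i := by
          rw [hk, Fin.lt_def]; simp only; omega
        have h6 : k ≠ i := by
          rintro rfl
          apply hj
          rw [← h4]; rfl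
        rw [hk.symm, Function.update_self, mulNeighbours, if_neg h5, if_neg h6, h4]
        simp
      · have h1 : (k : ℕ) + 1 ≠ j := fun h' => hk (Fin.ext (by simp only; omega))
        rw [Function.update_of_ne hk, mulNeighbours, mulNeighbours]
        have h3 : k.succ ≠ j := fun h' => h1 (by rw [← h']; rfl)
        by_cases hki : k ≤ i
        · have h2 : k.castSucc ≠ j := fun h' => by
            have := congrArg Fin.val h'
            simp only [Fin.val_castSucc] at this
            have : (k : ℕ) ≤ i := hki
            omega
          simp [h2, h3]
        · have : ¬ k < i := fun h => hki h.le
          have : k ≠ i := fun h => hki h.le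
          simp [*]

/-- `u_1 ⊗ ⋯ ⊗ u_{n+1} ↦ u_1 ⊗ ⋯ ⊗ u_i u_{i+1} ⊗ ⋯ ⊗ u_{n+1}`. -/
def faceMul (n : ℕ) (i : Fin n) : UPow R L (n + 1) →ₗ[R] UPow R L n :=
  PiTensorProduct.lift
    { toFun := fun u => PiTensorProduct.tprod R (mulNeighbours R L i u)
      map_update_add' := fun u j x y => by
        obtain ⟨k, T, hT⟩ := mulNeighbours_update R L i u j
        simp only [hT, map_add, MultilinearMap.map_update_add]
      map_update_smul' := fun u j r x => by
        obtain ⟨k, T, hT⟩ := mulNeighbours_update R L i u j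
        simp only [hT, map_smul, MultilinearMap.map_update_smul] }

lemma faceMul_tprod (n : ℕ) (i : Fin n) (u : Fin (n + 1) → UniversalEnvelopingAlgebra R L) :
    faceMul R L n i (PiTensorProduct.tprod R u) =
      PiTensorProduct.tprod R (mulNeighbours R L i u) := by
  simp [faceMul]

/-- The differential `∂_u` of the complex of inhomogeneous cochains `Hom_R(U(L)^{⊗ n}, R)`:
`(∂_u f)(u_1, …, u_{n+1}) = ε(u_1) f(u_2, …, u_{n+1})
  + ∑_{i=1}^n (-1)^i f(u_1, …, u_i u_{i+1}, …, u_{n+1}) + (-1)^{n+1} ε(u_{n+1}) f(u_1, …, u_n)`. -/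
def inhomD (n : ℕ) : Module.Dual R (UPow R L n) →ₗ[R] Module.Dual R (UPow R L (n + 1)) :=
  LinearMap.dualMap (faceFirst R L n + ∑ i : Fin n, (-1 : R) ^ ((i : ℕ) + 1) • faceMul R L n i +
    (-1 : R) ^ (n + 1) • faceLast R L n)

/-! ### `U(L)`-linear functionals -/

/-- `Hom_{U(L)}(U(L) ⊗ N, R)` for an `R`-module `N`, where `U(L)` acts on the first factor of
`U(L) ⊗ N` and acts on `R` through the counit, i.e. `R` is the trivial module. -/
def equivariantDual (N : Type u) [AddCommGroup N] [Module R N] :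
    Submodule R (Module.Dual R (UniversalEnvelopingAlgebra R L ⊗[R] N)) where
  carrier := {F | ∀ (u : UniversalEnvelopingAlgebra R L)
    (x : UniversalEnvelopingAlgebra R L ⊗[R] N), F (u • x) = counit R L u * F x}
  add_mem' {F F'} h h' u x := by
    rw [LinearMap.add_apply, LinearMap.add_apply, h, h', mul_add]
  zero_mem' u x := by simp
  smul_mem' r F h u x := by
    rw [LinearMap.smul_apply, LinearMap.smul_apply, h, smul_eq_mul, smul_eq_mul]; ring

/-- A `U(L)`-linear functional on `U(L) ⊗ N` is the same as a linear functional on `N`: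
`φ` corresponds to `u ⊗ x ↦ ε(u) φ(x)`, and `F` corresponds to `x ↦ F(1 ⊗ x)`. -/
def freeEquiv (N : Type u) [AddCommGroup N] [Module R N] :
    Module.Dual R N ≃ₗ[R] equivariantDual R L N where
  toFun φ := ⟨TensorProduct.lift ((LinearMap.lsmul R (Module.Dual R N)).flip φ ∘ₗ
      (counit R L).toLinearMap), fun u x => by
    induction x with
    | zero => simp
    | add x y hx hy => rw [smul_add, map_add, map_add, hx, hy, mul_add]
    | tmul v x => simp [TensorProduct.smul_tmul', mul_assoc]⟩
  map_add' φ ψ := by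
    ext v x
    simp
  map_smul' r φ := by
    ext v x
    simp
  invFun F := F.1 ∘ₗ TensorProduct.mk R (UniversalEnvelopingAlgebra R L) N 1
  left_inv φ := by
    ext x
    simp
  right_inv F := by
    apply Subtype.ext
    refine TensorProduct.ext' fun v x => ?_
    have := F.2 v (1 ⊗ₜ[R] x)
    rw [TensorProduct.smul_tmul', smul_eq_mul, mul_one] at this
    simp [this]

lemma freeEquiv_apply_tmul (N : Type u) [AddCommGroup N] [Module R N] (φ : Module.Dual R N)
    (v : UniversalEnvelopingAlgebra R L) (x : N) :
    (freeEquiv R L N φ).1 (v ⊗ₜ[R] x) = counit R L v * φ x := by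
  simp [freeEquiv]

lemma freeEquiv_symm_apply (N : Type u) [AddCommGroup N] [Module R N]
    (F : equivariantDual R L N) (x : N) :
    (freeEquiv R L N).symm F x = F.1 (1 ⊗ₜ[R] x) := rfl

/-! ### The homogeneous complex -/

/-- Homogeneous cochains `Hom_{U(L)}(U(L)^{⊗ (n+1)}, R)`, with `U(L)` acting on the first
of the `n + 1` factors. -/
abbrev HomCochain (n : ℕ) : Type u := equivariantDual R L (UPow R L n)

/-- The isomorphism `ι^n` from inhomogeneous to homogeneous cochains,
`ι^n(φ)(u_0, …, u_n) = ε(u_0) φ(u_1, …, u_n)`, with inverse `φ ↦ φ(1, -)`. -/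
def iota (n : ℕ) : Module.Dual R (UPow R L n) ≃ₗ[R] HomCochain R L n := freeEquiv R L (UPow R L n)

/-- The differential `ι^{n+1} ∘ ∂_u ∘ (ι^n)⁻¹` on homogeneous cochains. -/
def homD (n : ℕ) : HomCochain R L n →ₗ[R] HomCochain R L (n + 1) :=
  (iota R L (n + 1)).toLinearMap ∘ₗ inhomD R L n ∘ₗ (iota R L n).symm.toLinearMap

/-! ### The Koszul complex and the Chevalley-Eilenberg complex -/

variable {L}

/-- `∑_{k<l} (-1)^{k+l} [x_k, x_l] ∧ x_1 ∧ ⋯ ∧ x_{n+1}`, with `x_k` and `x_l` omitted from the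
wedge product. -/
def bracketSum : ∀ (n : ℕ), (Fin (n + 1) → L) → ⋀[R]^n L
  | 0, _ => 0
  | n + 1, x => ∑ l : Fin (n + 2), ∑ k : Fin (n + 1), if k.castSucc < l then
      (-1 : R) ^ ((k : ℕ) + (l : ℕ)) • exteriorPower.ιMulti R (n + 1)
        (Fin.cons ⁅x k.castSucc, x l⁆ fun i => x (l.succAbove (k.succAbove i)))
      else 0

variable {m : ℕ} (b : Module.Basis (Fin m) R L)

/-- The increasing tuple `(e_{i_1}, …, e_{i_n})`, `i_1 < ⋯ < i_n`, of basis vectors indexed by an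
`n`-element set `s = {i_1, …, i_n}`. -/
def basisTuple {n : ℕ} (s : Set.powersetCard (Fin m) n) (k : Fin n) : L :=
  b (Set.powersetCard.ofFinEmbEquiv.symm s k)

/-- The linear map `⋀^{n+1} L → ⋀^n L`,
`e_{i_1} ∧ ⋯ ∧ e_{i_{n+1}} ↦ ∑_{k<l} (-1)^{k+l} [e_{i_k}, e_{i_l}] ∧ e_{i_1} ∧ ⋯ ∧ e_{i_{n+1}}`
with `e_{i_k}` and `e_{i_l}` omitted, defined on the basis `i_1 < ⋯ < i_{n+1}`. -/
def bracketMap (n : ℕ) : ⋀[R]^(n + 1) L →ₗ[R] ⋀[R]^n L :=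
  (b.exteriorPower (n + 1)).constr R fun s => bracketSum R n (basisTuple R b s)

/-- The Chevalley-Eilenberg differential on `C^n(L, R) = Hom_R(⋀^n L, R)` for the trivial
module `R`. -/
def ceD (n : ℕ) : Module.Dual R (⋀[R]^n L) →ₗ[R] Module.Dual R (⋀[R]^(n + 1) L) :=
  LinearMap.dualMap (bracketMap R b n)

/-- The linear map `⋀^{n+1} L → U(L) ⊗ ⋀^n L`,
`e_{i_1} ∧ ⋯ ∧ e_{i_{n+1}} ↦ ∑_j (-1)^{j+1} e_{i_j} ⊗ e_{i_1} ∧ ⋯ ∧ e_{i_{n+1}}` with `e_{i_j}`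
omitted, defined on the basis `i_1 < ⋯ < i_{n+1}`. -/
def actionMap (n : ℕ) : ⋀[R]^(n + 1) L →ₗ[R] UniversalEnvelopingAlgebra R L ⊗[R] ⋀[R]^n L :=
  (b.exteriorPower (n + 1)).constr R fun s => ∑ j : Fin (n + 1), (-1 : R) ^ (j : ℕ) •
    (UniversalEnvelopingAlgebra.ι R (basisTuple R b s j) ⊗ₜ[R]
      exteriorPower.ιMulti R n fun i => basisTuple R b s (j.succAbove i))

/-- The differential `V_{n+1}(L) → V_n(L)` of the Koszul complex `V_n(L) = U(L) ⊗ ⋀^n L`,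
`u ⊗ e_{i_1} ∧ ⋯ ∧ e_{i_{n+1}} ↦ ∑_{k<l} (-1)^{k+l} u ⊗ [e_{i_k}, e_{i_l}] ∧ ⋯
  + ∑_j (-1)^{j+1} u e_{i_j} ⊗ ⋯`. -/
def koszulD (n : ℕ) : UniversalEnvelopingAlgebra R L ⊗[R] ⋀[R]^(n + 1) L →ₗ[R]
    UniversalEnvelopingAlgebra R L ⊗[R] ⋀[R]^n L :=
  TensorProduct.lift
    ((LinearMap.lcomp R _ (TensorProduct.mk R (UniversalEnvelopingAlgebra R L) (⋀[R]^n L) 1 ∘ₗ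
      bracketMap R b n + actionMap R b n)) ∘ₗ
        (Algebra.lsmul R R (UniversalEnvelopingAlgebra R L ⊗[R] ⋀[R]^n L)).toLinearMap)

lemma koszulD_tmul (n : ℕ) (u : UniversalEnvelopingAlgebra R L) (x : ⋀[R]^(n + 1) L) :
    koszulD R b n (u ⊗ₜ[R] x) =
      u • (1 ⊗ₜ[R] bracketMap R b n x + actionMap R b n x) := by
  simp [koszulD]

lemma koszulD_smul (n : ℕ) (u : UniversalEnvelopingAlgebra R L)
    (x : UniversalEnvelopingAlgebra R L ⊗[R] ⋀[R]^(n + 1) L) :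
    koszulD R b n (u • x) = u • koszulD R b n x := by
  induction x with
  | zero => simp
  | add x y hx hy => rw [smul_add, map_add, map_add, hx, hy, smul_add]
  | tmul v x =>
    rw [TensorProduct.smul_tmul', koszulD_tmul, koszulD_tmul, smul_eq_mul, mul_smul]

variable (L) in
/-- The cochains `Hom_{U(L)}(V_n(L), R)` of the Koszul complex. -/
abbrev KoszulHom (n : ℕ) : Type u := equivariantDual R L (⋀[R]^n L)

/-- The differential of `Hom_{U(L)}(V_•(L), R)`, composition with that of the Koszul complex. -/
def koszulHomD (n : ℕ) : KoszulHom R L n →ₗ[R] KoszulHom R L (n + 1) :=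
  ((LinearMap.dualMap (koszulD R b n)) ∘ₗ (equivariantDual R L (⋀[R]^n L)).subtype).codRestrict _
    fun F u x => by
      change F.1 (koszulD R b n (u • x)) = _ * F.1 (koszulD R b n x)
      rw [koszulD_smul, F.2]

variable (L) in
/-- The antisymmetrisation `as_n : ⋀^n L → U(L)^{⊗ n}`,
`x_1 ∧ ⋯ ∧ x_n ↦ ∑_α sgn(α) x_{α(1)} ⊗ ⋯ ⊗ x_{α(n)}`. -/
def antisymm (n : ℕ) : ⋀[R]^n L →ₗ[R] UPow R L n :=
  exteriorPower.alternatingMapLinearEquiv (MultilinearMap.alternatization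
    ((PiTensorProduct.tprod R (s := fun _ : Fin n => UniversalEnvelopingAlgebra R L)).compLinearMap
      fun _ => (UniversalEnvelopingAlgebra.ι R : L →ₗ⁅R⁆ UniversalEnvelopingAlgebra R L).toLinearMap))

variable (L) in
/-- The map `ν` from homogeneous cochains to cochains of the Koszul complex, composition with
`id ⊗ as_n : U(L) ⊗ ⋀^n L → U(L) ⊗ U(L)^{⊗ n}`. -/
def nu (n : ℕ) : HomCochain R L n →ₗ[R] KoszulHom R L n :=
  ((LinearMap.dualMap (LinearMap.lTensor (UniversalEnvelopingAlgebra R L) (antisymm R L n))) ∘ₗ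
    (equivariantDual R L (UPow R L n)).subtype).codRestrict _
    fun F u x => by
      have : LinearMap.lTensor (UniversalEnvelopingAlgebra R L) (antisymm R L n) (u • x) =
          u • LinearMap.lTensor (UniversalEnvelopingAlgebra R L) (antisymm R L n) x := by
        induction x with
        | zero => simp
        | add x y hx hy => rw [smul_add, map_add, map_add, hx, hy, smul_add]
        | tmul v x => rw [TensorProduct.smul_tmul', LinearMap.lTensor_tmul,
            LinearMap.lTensor_tmul, TensorProduct.smul_tmul']
      change F.1 (LinearMap.lTensor _ (antisymm R L n) (u • x)) =
        _ * F.1 (LinearMap.lTensor _ (antisymm R L n) x)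
      rw [this, F.2]

variable (L) in
/-- The isomorphism `κ^n : Hom_{U(L)}(V_n(L), R) → Hom_R(⋀^n L, R)`, `f ↦ f(1 ⊗ -)`. -/
def kappa (n : ℕ) : KoszulHom R L n ≃ₗ[R] Module.Dual R (⋀[R]^n L) :=
  (freeEquiv R L (⋀[R]^n L)).symm

end
end LieCochains

namespace FormalGroupLaw

variable {R : Type u} [CommRing R] {m : ℕ} (G : FormalGroupLaw R m)

section Cobar

open MvPowerSeries

variable (A : Type u) [CommRing A] [Algebra R A]

/-- The series `G^{(j)}` with coefficients in the `R`-algebra `A`. -/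
def seriesOver (j : Fin m) : MvPowerSeries (Fin 2 × Fin m) A :=
  MvPowerSeries.map (algebraMap R A) (G.series j)

lemma constantCoeff_seriesOver (j : Fin m) : constantCoeff (G.seriesOver A j) = 0 := by
  rw [seriesOver, constantCoeff_map, G.constantCoeff_series, map_zero]

/-- The tuple `G(P, Q)` for two tuples `P`, `Q` of power series without constant term. -/
def eval {τ : Type} (P Q : Fin m → MvPowerSeries τ A) (j : Fin m) : MvPowerSeries τ A :=
  subst (pairBlocks P Q) (G.seriesOver A j)

/-- The arguments of `f` in the `i`-th coface of `f(t_1, …, t_n)`: it is `f(t_2, …, t_{n+1})` for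
`i = 0`, `f(t_1, …, G(t_i, t_{i+1}), …, t_{n+1})` for `1 ≤ i ≤ n`, and `f(t_1, …, t_n)` for
`i = n + 1`.  The variable `t_k^{(j)}` has index `(k - 1, j)`. -/
def cofaceArgs (n : ℕ) (i : Fin (n + 2)) (q : Fin n × Fin m) :
    MvPowerSeries (Fin (n + 1) × Fin m) A :=
  if (q.1 : ℕ) + 1 < i then X (q.1.castSucc, q.2)
  else if (q.1 : ℕ) + 1 = i then
    G.eval A (fun j => X (q.1.castSucc, j)) (fun j => X (q.1.succ, j)) q.2
  else X (q.1.succ, q.2)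

lemma constantCoeff_cofaceArgs (n : ℕ) (i : Fin (n + 2)) (q : Fin n × Fin m) :
    constantCoeff (G.cofaceArgs A n i q) = 0 := by
  unfold cofaceArgs
  split_ifs
  · simp
  · exact constantCoeff_subst_eq_zero
      (hasSubst_pairBlocks (fun i => by simp) (fun i => by simp))
      (by rintro ⟨b, k⟩; fin_cases b <;> simp [pairBlocks]) (G.constantCoeff_seriesOver A _)
  · simp

lemma hasSubst_cofaceArgs (n : ℕ) (i : Fin (n + 2)) : HasSubst (G.cofaceArgs A n i) :=
  hasSubst_of_constantCoeff_zero (G.constantCoeff_cofaceArgs A n i)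

/-- The `i`-th coface map on `n`-cochains, that is, on power series in `n` blocks of `m`
variables. -/
def coface (n : ℕ) (i : Fin (n + 2)) :
    MvPowerSeries (Fin n × Fin m) A →ₐ[A] MvPowerSeries (Fin (n + 1) × Fin m) A :=
  substAlgHom (G.hasSubst_cofaceArgs A n i)

/-- The differential `∂ = ∑ (-1)^i ∂^i` of the cobar complex, on power series with coefficients in
`A`. -/
def cobarD (n : ℕ) :
    MvPowerSeries (Fin n × Fin m) A →ₗ[R] MvPowerSeries (Fin (n + 1) × Fin m) A :=
  ∑ i : Fin (n + 2), (-1 : R) ^ (i : ℕ) • (G.coface A n i).toLinearMap.restrictScalars R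

/-- Inhomogeneous `n`-cochains `K^n(G, R)`, the `n`-fold completed tensor power of `R[[t]]`. -/
abbrev K (_G : FormalGroupLaw R m) (n : ℕ) : Type u := MvPowerSeries (Fin n × Fin m) R

/-- The modified ring of functions of `G`. -/
abbrev OTilde (_G : FormalGroupLaw R m) : Subalgebra R (MvPowerSeries (Fin m) (FractionRing R)) :=
  modifiedSeries R (Fin m)

/-- The `n`-fold completed tensor power of the modified ring of functions. -/
abbrev KTilde (_G : FormalGroupLaw R m) (n : ℕ) :
    Subalgebra R (MvPowerSeries (Fin n × Fin m) (FractionRing R)) :=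
  modifiedSeries R (Fin n × Fin m)

/-- The pure tensor `f_1 ⊗ ⋯ ⊗ f_n = f_1(t_1) ⋯ f_n(t_n)` of power series in `m` variables. -/
def pureTensor {A : Type u} [CommRing A] {n : ℕ} (f : Fin n → MvPowerSeries (Fin m) A) :
    MvPowerSeries (Fin n × Fin m) A :=
  ∏ i, subst (fun j => X (i, j) : Fin m → MvPowerSeries (Fin n × Fin m) A) (f i)

/-- The inclusion of the cochains of `G` in the modified cochains. -/
def incl (n : ℕ) : G.K n →ₗ[R] G.KTilde n where
  toFun f := ⟨MvPowerSeries.map (algebraMap R (FractionRing R)) f, map_mem_modifiedSeries f⟩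
  map_add' f g := Subtype.ext (map_add _ f g)
  map_smul' r f := by
    apply Subtype.ext
    ext d
    change coeff d (MvPowerSeries.map (algebraMap R (FractionRing R)) (r • f)) =
      r • coeff d (MvPowerSeries.map (algebraMap R (FractionRing R)) f)
    rw [coeff_map, coeff_map, coeff_smul, map_mul, Algebra.smul_def]

lemma seriesOver_mem (j : Fin m) :
    G.seriesOver (FractionRing R) j ∈ modifiedSeries R (Fin 2 × Fin m) :=
  map_mem_modifiedSeries _

lemma X_mem {σ : Type} [Fintype σ] (s : σ) :
    (X s : MvPowerSeries σ (FractionRing R)) ∈ modifiedSeries R σ := by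
  rw [← map_X (algebraMap R (FractionRing R)) s]
  exact map_mem_modifiedSeries _

variable [IsDomain R] [CharZero R]

lemma eval_mem {τ : Type} [Fintype τ] {P Q : Fin m → MvPowerSeries τ (FractionRing R)}
    (hP : ∀ j, P j ∈ modifiedSeries R τ) (hQ : ∀ j, Q j ∈ modifiedSeries R τ)
    (hP0 : ∀ j, constantCoeff (P j) = 0) (hQ0 : ∀ j, constantCoeff (Q j) = 0) (j : Fin m) :
    G.eval (FractionRing R) P Q j ∈ modifiedSeries R τ := by
  refine subst_mem_modifiedSeries ?_ ?_ (G.seriesOver_mem j)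
  · rintro ⟨b, k⟩; fin_cases b
    · exact hP k
    · exact hQ k
  · rintro ⟨b, k⟩; fin_cases b
    · exact hP0 k
    · exact hQ0 k

lemma cofaceArgs_mem (n : ℕ) (i : Fin (n + 2)) (q : Fin n × Fin m) :
    G.cofaceArgs (FractionRing R) n i q ∈ modifiedSeries R (Fin (n + 1) × Fin m) := by
  unfold cofaceArgs
  split_ifs
  · exact X_mem _
  · exact G.eval_mem (fun _ => X_mem _) (fun _ => X_mem _) (by simp) (by simp) _
  · exact X_mem _

lemma cobarD_mem (n : ℕ) (f : G.KTilde n) :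
    G.cobarD (FractionRing R) n f.1 ∈ G.KTilde (n + 1) := by
  rw [cobarD, LinearMap.sum_apply]
  refine Subalgebra.sum_mem _ fun i _ => Subalgebra.smul_mem _ ?_ _
  change G.coface (FractionRing R) n i f.1 ∈ _
  rw [coface, substAlgHom_apply]
  exact subst_mem_modifiedSeries (G.cofaceArgs_mem n i)
    (G.constantCoeff_cofaceArgs (FractionRing R) n i) f.2

/-- The differential of the cobar complex of the modified ring of functions. -/
def cobarTildeD (n : ℕ) : G.KTilde n →ₗ[R] G.KTilde (n + 1) where
  toFun f := ⟨G.cobarD (FractionRing R) n f.1, G.cobarD_mem n f⟩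
  map_add' f g := Subtype.ext (map_add _ f.1 g.1)
  map_smul' r f := Subtype.ext (map_smul (G.cobarD (FractionRing R) n) r f.1)

/-- The comultiplication `μ(f) = f(G(t_1, t_2))` of the modified ring of functions. -/
def comulTilde (f : G.OTilde) : G.KTilde 2 :=
  ⟨subst (G.seriesOver (FractionRing R)) f.1,
    subst_mem_modifiedSeries G.seriesOver_mem (G.constantCoeff_seriesOver _) f.2⟩

/-- The pure tensor `f_1 ⊗ ⋯ ⊗ f_n` of elements of the modified ring. -/
def pureTensorTilde {n : ℕ} (f : Fin n → G.OTilde) : G.KTilde n :=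
  ⟨pureTensor (fun i => (f i).1), Subalgebra.prod_mem _ fun i _ =>
    subst_mem_modifiedSeries (fun _ => X_mem _) (by simp) (f i).2⟩

end Cobar

section Alpha

open MvPowerSeries

/-- The pairing of power series in `n` blocks of `m` variables with `D^{⊗ n}`: the pairing of `f`
with `δ_{p_1} ⊗ ⋯ ⊗ δ_{p_n}` is the coefficient of `t_1^{p_1} ⋯ t_n^{p_n}` in `f`. -/
def pairing (A : Type u) [CommRing A] [Algebra R A] (n : ℕ) :
    MvPowerSeries (Fin n × Fin m) A →ₗ[R] (⨂[R] _ : Fin n, G.Distr) →ₗ[R] A :=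
  ((Basis.piTensorProduct fun _ : Fin n => G.deltaBasis).constr R).toLinearMap ∘ₗ
    LinearMap.pi fun p => (coeff (joinExp p)).restrictScalars R

/-- The functional on `U(𝔤)^{⊗ n}` attached to a power series `f` in `n` blocks of `m` variables,
`u_1 ⊗ ⋯ ⊗ u_n ↦ (α(u_1) ⊗ ⋯ ⊗ α(u_n))(f)`. -/
def dualAlpha (A : Type u) [CommRing A] [Algebra R A] (n : ℕ) :
    MvPowerSeries (Fin n × Fin m) A →ₗ[R] LieCochains.UPow R G.LieAlg n →ₗ[R] A :=
  LinearMap.lcomp R A (PiTensorProduct.map fun _ => G.alpha.toLinearMap) ∘ₗ G.pairing A n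

lemma dualAlpha_tprod (A : Type u) [CommRing A] [Algebra R A] (n : ℕ)
    (f : MvPowerSeries (Fin n × Fin m) A) (u : Fin n → G.U) :
    G.dualAlpha A n f (PiTensorProduct.tprod R u) =
      ((Basis.piTensorProduct fun _ : Fin n => G.deltaBasis).repr
        (PiTensorProduct.tprod R fun i => G.alpha (u i))).sum
          fun p a => a • coeff (joinExp p) f := by
  simp only [dualAlpha, pairing, LinearMap.comp_apply, LinearMap.lcomp_apply,
    PiTensorProduct.map_tprod, LinearEquiv.coe_coe]
  rw [Module.Basis.constr_apply]
  rfl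

/-- The morphism `α^*` in degree `n`, from the `n`-cochains of `G` to
`Hom_R(U(𝔤)^{⊗ n}, R)`. -/
def alphaStar (n : ℕ) : G.K n →ₗ[R] Module.Dual R (LieCochains.UPow R G.LieAlg n) :=
  G.dualAlpha R n

/-- The functional on `U(𝔤)` attached to a power series `f` in `m` variables,
`u ↦ α(u)(f) = ∑ α(u)(t^d) b_d` for `f = ∑ b_d t^d`. -/
def dualAlphaOne (A : Type u) [CommRing A] [Algebra R A] :
    MvPowerSeries (Fin m) A →ₗ[R] G.U →ₗ[R] A :=
  LinearMap.lcomp R A G.alpha.toLinearMap ∘ₗ (G.deltaBasis.constr R).toLinearMap ∘ₗ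
    LinearMap.pi fun d => (coeff d).restrictScalars R

/-- The morphism `α^* : O(G) → U(𝔤)^*`, `f ↦ (u ↦ α(u)(f))`. -/
def alphaStarOne : MvPowerSeries (Fin m) R →ₗ[R] Module.Dual R G.U := G.dualAlphaOne R

variable [IsDomain R] [CharZero R]

lemma dvd_structureConst (x y d : Fin m →₀ ℕ) :
    (multiFactorial d : R) ∣ multiFactorial x * multiFactorial y * G.structureConst x y d := by
  have h1 : ∏ s, (C (((d s).factorial : FractionRing R)⁻¹) *
      G.seriesOver (FractionRing R) s ^ d s) ∈ modifiedSeries R (Fin 2 × Fin m) :=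
    Subalgebra.prod_mem _ fun s _ =>
      divPow_mem (G.seriesOver_mem s) (G.constantCoeff_seriesOver _ s) (d s)
  obtain ⟨r, hr⟩ := h1 (joinExp ![x, y])
  refine ⟨r, FaithfulSMul.algebraMap_injective R (FractionRing R) ?_⟩
  have h2 : ∏ s, G.seriesOver (FractionRing R) s ^ d s =
      MvPowerSeries.map (algebraMap R (FractionRing R)) (G.monomialImage d) := by
    simp [monomialImage, seriesOver, map_prod]
  have h3 : multiFactorial (joinExp ![x, y]) = multiFactorial x * multiFactorial y := by
    simp [multiFactorial, Fintype.prod_prod_type, joinExp_apply]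
  have hne : (multiFactorial d : FractionRing R) ≠ 0 := by
    exact_mod_cast multiFactorial_ne_zero d
  have h4 : (∏ i, ((d i).factorial : FractionRing R)) = multiFactorial d := by
    simp [multiFactorial]
  rw [Finset.prod_mul_distrib, ← map_prod, coeff_C_mul, Finset.prod_inv_distrib, h2, coeff_map,
    h3, h4] at hr
  rw [map_mul, map_mul, map_mul, hr, map_natCast, map_natCast, map_natCast, structureConst]
  push_cast
  field_simp

/-- The distributions `φ` such that `d!` divides `φ(t^d)` for all `d`, i.e. those which are
`R`-valued on the modified ring. -/
def dividedDistr : Subalgebra R G.Distr where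
  carrier := {a | ∀ d, (multiFactorial d : R) ∣ G.value d a}
  mul_mem' {a b} ha hb d := by
    have h1 := G.apply_eq_finsum ((G.value d).comp (G.mulLin.flip b)) a
    simp only [LinearMap.comp_apply, LinearMap.flip_apply] at h1
    rw [mul_def, h1]
    refine finsum_induction (fun z : R => (multiFactorial d : R) ∣ z) (dvd_zero _)
      (fun _ _ => dvd_add) fun x => ?_
    have h2 := G.apply_eq_finsum ((G.value d).comp (G.mulLin (G.delta x))) b
    simp only [LinearMap.comp_apply] at h2
    rw [h2, mul_finsum]
    refine finsum_induction (fun z : R => (multiFactorial d : R) ∣ z) (dvd_zero _)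
      (fun _ _ => dvd_add) fun y => ?_
    rw [mulLin_delta, value_deltaMul]
    obtain ⟨r, hr⟩ := ha x
    obtain ⟨s, hs⟩ := hb y
    rw [hr, hs]
    refine (G.dvd_structureConst x y d).trans ⟨r * s, ?_⟩
    ring
  add_mem' {a b} ha hb d := by
    rw [map_add]
    exact dvd_add (ha d) (hb d)
  algebraMap_mem' r d := by
    classical
    rw [Algebra.algebraMap_eq_smul_one, map_smul]
    change _ ∣ r • G.value d (G.delta 0)
    rw [value_delta]
    split_ifs with h
    · subst h
      simp [multiFactorial]
    · simp

lemma tangent_mem (x : G.LieAlg) : G.tangent x ∈ G.dividedDistr := by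
  classical
  rw [tangent, Module.Basis.constr_apply_fintype]
  refine Subalgebra.sum_mem _ fun j _ => Subalgebra.smul_mem _ ?_ _
  intro d
  rw [value_delta]
  split_ifs with h
  · subst h
    have : multiFactorial (Finsupp.single j 1) = 1 := by
      rw [multiFactorial]
      refine Finset.prod_eq_one fun i _ => ?_
      by_cases hi : i = j
      · subst hi; simp
      · simp [hi]
    simp [this]
  · exact dvd_zero _

attribute [local instance] LieRing.ofAssociativeRing in
lemma alpha_mem (u : G.U) : G.alpha u ∈ G.dividedDistr := by
  let φ : G.LieAlg →ₗ⁅R⁆ G.dividedDistr :=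
    { toFun := fun x => ⟨G.tangent x, G.tangent_mem x⟩
      map_add' := fun x y => Subtype.ext (map_add G.tangent x y)
      map_smul' := fun r x => Subtype.ext (map_smul G.tangent r x)
      map_lie' := fun {x y} => Subtype.ext (G.tangentHom.map_lie x y) }
  have h : G.dividedDistr.val.comp (UniversalEnvelopingAlgebra.lift R φ) = G.alpha := by
    ext x
    simp [alpha, φ]
    rfl
  rw [← h]
  exact (UniversalEnvelopingAlgebra.lift R φ u).2

lemma dualAlpha_mem {n : ℕ} {f : MvPowerSeries (Fin n × Fin m) (FractionRing R)}
    (hf : f ∈ G.KTilde n) (x : LieCochains.UPow R G.LieAlg n) :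
    G.dualAlpha (FractionRing R) n f x ∈ LinearMap.range (Algebra.linearMap R (FractionRing R)) := by
  induction x using PiTensorProduct.induction_on with
  | smul_tprod r u =>
    rw [map_smul, dualAlpha_tprod]
    refine Submodule.smul_mem _ _ (Submodule.sum_mem _ fun p _ => ?_)
    rw [Basis.piTensorProduct_repr_tprod_apply]
    choose c hc using fun i => G.alpha_mem (u i) (p i)
    have h1 : ∏ i, (G.deltaBasis.repr (G.alpha (u i))) (p i) =
        (∏ i, c i) * (multiFactorial (joinExp p) : R) := by
      have h2 : multiFactorial (joinExp p) = ∏ i, multiFactorial (p i) := by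
        simp [multiFactorial, Fintype.prod_prod_type, joinExp_apply]
      rw [h2, Nat.cast_prod, ← Finset.prod_mul_distrib]
      exact Finset.prod_congr rfl fun i _ => (hc i).trans (mul_comm _ _)
    rw [h1]
    change (_ * _ : R) • _ ∈ _
    rw [mul_smul]
    refine Submodule.smul_mem _ _ ?_
    obtain ⟨r, hr⟩ := hf (joinExp p)
    exact ⟨r, by rw [Algebra.linearMap_apply, hr, Algebra.smul_def, map_natCast]⟩
  | add x y hx hy =>
    rw [map_add]
    exact Submodule.add_mem _ hx hy

/-- `R`, as the submodule of its fraction field. -/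
def rangeEquiv (R : Type u) [CommRing R] [IsDomain R] :
    R ≃ₗ[R] LinearMap.range (Algebra.linearMap R (FractionRing R)) :=
  LinearEquiv.ofInjective _ (FaithfulSMul.algebraMap_injective R (FractionRing R))

lemma algebraMap_rangeEquiv_symm (R : Type u) [CommRing R] [IsDomain R]
    (x : LinearMap.range (Algebra.linearMap R (FractionRing R))) :
    algebraMap R (FractionRing R) ((rangeEquiv R).symm x) = x := by
  have h : ((rangeEquiv R) ((rangeEquiv R).symm x)).1 = x.1 := by rw [LinearEquiv.apply_symm_apply]
  exact h

/-- A linear map to the maps with values in the fraction field, whose values lie in `R`, as a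
linear map to the maps with values in `R`. -/
def descend {R : Type u} [CommRing R] [IsDomain R] {M N : Type u} [AddCommGroup M] [Module R M] [AddCommGroup N] [Module R N]
    (F : M →ₗ[R] N →ₗ[R] FractionRing R)
    (hF : ∀ f x, F f x ∈ LinearMap.range (Algebra.linearMap R (FractionRing R))) :
    M →ₗ[R] Module.Dual R N where
  toFun f := (rangeEquiv R).symm.toLinearMap ∘ₗ (F f).codRestrict _ (hF f)
  map_add' f g := by
    ext x
    apply FaithfulSMul.algebraMap_injective R (FractionRing R)
    rw [LinearMap.add_apply, map_add (algebraMap R (FractionRing R))]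
    refine (algebraMap_rangeEquiv_symm R _).trans (Eq.trans ?_ (congrArg₂ (· + ·)
      (algebraMap_rangeEquiv_symm R _) (algebraMap_rangeEquiv_symm R _)).symm)
    exact LinearMap.congr_fun (map_add F f g) x
  map_smul' r f := by
    ext x
    apply FaithfulSMul.algebraMap_injective R (FractionRing R)
    rw [LinearMap.smul_apply, smul_eq_mul, map_mul, ← Algebra.smul_def]
    refine (algebraMap_rangeEquiv_symm R _).trans (Eq.trans ?_ (congrArg (r • ·)
      (algebraMap_rangeEquiv_symm R _)).symm)
    exact LinearMap.congr_fun (map_smul F r f) x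

lemma algebraMap_descend {R : Type u} [CommRing R] [IsDomain R] {M N : Type u} [AddCommGroup M] [Module R M] [AddCommGroup N]
    [Module R N] (F : M →ₗ[R] N →ₗ[R] FractionRing R)
    (hF : ∀ f x, F f x ∈ LinearMap.range (Algebra.linearMap R (FractionRing R))) (f : M) (x : N) :
    algebraMap R (FractionRing R) (descend F hF f x) = F f x :=
  algebraMap_rangeEquiv_symm R _

/-- The map `α̃^*` in degree `n`, from the modified `n`-cochains to `Hom_R(U(𝔤)^{⊗ n}, R)`,
`f ↦ (u_1 ⊗ ⋯ ⊗ u_n ↦ (α(u_1) ⊗ ⋯ ⊗ α(u_n))(f))`; these values lie in `R`. -/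
def alphaTilde (n : ℕ) : G.KTilde n →ₗ[R] Module.Dual R (LieCochains.UPow R G.LieAlg n) :=
  descend (G.dualAlpha (FractionRing R) n ∘ₗ (Subalgebra.toSubmodule (G.KTilde n)).subtype)
    fun f => G.dualAlpha_mem f.2

lemma dualAlphaOne_mem {f : MvPowerSeries (Fin m) (FractionRing R)} (hf : f ∈ G.OTilde)
    (u : G.U) : G.dualAlphaOne (FractionRing R) f u ∈
      LinearMap.range (Algebra.linearMap R (FractionRing R)) := by
  change (G.deltaBasis.constr R _) (G.alpha u) ∈ _
  rw [Module.Basis.constr_apply]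
  refine Submodule.sum_mem _ fun d _ => ?_
  obtain ⟨c, hc⟩ := G.alpha_mem u d
  have h1 : (G.deltaBasis.repr (G.alpha u)) d = c * (multiFactorial d : R) :=
    hc.trans (mul_comm _ _)
  rw [h1]
  change (_ * _ : R) • _ ∈ _
  rw [mul_smul]
  refine Submodule.smul_mem _ _ ?_
  obtain ⟨r, hr⟩ := hf d
  exact ⟨r, by rw [Algebra.linearMap_apply, hr, Algebra.smul_def, map_natCast]; rfl⟩

/-- The map `α̃^* : Õ(G) → U(𝔤)^*`, `f ↦ (u ↦ α(u)(f))`; these values lie in `R`. -/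
def alphaTildeOne : G.OTilde →ₗ[R] Module.Dual R G.U :=
  descend (G.dualAlphaOne (FractionRing R) ∘ₗ (Subalgebra.toSubmodule G.OTilde).subtype)
    fun f => G.dualAlphaOne_mem f.2

end Alpha

section HopfIso

variable [IsDomain R] [CharZero R]

/-- The ordered monomial `e_1^{j_1} ⋯ e_m^{j_m}` in `U(𝔤)`. -/
def pbwMonomial (j : Fin m →₀ ℕ) : G.U :=
  (List.ofFn fun i => UniversalEnvelopingAlgebra.ι R (G.lieBasis i) ^ j i).prod

/-- `s` is the tuple of power series without constant term with `G(t, s(t)) = 0`. -/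
def IsInverseSeries (s : Fin m → MvPowerSeries (Fin m) R) : Prop :=
  (∀ j, MvPowerSeries.constantCoeff (s j) = 0) ∧
    ∀ j, G.eval R (fun i => MvPowerSeries.X i) s j = 0

/-- The map `α̃^* : Õ(G) → U(𝔤)^*` is an isomorphism of complete Hopf algebras which is induced by
the pairing of `𝔤` with `Õ(G)`. -/
structure AlphaIsHopfIso : Prop where
  /-- `α̃^*` is bijective. -/
  bijective : Function.Bijective G.alphaTildeOne
  /-- `α̃^*(f)(L) = L(f) = ∑ r_j (∂f / ∂t^{(j)})(0)` for `L = ∑ r_j e_j` in `𝔤`. -/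
  pairing : ∀ (f : G.OTilde) (x : G.LieAlg),
    algebraMap R (FractionRing R) (G.alphaTildeOne f (UniversalEnvelopingAlgebra.ι R x)) =
      ∑ j, algebraMap R (FractionRing R) (G.lieBasis.repr x j) *
        MvPowerSeries.coeff (Finsupp.single j 1) f.1
  /-- `α̃^*` respects the units: the unit of `U(𝔤)^*` is the counit of `U(𝔤)`. -/
  unit : G.alphaTildeOne 1 = (LieCochains.counit R G.LieAlg).toLinearMap
  /-- `α̃^*` respects the products: that of `U(𝔤)^*` is dual to the comultiplication of
  `U(𝔤)`. -/
  mul : ∀ (f g : G.OTilde) (u : G.U), G.alphaTildeOne (f * g) u =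
    LinearMap.mul' R R (TensorProduct.map (G.alphaTildeOne f) (G.alphaTildeOne g)
      (LieCochains.comul R G.LieAlg u))
  /-- `α̃^*` respects the counits: that of `U(𝔤)^*` is the evaluation at `1`. -/
  counit : ∀ f : G.OTilde, algebraMap R (FractionRing R) (G.alphaTildeOne f 1) =
    MvPowerSeries.constantCoeff f.1
  /-- `α̃^*` respects the comultiplications: that of `U(𝔤)^*` is dual to the product of
  `U(𝔤)`. -/
  comul : ∀ (f : G.OTilde) (u v : G.U),
    G.alphaTilde 2 (G.comulTilde f) (PiTensorProduct.tprod R ![u, v]) = G.alphaTildeOne f (u * v)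
  /-- `α̃^*` respects the antipodes, `f ↦ f ∘ s` and `φ ↦ φ ∘ S`. -/
  antipode : ∃ s, G.IsInverseSeries s ∧ ∀ f : G.OTilde, ∃ g : G.OTilde,
    g.1 = MvPowerSeries.subst
      (fun j => MvPowerSeries.map (algebraMap R (FractionRing R)) (s j)) f.1 ∧
    ∀ u : G.U, G.alphaTildeOne g u = G.alphaTildeOne f (LieCochains.antipode R G.LieAlg u)
  /-- `α̃^*` is a homeomorphism, in the strong form that it identifies the filtration of `Õ(G)` by
  the total degree with the filtration of `U(𝔤)^*` by the functionals vanishing on all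
  `e_1^{j_1} ⋯ e_m^{j_m}` with `|j| < i`. -/
  filtration : ∀ (f : G.OTilde) (i : ℕ),
    (∀ d : Fin m →₀ ℕ, d.degree < i → MvPowerSeries.coeff d f.1 = 0) ↔
      ∀ j : Fin m →₀ ℕ, j.degree < i → G.alphaTildeOne f (G.pbwMonomial j) = 0

end HopfIso

section Phi

/-- Inhomogeneous cochains `Hom_R(U(𝔤)^{⊗ n}, R)`. -/
abbrev InhomCochain (n : ℕ) : Type u := Module.Dual R (LieCochains.UPow R G.LieAlg n)

/-- Homogeneous cochains `Hom_{U(𝔤)}(U(𝔤)^{⊗ (n+1)}, R)`. -/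
abbrev HomCochain (n : ℕ) : Type u := LieCochains.HomCochain R G.LieAlg n

/-- Cochains `Hom_{U(𝔤)}(V_n(𝔤), R)` of the Koszul complex. -/
abbrev KoszulCochain (n : ℕ) : Type u := LieCochains.KoszulHom R G.LieAlg n

/-- Cochains `C^n(𝔤, R) = Hom_R(⋀^n 𝔤, R)` of the Lie algebra. -/
abbrev LieCochain (n : ℕ) : Type u := Module.Dual R (⋀[R]^n G.LieAlg)

/-- The differential `∂_u` of the inhomogeneous complex of `U(𝔤)`. -/
def inhomD (n : ℕ) : G.InhomCochain n →ₗ[R] G.InhomCochain (n + 1) :=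
  LieCochains.inhomD R G.LieAlg n

/-- The differential of the homogeneous complex of `U(𝔤)`. -/
def homD (n : ℕ) : G.HomCochain n →ₗ[R] G.HomCochain (n + 1) := LieCochains.homD R G.LieAlg n

/-- The differential of `Hom_{U(𝔤)}(V_•(𝔤), R)`. -/
def koszulD (n : ℕ) : G.KoszulCochain n →ₗ[R] G.KoszulCochain (n + 1) :=
  LieCochains.koszulHomD R G.lieBasis n

/-- The Chevalley-Eilenberg differential of `C^•(𝔤, R)`. -/
def ceD (n : ℕ) : G.LieCochain n →ₗ[R] G.LieCochain (n + 1) := LieCochains.ceD R G.lieBasis n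

/-- The map `ι` from inhomogeneous to homogeneous cochains. -/
def iota (n : ℕ) : G.InhomCochain n →ₗ[R] G.HomCochain n :=
  (LieCochains.iota R G.LieAlg n).toLinearMap

/-- The map `ν` from homogeneous cochains to cochains of the Koszul complex. -/
def nu (n : ℕ) : G.HomCochain n →ₗ[R] G.KoszulCochain n := LieCochains.nu R G.LieAlg n

/-- The map `κ` from cochains of the Koszul complex to `C^n(𝔤, R)`. -/
def kappa (n : ℕ) : G.KoszulCochain n →ₗ[R] G.LieCochain n :=
  (LieCochains.kappa R G.LieAlg n).toLinearMap

/-- The map `φ = κ ∘ ν ∘ ι ∘ α^*` in degree `n`. -/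
def phi (n : ℕ) : G.K n →ₗ[R] G.LieCochain n :=
  G.kappa n ∘ₗ G.nu n ∘ₗ G.iota n ∘ₗ G.alphaStar n

end Phi

end FormalGroupLaw

section Complexes

open CategoryTheory

variable {R : Type u} [CommRing R]

/-- The cochain complex of `R`-modules given by a sequence of linear maps with `d ∘ d = 0`. -/
def toComplex (X : ℕ → Type u) [∀ n, AddCommGroup (X n)] [∀ n, Module R (X n)]
    (d : ∀ n, X n →ₗ[R] X (n + 1)) (h : ∀ n, d (n + 1) ∘ₗ d n = 0) :
    CochainComplex (ModuleCat.{u} R) ℕ :=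
  CochainComplex.of (fun n => ModuleCat.of R (X n)) (fun n => ModuleCat.ofHom (d n)) fun n => by
    rw [← ModuleCat.ofHom_comp, h]; rfl

lemma toComplex_d (X : ℕ → Type u) [∀ n, AddCommGroup (X n)] [∀ n, Module R (X n)]
    (d : ∀ n, X n →ₗ[R] X (n + 1)) (h : ∀ n, d (n + 1) ∘ₗ d n = 0) (n : ℕ) :
    (toComplex X d h).d n (n + 1) = ModuleCat.ofHom (d n) :=
  CochainComplex.of_d (fun n => ModuleCat.of R (X n)) (fun n => ModuleCat.ofHom (d n)) n

variable {X Y : ℕ → Type u} [∀ n, AddCommGroup (X n)] [∀ n, Module R (X n)]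
  [∀ n, AddCommGroup (Y n)] [∀ n, Module R (Y n)]
  {dX : ∀ n, X n →ₗ[R] X (n + 1)} {dY : ∀ n, Y n →ₗ[R] Y (n + 1)}

/-- The morphism of cochain complexes given by linear maps commuting with the differentials. -/
def toHom (hX : ∀ n, dX (n + 1) ∘ₗ dX n = 0) (hY : ∀ n, dY (n + 1) ∘ₗ dY n = 0)
    (f : ∀ n, X n →ₗ[R] Y n) (comm : ∀ n, f (n + 1) ∘ₗ dX n = dY n ∘ₗ f n) :
    toComplex X dX hX ⟶ toComplex Y dY hY :=
  CochainComplex.ofHom (fun n => ModuleCat.ofHom (f n)) fun n => by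
    refine (congrArg (ModuleCat.ofHom (f n) ≫ ·) (toComplex_d Y dY hY n)).trans (Eq.trans ?_
      (congrArg (· ≫ ModuleCat.ofHom (f (n + 1))) (toComplex_d X dX hX n)).symm)
    change ModuleCat.ofHom (f n) ≫ ModuleCat.ofHom (dY n) =
      ModuleCat.ofHom (dX n) ≫ ModuleCat.ofHom (f (n + 1))
    rw [← ModuleCat.ofHom_comp, ← ModuleCat.ofHom_comp, comm]

end Complexes

namespace FormalGroupLaw

open CategoryTheory

variable {R : Type u} [CommRing R] {m : ℕ} (G : FormalGroupLaw R m)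

/-- The cobar complex `(K^•(G, R), ∂)`. -/
def cobarComplex (h : ∀ n, G.cobarD R (n + 1) ∘ₗ G.cobarD R n = 0) :
    CochainComplex (ModuleCat.{u} R) ℕ := toComplex G.K (G.cobarD R) h

/-- The complex `(Hom_R(U^•, R), ∂_u)` of inhomogeneous cochains. -/
def inhomComplex (h : ∀ n, G.inhomD (n + 1) ∘ₗ G.inhomD n = 0) :
    CochainComplex (ModuleCat.{u} R) ℕ := toComplex G.InhomCochain G.inhomD h

/-- The complex of homogeneous cochains. -/
def homComplex (h : ∀ n, G.homD (n + 1) ∘ₗ G.homD n = 0) :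
    CochainComplex (ModuleCat.{u} R) ℕ := toComplex G.HomCochain G.homD h

/-- The complex `(Hom_{U(𝔤)}(V(𝔤)^•, R), d)`. -/
def koszulComplex (h : ∀ n, G.koszulD (n + 1) ∘ₗ G.koszulD n = 0) :
    CochainComplex (ModuleCat.{u} R) ℕ := toComplex G.KoszulCochain G.koszulD h

/-- The Chevalley-Eilenberg complex `(C^•(𝔤, R), ∂')`. -/
def ceComplex (h : ∀ n, G.ceD (n + 1) ∘ₗ G.ceD n = 0) :
    CochainComplex (ModuleCat.{u} R) ℕ := toComplex G.LieCochain G.ceD h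

/-- The morphism of complexes `ι`. -/
def iotaHom (hU : ∀ n, G.inhomD (n + 1) ∘ₗ G.inhomD n = 0)
    (hUh : ∀ n, G.homD (n + 1) ∘ₗ G.homD n = 0)
    (c : ∀ n, G.iota (n + 1) ∘ₗ G.inhomD n = G.homD n ∘ₗ G.iota n) :
    G.inhomComplex hU ⟶ G.homComplex hUh :=
  toHom (X := G.InhomCochain) (Y := G.HomCochain) hU hUh G.iota c

/-- The morphism of complexes `ν`. -/
def nuHom (hUh : ∀ n, G.homD (n + 1) ∘ₗ G.homD n = 0)
    (hV : ∀ n, G.koszulD (n + 1) ∘ₗ G.koszulD n = 0)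
    (c : ∀ n, G.nu (n + 1) ∘ₗ G.homD n = G.koszulD n ∘ₗ G.nu n) :
    G.homComplex hUh ⟶ G.koszulComplex hV :=
  toHom (X := G.HomCochain) (Y := G.KoszulCochain) hUh hV G.nu c

/-- The morphism of complexes `κ`. -/
def kappaHom (hV : ∀ n, G.koszulD (n + 1) ∘ₗ G.koszulD n = 0)
    (hC : ∀ n, G.ceD (n + 1) ∘ₗ G.ceD n = 0)
    (c : ∀ n, G.kappa (n + 1) ∘ₗ G.koszulD n = G.ceD n ∘ₗ G.kappa n) :
    G.koszulComplex hV ⟶ G.ceComplex hC :=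
  toHom (X := G.KoszulCochain) (Y := G.LieCochain) hV hC G.kappa c

/-- The morphism of complexes `φ`. -/
def phiHom (hK : ∀ n, G.cobarD R (n + 1) ∘ₗ G.cobarD R n = 0)
    (hC : ∀ n, G.ceD (n + 1) ∘ₗ G.ceD n = 0)
    (c : ∀ n, G.phi (n + 1) ∘ₗ G.cobarD R n = G.ceD n ∘ₗ G.phi n) :
    G.cobarComplex hK ⟶ G.ceComplex hC :=
  toHom (X := G.K) (Y := G.LieCochain) hK hC G.phi c

variable [IsDomain R] [CharZero R]

/-- The cobar complex `(K̃^•(G, R), ∂)` of the modified ring of functions. -/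
def cobarTildeComplex (h : ∀ n, G.cobarTildeD (n + 1) ∘ₗ G.cobarTildeD n = 0) :
    CochainComplex (ModuleCat.{u} R) ℕ := toComplex (fun n => G.KTilde n) G.cobarTildeD h

/-- The inclusion of the cobar complex in the modified cobar complex. -/
def inclHom (hK : ∀ n, G.cobarD R (n + 1) ∘ₗ G.cobarD R n = 0)
    (hKt : ∀ n, G.cobarTildeD (n + 1) ∘ₗ G.cobarTildeD n = 0)
    (c : ∀ n, G.incl (n + 1) ∘ₗ G.cobarD R n = G.cobarTildeD n ∘ₗ G.incl n) :
    G.cobarComplex hK ⟶ G.cobarTildeComplex hKt :=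
  toHom (X := G.K) (Y := fun n => G.KTilde n) hK hKt G.incl c

/-- The morphism of complexes induced by `α̃^*`. -/
def alphaTildeHom (hKt : ∀ n, G.cobarTildeD (n + 1) ∘ₗ G.cobarTildeD n = 0)
    (hU : ∀ n, G.inhomD (n + 1) ∘ₗ G.inhomD n = 0)
    (c : ∀ n, G.alphaTilde (n + 1) ∘ₗ G.cobarTildeD n = G.inhomD n ∘ₗ G.alphaTilde n) :
    G.cobarTildeComplex hKt ⟶ G.inhomComplex hU :=
  toHom (X := fun n => G.KTilde n) (Y := G.InhomCochain) hKt hU G.alphaTilde c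

end FormalGroupLaw

end

open CategoryTheory

/-! Everything rests on one triangularity. The module `G.Distr` has the basis of functionals δ_d,
"coefficient of t^d", and in its lowest degree |d| the series G(X,Y)^d agrees with (X+Y)^d. Hence α
maps an ordered monomial e^j to j! δ_j plus terms δ_d with |d| < |j| (`value_alpha_pbwMonomial`).
Over a domain of characteristic zero the images of the ordered monomials are therefore independent,
which proves the Poincaré–Birkhoff–Witt theorem for the Lie algebra of G and the injectivity of α
together. The image of α is the lattice spanned by the d! δ_d: it is contained in it by `alpha_mem`,
and conversely the lower terms of α(e^d) are integral multiples of elements already reached, so they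
can be subtracted (`exists_alpha_eq`). In the resulting basis `divBasis` of U, a functional is a
free choice of the numbers d! b_d in R, and such a choice is exactly an element of the modified
ring. The same count in n blocks of variables gives `alphaTilde_bijective`.

The coefficients of G(X,Y)^d are the structure constants of the product of distributions. So the
cofaces of the cobar complex are transposes of the faces of tensor powers of U (`dualAlpha_cobarD`),
α̃^* commutes with the differentials, and the square of the cobar differential vanishes because that
of the bar differential does. For the remaining Hopf structure, translation by an element of the Lie
algebra is the transpose of left multiplication and is a derivation. This makes multiplication of
series dual to the coproduct (`dualAlphaOne_mul`), and evaluating f(G(t, s(t))) = f(0) on suitable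
tensors gives the antipode.

For ν, homogeneous cochains are the U-linear functionals on the bar resolution and Koszul cochains
those on V; ν is the transpose of the antisymmetrisation `koszulToBar`. The latter is a chain map
because the two orders of a product of neighbours occur with opposite signs and leave a bracket
(`barRest_antisymm`). The bar complex has a contracting homotopy. The Koszul complex is exact
because, for the filtration by the degree of the ordered monomial, its leading part is the Koszul
complex of a polynomial ring, which has a homotopy without denominators (`koszulHtpy_top_add`). Both
complexes consist of projective U-modules and agree in degree zero, so antisymmetrisation is a
homotopy equivalence, and this survives passage to U-linear functionals. -/

noncomputable section

/-! ### Induction on the enveloping algebra -/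

namespace UniversalEnvelopingAlgebra

variable {R : Type u} [CommRing R] {L : Type u} [LieRing L] [LieAlgebra R L]

attribute [local instance] LieRing.ofAssociativeRing in
/-- A submodule of `U(L)` containing `1` and stable under left multiplication by `L` is all of
`U(L)`. -/
theorem mem_of_stable (p : Submodule R (UniversalEnvelopingAlgebra R L)) (h1 : 1 ∈ p)
    (hmul : ∀ (x : L), ∀ u ∈ p, ι R x * u ∈ p) (u : UniversalEnvelopingAlgebra R L) : u ∈ p := by
  -- The elements whose left multiplication preserves `p` form a subalgebra containing the image of
  -- `L`. By the universal property the inclusion of `S` has a section, so `S` is everything; then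
  -- each element is applied to `1 ∈ p`.
  let S : Subalgebra R (UniversalEnvelopingAlgebra R L) :=
    { carrier := {a | ∀ u ∈ p, a * u ∈ p}
      mul_mem' := fun {a b} ha hb u hu => by rw [mul_assoc]; exact ha _ (hb _ hu)
      add_mem' := fun {a b} ha hb u hu => by rw [add_mul]; exact p.add_mem (ha _ hu) (hb _ hu)
      algebraMap_mem' := fun r u hu => by
        rw [← Algebra.smul_def]; exact p.smul_mem r hu }
  let φ : L →ₗ⁅R⁆ S :=
    { toFun := fun x => ⟨ι R x, hmul x⟩
      map_add' := fun x y => Subtype.ext (map_add _ x y)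
      map_smul' := fun r x => Subtype.ext (map_smul _ r x)
      map_lie' := fun {x y} => Subtype.ext (LieHom.map_lie (ι R) x y) }
  have h : S.val.comp (lift R φ) = AlgHom.id R _ := by
    ext x
    simp [φ]
  have h2 : u ∈ S := by
    rw [show u = S.val (lift R φ u) from (DFunLike.congr_fun h u).symm]
    exact (lift R φ u).2
  simpa using h2 1 h1

end UniversalEnvelopingAlgebra

namespace FormalGroupLaw

variable {R : Type u} [CommRing R] {m : ℕ} (G : FormalGroupLaw R m)

/-! ### Words in the generators and ordered monomials -/

section Words

/-- The generator `e_i` of `U(𝔤)`. -/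
def gen (i : Fin m) : G.U := UniversalEnvelopingAlgebra.ι R (G.lieBasis i)

/-- The product of generators along a list. -/
def word (l : List (Fin m)) : G.U := (l.map G.gen).prod

@[simp] lemma word_nil : G.word [] = 1 := rfl

@[simp] lemma word_cons (i : Fin m) (l : List (Fin m)) : G.word (i :: l) = G.gen i * G.word l := by
  simp [word]

lemma word_append (l l' : List (Fin m)) : G.word (l ++ l') = G.word l * G.word l' := by
  simp [word]

/-- The span of the products of at most `n` generators. -/
def filt (n : ℕ) : Submodule R G.U := Submodule.span R (G.word '' {l | l.length ≤ n})

lemma word_mem_filt {n : ℕ} {l : List (Fin m)} (h : l.length ≤ n) : G.word l ∈ G.filt n :=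
  Submodule.subset_span ⟨l, h, rfl⟩

lemma filt_mono {a b : ℕ} (h : a ≤ b) : G.filt a ≤ G.filt b :=
  Submodule.span_mono (Set.image_mono fun _ hl => le_trans hl h)

lemma mul_mem_filt {a b : ℕ} {u v : G.U} (hu : u ∈ G.filt a) (hv : v ∈ G.filt b) :
    u * v ∈ G.filt (a + b) := by
  induction hu using Submodule.span_induction with
  | mem x hx =>
    obtain ⟨l, hl, rfl⟩ := hx
    induction hv using Submodule.span_induction with
    | mem y hy =>
      obtain ⟨l', hl', rfl⟩ := hy
      rw [← word_append]
      refine G.word_mem_filt ?_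
      have h1 : l.length ≤ a := hl
      have h2 : l'.length ≤ b := hl'
      rw [List.length_append]
      omega
    | zero => simp
    | add y z _ _ hy hz => rw [mul_add]; exact Submodule.add_mem _ hy hz
    | smul r y _ hy => rw [mul_smul_comm]; exact Submodule.smul_mem _ _ hy
  | zero => simp
  | add y z _ _ hy hz => rw [add_mul]; exact Submodule.add_mem _ hy hz
  | smul r y _ hy => rw [smul_mul_assoc]; exact Submodule.smul_mem _ _ hy

lemma ι_mem_filt (x : G.LieAlg) : UniversalEnvelopingAlgebra.ι R x ∈ G.filt 1 := by
  rw [← G.lieBasis.sum_repr x, map_sum]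
  refine Submodule.sum_mem _ fun i _ => ?_
  rw [map_smul]
  refine Submodule.smul_mem _ _ ?_
  have := G.word_mem_filt (n := 1) (l := [i]) (by simp)
  simpa [gen] using this

-- Exchanging two neighbouring generators changes a word by a word with their bracket in place of
-- the pair, which is one letter shorter. The truncated `l.length - 1` is harmless for the empty
-- word, where the difference is zero.
attribute [local instance] LieRing.ofAssociativeRing in
lemma word_perm {l l' : List (Fin m)} (h : l.Perm l') :
    G.word l - G.word l' ∈ G.filt (l.length - 1) := by
  induction h with
  | nil => simp
  | @cons x l₁ l₂ h ih =>
    rw [word_cons, word_cons, ← mul_sub]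
    -- The empty tail is separate because `1 + (l₁.length - 1)` equals `l₁.length` only for a
    -- nonempty list.
    by_cases h0 : l₁ = []
    · subst h0
      rw [List.nil_perm] at h
      subst h
      simp
    · have h1 := List.length_pos_iff.mpr h0
      have := G.mul_mem_filt (G.ι_mem_filt (G.lieBasis x)) ih
      rw [List.length_cons, show l₁.length + 1 - 1 = 1 + (l₁.length - 1) by omega]
      exact this
  | swap x y l =>
    have h1 : G.word (y :: x :: l) - G.word (x :: y :: l) =
        UniversalEnvelopingAlgebra.ι R ⁅G.lieBasis y, G.lieBasis x⁆ * G.word l := by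
      simp only [word_cons, LieHom.map_lie, LieRing.of_associative_ring_bracket, gen]
      noncomm_ring
    rw [h1]
    have := G.mul_mem_filt (G.ι_mem_filt ⁅G.lieBasis y, G.lieBasis x⁆)
      (G.word_mem_filt (le_refl l.length))
    refine G.filt_mono ?_ this
    simp only [List.length_cons]
    omega
  | trans h₁ h₂ ih₁ ih₂ =>
    rw [← sub_add_sub_cancel]
    refine Submodule.add_mem _ ih₁ ?_
    rw [h₁.length_eq]
    exact ih₂

/-- The exponent of the monomial attached to a list. -/
def content (l : List (Fin m)) : Fin m →₀ ℕ := (l.map fun i => Finsupp.single i 1).sum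

@[simp] lemma content_nil : content ([] : List (Fin m)) = 0 := rfl

@[simp] lemma content_cons (i : Fin m) (l : List (Fin m)) :
    content (i :: l) = Finsupp.single i 1 + content l := by
  simp [content]

lemma content_apply (l : List (Fin m)) (i : Fin m) : content l i = l.count i := by
  classical
  induction l with
  | nil => rfl
  | cons j l ih =>
    rw [content_cons, Finsupp.add_apply, ih, List.count_cons, Finsupp.single_apply]
    simp [add_comm]

lemma degree_content (l : List (Fin m)) : (content l).degree = l.length := by
  induction l with
  | nil => simp
  | cons j l ih => rw [content_cons, map_add, ih, Finsupp.degree_single, List.length_cons, add_comm]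

/-- The increasing list with a given content. -/
def sortedList (d : Fin m →₀ ℕ) : List (Fin m) :=
  (List.ofFn fun i => List.replicate (d i) i).flatten

lemma content_sortedList (d : Fin m →₀ ℕ) : content (sortedList d) = d := by
  ext i
  rw [content_apply, sortedList, List.count_flatten, List.map_ofFn, List.sum_ofFn,
    Finset.sum_eq_single i]
  · simp
  · intro j _ hj
    simp [List.count_replicate, hj]
  · simp

lemma length_sortedList (d : Fin m →₀ ℕ) : (sortedList d).length = d.degree := by
  rw [← degree_content, content_sortedList]

lemma perm_of_content {l l' : List (Fin m)} (h : content l = content l') : l.Perm l' := by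
  rw [List.perm_iff_count]
  intro i
  rw [← content_apply, h, content_apply]

lemma pbwMonomial_eq_word (d : Fin m →₀ ℕ) : G.pbwMonomial d = G.word (sortedList d) := by
  rw [pbwMonomial, word, sortedList, List.map_flatten, List.prod_flatten, List.map_map,
    List.map_ofFn]
  congr 2
  funext i
  simp [gen]

lemma pbwMonomial_mem_filt (d : Fin m →₀ ℕ) : G.pbwMonomial d ∈ G.filt d.degree := by
  rw [pbwMonomial_eq_word]
  exact G.word_mem_filt (length_sortedList d).le

lemma word_sub_pbwMonomial (l : List (Fin m)) :
    G.word l - G.pbwMonomial (content l) ∈ G.filt (l.length - 1) := by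
  rw [pbwMonomial_eq_word]
  exact G.word_perm (perm_of_content (content_sortedList _).symm)

/-- The ordered monomials of degree at most `n` span the `n`-th step of the filtration. -/
lemma filt_eq_span (n : ℕ) :
    G.filt n = Submodule.span R (G.pbwMonomial '' {d | d.degree ≤ n}) := by
  apply le_antisymm
  · induction n with
    | zero =>
      refine Submodule.span_le.mpr ?_
      rintro _ ⟨l, hl, rfl⟩
      have : l = [] := by simpa using hl
      subst this
      refine Submodule.subset_span ⟨0, by simp, ?_⟩
      simp [pbwMonomial]
    | succ n ih =>
      refine Submodule.span_le.mpr ?_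
      rintro _ ⟨l, hl, rfl⟩
      have hl : l.length ≤ n + 1 := hl
      -- A word is its sorted version plus a combination of shorter words, and the latter are
      -- covered by induction.
      rw [SetLike.mem_coe, ← sub_add_cancel (G.word l) (G.pbwMonomial (content l))]
      refine Submodule.add_mem _ ?_ (Submodule.subset_span ⟨_, ?_, rfl⟩)
      · refine Submodule.span_mono (Set.image_mono ?_)
          (ih (G.filt_mono (by omega) (G.word_sub_pbwMonomial l)))
        intro d hd
        exact le_trans hd (Nat.le_succ n)
      · simpa [degree_content] using hl
  · refine Submodule.span_le.mpr ?_
    rintro _ ⟨d, hd, rfl⟩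
    exact G.filt_mono hd (G.pbwMonomial_mem_filt d)

lemma exists_mem_filt (u : G.U) : ∃ n, u ∈ G.filt n := by
  let p : Submodule R G.U :=
    { carrier := {u | ∃ n, u ∈ G.filt n}
      add_mem' := by
        rintro a b ⟨i, hi⟩ ⟨j, hj⟩
        exact ⟨max i j, Submodule.add_mem _ (G.filt_mono (le_max_left _ _) hi)
          (G.filt_mono (le_max_right _ _) hj)⟩
      zero_mem' := ⟨0, Submodule.zero_mem _⟩
      smul_mem' := by
        rintro r a ⟨i, hi⟩
        exact ⟨i, Submodule.smul_mem _ _ hi⟩ }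
  refine UniversalEnvelopingAlgebra.mem_of_stable p ⟨0, ?_⟩ ?_ u
  · exact G.word_mem_filt (l := []) (by simp)
  · rintro x u ⟨n, hn⟩
    exact ⟨_, G.mul_mem_filt (G.ι_mem_filt x) hn⟩

lemma pbwMonomial_span : ⊤ ≤ Submodule.span R (Set.range G.pbwMonomial) := by
  intro u _
  obtain ⟨n, hn⟩ := G.exists_mem_filt u
  rw [filt_eq_span] at hn
  exact Submodule.span_mono (Set.image_subset_range _ _) hn

/-- Appending a letter and sorting only creates terms of lower degree. This is why the leading part
of the Koszul differential is that of a polynomial ring. -/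
lemma pbwMonomial_mul_gen (d : Fin m →₀ ℕ) (i : Fin m) :
    G.pbwMonomial d * G.gen i - G.pbwMonomial (d + Finsupp.single i 1) ∈ G.filt d.degree := by
  have h := G.word_sub_pbwMonomial (sortedList d ++ [i])
  have h2 : content (sortedList d ++ [i]) = d + Finsupp.single i 1 := by
    have : content (sortedList d ++ [i]) = content (sortedList d) + content [i] := by
      simp [content]
    rw [this, content_sortedList]
    simp
  rw [h2, word_append, ← pbwMonomial_eq_word, List.length_append, length_sortedList] at h
  simpa using h

end Words

/-! ### Triangularity of α, the Poincaré–Birkhoff–Witt basis and the image of α -/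

section Triangular

open MvPowerSeries

/-- Under the degree bound one factor G^{(j)} may be replaced by X_j + Y_j (`coeff_series_mul`),
which removes one unit from either `x` or `y`. -/
lemma structureConst_single_add (x y d : Fin m →₀ ℕ) (j : Fin m)
    (h : x.degree + y.degree ≤ d.degree + 1) :
    G.structureConst x y (Finsupp.single j 1 + d) =
      (if x j = 0 then 0 else G.structureConst (x - Finsupp.single j 1) y d) +
        (if y j = 0 then 0 else G.structureConst x (y - Finsupp.single j 1) d) := by
  have u0 : ∀ c : Fin m →₀ ℕ, Function.update ![x, y] 0 c = ![c, y] := by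
    intro c; funext q; fin_cases q <;> simp
  have u1 : ∀ c : Fin m →₀ ℕ, Function.update ![x, y] 1 c = ![x, c] := by
    intro c; funext q; fin_cases q <;> simp
  rw [structureConst, G.monomialImage_add, G.monomialImage_single, G.coeff_series_mul _ _ _
      (by rw [degree_joinExp_two]; exact h), coeff_X_mul', coeff_X_mul', joinExp_apply,
      joinExp_apply, joinExp_sub_single, joinExp_sub_single, u0, u1]
  rfl

/-- In degree |d| the series G^d is (X+Y)^d, whose part linear in X is the sum of the terms d_i X_i
Y^{d - e_i}. The factor d_i is the source of the factorials in the image of α. -/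
lemma structureConst_single_left (i : Fin m) (y d : Fin m →₀ ℕ) (h : y.degree + 1 = d.degree) :
    G.structureConst (Finsupp.single i 1) y d =
      if d = Finsupp.single i 1 + y then (d i : R) else 0 := by
  classical
  induction hn : y.degree generalizing y d with
  | zero =>
    have hy : y = 0 := (Finsupp.degree_eq_zero_iff y).mp hn
    subst hy
    rw [G.structureConst_zero_right (by simp [← h]), add_zero]
    by_cases h1 : Finsupp.single i 1 = d
    · rw [if_pos h1, if_pos h1.symm, ← h1]; simp
    · rw [if_neg h1, if_neg (Ne.symm h1)]
  | succ n ih =>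
    obtain ⟨j, d', rfl, hd'⟩ := exists_add_single d (n + 1) (by omega)
    rw [G.structureConst_single_add _ _ _ _ (by simp; omega)]
    have hy : ∀ _ : y j ≠ 0, ∃ y', y = Finsupp.single j 1 + y' := by
      intro hy
      refine ⟨y - Finsupp.single j 1, (add_tsub_cancel_of_le ?_).symm⟩
      rw [Finsupp.single_le_iff]; omega
    by_cases hij : i = j
    · subst hij
      rw [if_neg (by simp), tsub_self, G.structureConst_zero_left (by omega)]
      by_cases h0 : y i = 0
      · rw [if_pos h0, add_zero]
        by_cases h1 : y = d'
        · subst h1; simp [h0]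
        · rw [if_neg h1, if_neg]
          simpa using Ne.symm h1
      · rw [if_neg h0]
        obtain ⟨y', rfl⟩ := hy h0
        rw [add_tsub_cancel_left]
        rw [map_add, Finsupp.degree_single] at hn
        rw [ih _ _ (by omega) (by omega)]
        by_cases h1 : Finsupp.single i 1 + y' = d'
        · subst h1; simp [add_comm]
        · rw [if_neg h1, if_neg (Ne.symm h1), if_neg, add_zero]
          simpa using Ne.symm h1
    · rw [if_pos (by simp [hij]), zero_add]
      by_cases h0 : y j = 0
      · rw [if_pos h0, if_neg]
        intro h1
        have := DFunLike.congr_fun h1 j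
        simp [h0, hij] at this
      · rw [if_neg h0]
        obtain ⟨y', rfl⟩ := hy h0
        rw [add_tsub_cancel_left]
        rw [map_add, Finsupp.degree_single] at hn
        rw [ih _ _ (by omega) (by omega)]
        rw [add_left_comm]
        simp [Ne.symm hij]

lemma value_gen_mul (i : Fin m) (a : G.Distr) (d : Fin m →₀ ℕ) :
    G.value d (G.delta (Finsupp.single i 1) * a) =
      ∑ᶠ y, G.value y a * G.structureConst (Finsupp.single i 1) y d := by
  have h := G.apply_eq_finsum ((G.value d).comp (G.mulLin (G.delta (Finsupp.single i 1)))) a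
  simp only [LinearMap.comp_apply, mulLin_delta, value_deltaMul] at h
  exact h

lemma alpha_ι (x : G.LieAlg) : G.alpha (UniversalEnvelopingAlgebra.ι R x) = G.tangent x := by
  simp [alpha]
  rfl

lemma alpha_gen (i : Fin m) : G.alpha (G.gen i) = G.delta (Finsupp.single i 1) := by
  rw [gen, alpha_ι, tangent, Module.Basis.constr_basis]

/-- In top degree, `α` sends a word to the corresponding multiple of a coefficient functional. -/
lemma value_alpha_word (l : List (Fin m)) (d : Fin m →₀ ℕ) (h : l.length ≤ d.degree) :
    G.value d (G.alpha (G.word l)) = if d = content l then (multiFactorial d : R) else 0 := by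
  classical
  induction l generalizing d with
  | nil =>
    rw [word_nil, map_one]
    refine (G.value_delta d 0).trans ?_
    rw [content_nil]
    by_cases h1 : d = 0
    · subst h1; simp [multiFactorial]
    · rw [if_neg h1, if_neg (Ne.symm h1)]
  | cons i l ih =>
    -- Only `y = content l` contributes: for other `y` with |y| at least the length of `l` the
    -- induction hypothesis gives zero, and for smaller |y| the structure constant vanishes because
    -- 1 + |y| < |d|. The surviving constant d_i turns the factorial of `content l` into that of
    -- `d`.
    rw [word_cons, map_mul, alpha_gen, value_gen_mul, content_cons, finsum_eq_single _ (content l)]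
    · rw [ih _ (degree_content l).ge, if_pos rfl]
      rw [List.length_cons] at h
      rcases h.eq_or_lt with h1 | h1
      · rw [structureConst_single_left _ _ _ _ (by rw [degree_content, h1])]
        split_ifs with h2
        · subst h2
          rw [add_comm, multiFactorial_add_single]
          push_cast [Finsupp.add_apply, Finsupp.single_eq_same]
          ring
        · simp
      · rw [structureConst_eq_zero _ (by rw [degree_content, Finsupp.degree_single]; omega),
          mul_zero, if_neg]
        rintro rfl
        rw [map_add, degree_content, Finsupp.degree_single] at h1
        omega
    · intro y hy
      rw [List.length_cons] at h
      by_cases h1 : l.length ≤ y.degree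
      · rw [ih y h1, if_neg hy, zero_mul]
      · rw [structureConst_eq_zero _ (by rw [Finsupp.degree_single]; omega), mul_zero]

lemma value_alpha_pbwMonomial (j d : Fin m →₀ ℕ) (h : j.degree ≤ d.degree) :
    G.value d (G.alpha (G.pbwMonomial j)) = if d = j then (multiFactorial d : R) else 0 := by
  rw [pbwMonomial_eq_word, value_alpha_word _ _ _ (by rwa [length_sortedList]),
    content_sortedList]

lemma multiFactorial_cast_ne_zero [CharZero R] (d : Fin m →₀ ℕ) : (multiFactorial d : R) ≠ 0 := by
  exact_mod_cast multiFactorial_ne_zero d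

variable [IsDomain R] [CharZero R]

/-- In a relation, let `d` have maximal degree among the exponents with nonzero coefficient. The
value of the relation at t^d is d! times that coefficient, and d! is not zero in `R`. Independence
after applying α also yields the injectivity of α. -/
lemma pbwMonomial_linearIndependent :
    LinearIndependent R (fun d : Fin m →₀ ℕ => G.alpha (G.pbwMonomial d)) := by
  classical
  rw [linearIndependent_iff']
  intro s c hc
  by_contra! hne
  obtain ⟨i, hi, hci⟩ := hne
  obtain ⟨d, hd, hmax⟩ := Finset.exists_max_image (s.filter fun i => c i ≠ 0)
    (fun d => Finsupp.degree d) ⟨i, by simp [hi, hci]⟩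
  rw [Finset.mem_filter] at hd
  have := congrArg (G.value d) hc
  rw [map_sum, Finset.sum_eq_single d, map_smul, value_alpha_pbwMonomial _ _ _ le_rfl, if_pos rfl,
    map_zero, smul_eq_mul, mul_eq_zero] at this
  · rcases this with h | h
    · exact hd.2 h
    · exact multiFactorial_cast_ne_zero d h
  · intro e he hed
    by_cases h0 : c e = 0
    · simp [h0]
    · rw [map_smul, value_alpha_pbwMonomial _ _ _ (hmax e (by simp [he, h0])), if_neg hed.symm,
        smul_zero]
  · exact fun h => absurd hd.1 h

/-- The Poincaré–Birkhoff–Witt basis of `U(𝔤)`. -/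
def pbwBasis : Module.Basis (Fin m →₀ ℕ) R G.U :=
  Module.Basis.mk (LinearIndependent.of_comp G.alpha.toLinearMap G.pbwMonomial_linearIndependent)
    G.pbwMonomial_span

lemma pbwBasis_apply (d : Fin m →₀ ℕ) : G.pbwBasis d = G.pbwMonomial d := by simp [pbwBasis]

lemma alpha_injective : Function.Injective G.alpha := by
  rw [injective_iff_map_eq_zero]
  intro u hu
  have h2 : G.alpha u = Finsupp.linearCombination R (fun d => G.alpha (G.pbwMonomial d))
      (G.pbwBasis.repr u) := by
    conv_lhs => rw [← G.pbwBasis.linearCombination_repr u]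
    rw [Finsupp.linearCombination_apply, Finsupp.linearCombination_apply, map_finsuppSum]
    simp only [map_smul, pbwBasis_apply]
  rw [h2] at hu
  have := (linearIndependent_iff.mp G.pbwMonomial_linearIndependent) _ hu
  simpa using this

/-- Since α(e^d) is d! δ_d plus terms δ_e with |e| < |d|, and e! divides the coefficient of δ_e by
`alpha_mem`, each lower term is an `R`-multiple of e! δ_e. By induction on the degree those are
images, so they can be removed without division. -/
lemma exists_alpha_eq (d : Fin m →₀ ℕ) :
    ∃ u ∈ G.filt d.degree, G.alpha u = (multiFactorial d : R) • G.delta d := by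
  classical
  induction hn : d.degree using Nat.strong_induction_on generalizing d with
  | h n ih =>
    subst hn
    have hdvd := G.alpha_mem (G.pbwMonomial d)
    choose c hc using hdvd
    -- These are the lower terms to be removed; in degrees at least |d| only `d` itself occurs.
    let s : Finset (Fin m →₀ ℕ) := (G.deltaBasis.repr (G.alpha (G.pbwMonomial d))).support.filter
      fun e => e.degree < d.degree
    have hs : ∀ e ∈ s, e.degree < d.degree := fun e he => (Finset.mem_filter.mp he).2
    choose! w hw hw2 using fun (e : Fin m →₀ ℕ) (he : e.degree < d.degree) => ih _ he e rfl
    refine ⟨G.pbwMonomial d - ∑ e ∈ s, c e • w e, ?_, ?_⟩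
    · refine Submodule.sub_mem _ (G.pbwMonomial_mem_filt d) (Submodule.sum_mem _ fun e he => ?_)
      exact Submodule.smul_mem _ _ (G.filt_mono (hs e he).le (hw e (hs e he)))
    · rw [map_sub, map_sum, sub_eq_iff_eq_add]
      apply G.value_ext
      intro f
      rw [map_add, map_smul, value_delta, map_sum]
      have hterm : ∀ e ∈ s, G.value f (G.alpha (c e • w e)) =
          if e = f then G.value f (G.alpha (G.pbwMonomial d)) else 0 := by
        intro e he
        rw [map_smul, hw2 e (hs e he), map_smul, map_smul, value_delta]
        split_ifs with h
        · subst h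
          rw [hc, smul_eq_mul, smul_eq_mul]; ring
        · simp
      rw [Finset.sum_congr rfl hterm, Finset.sum_ite_eq']
      by_cases hf : d.degree ≤ f.degree
      · rw [if_neg (fun h => absurd (hs f h) (by omega)), add_zero,
          value_alpha_pbwMonomial _ _ _ hf]
        by_cases h : f = d
        · simp [h]
        · simp [h, Ne.symm h]
      · have : d ≠ f := by rintro rfl; exact hf le_rfl
        rw [if_neg this, smul_zero, zero_add]
        split_ifs with h
        · rfl
        · by_contra h0
          refine h (Finset.mem_filter.mpr ⟨?_, by omega⟩)
          rw [Finsupp.mem_support_iff]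
          exact h0

/-- The elements of `U(𝔤)` corresponding under `α` to the functionals `d! δ_d`. -/
def divElt (d : Fin m →₀ ℕ) : G.U := (G.exists_alpha_eq d).choose

lemma alpha_divElt (d : Fin m →₀ ℕ) :
    G.alpha (G.divElt d) = (multiFactorial d : R) • G.delta d :=
  (G.exists_alpha_eq d).choose_spec.2

/-- The basis of `U(𝔤)` formed by the elements corresponding to the functionals `d! δ_d`. -/
def divBasis : Module.Basis (Fin m →₀ ℕ) R G.U :=
  Module.Basis.mk (v := G.divElt)
    (by
      refine LinearIndependent.of_comp G.alpha.toLinearMap ?_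
      rw [linearIndependent_iff']
      intro s c hc i hi
      classical
      have := congrArg (G.value i) hc
      simp only [Function.comp_apply, AlgHom.toLinearMap_apply, map_sum, map_smul, alpha_divElt,
        value_delta, map_zero, smul_eq_mul, mul_ite, mul_one, mul_zero, Finset.sum_ite_eq', if_pos hi,
        mul_eq_zero, multiFactorial_cast_ne_zero, or_false] at this
      exact this)
    (by
      intro u _
      -- Divisibility writes α(u) as a sum of c_d d! δ_d with c_d in `R`; injectivity of α lifts
      -- this identity to `U`.
      choose c hc using G.alpha_mem u
      have : u = ∑ d ∈ (G.deltaBasis.repr (G.alpha u)).support, c d • G.divElt d := by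
        apply G.alpha_injective
        rw [map_sum]
        conv_lhs => rw [← G.deltaBasis.linearCombination_repr (G.alpha u)]
        rw [Finsupp.linearCombination_apply, Finsupp.sum]
        refine Finset.sum_congr rfl fun d _ => ?_
        rw [map_smul, alpha_divElt, smul_smul, mul_comm, ← hc]
        rfl
      rw [this]
      exact Submodule.sum_mem _ fun d _ => Submodule.smul_mem _ _ (Submodule.subset_span ⟨d, rfl⟩))

lemma divBasis_apply (d : Fin m →₀ ℕ) : G.divBasis d = G.divElt d := by simp [divBasis]

lemma alpha_divBasis (d : Fin m →₀ ℕ) :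
    G.alpha (G.divBasis d) = (multiFactorial d : R) • G.delta d := by
  rw [divBasis_apply, alpha_divElt]

end Triangular

end FormalGroupLaw

/-! ### Power series in disjoint sets of variables -/

namespace MvPowerSeries

variable {σ : Type} {A : Type u} [CommRing A]

/-- The series `f` only involves the variables in `S`. -/
def SuppOn (S : Set σ) (f : MvPowerSeries σ A) : Prop :=
  ∀ d, coeff d f ≠ 0 → ∀ x ∉ S, d x = 0

lemma SuppOn.mono {S T : Set σ} {f : MvPowerSeries σ A} (hf : SuppOn S f) (h : S ⊆ T) :
    SuppOn T f := fun d hd x hx => hf d hd x fun hx' => hx (h hx')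

lemma SuppOn.one (S : Set σ) : SuppOn S (1 : MvPowerSeries σ A) := by
  classical
  intro d hd x _
  rw [coeff_one] at hd
  have : d = 0 := by by_contra h; exact hd (if_neg h)
  simp [this]

lemma SuppOn.mul {S : Set σ} {f g : MvPowerSeries σ A} (hf : SuppOn S f) (hg : SuppOn S g) :
    SuppOn S (f * g) := by
  classical
  intro d hd x hx
  rw [coeff_mul] at hd
  obtain ⟨p, hp, h0⟩ := Finset.exists_ne_zero_of_sum_ne_zero hd
  have h1 := hf p.1 (fun h => h0 (by rw [h, zero_mul])) x hx
  have h2 := hg p.2 (fun h => h0 (by rw [h, mul_zero])) x hx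
  rw [← Finset.HasAntidiagonal.mem_antidiagonal.mp hp, Finsupp.add_apply, h1, h2]

lemma SuppOn.prod {ι : Type*} {S : Set σ} {f : ι → MvPowerSeries σ A} (s : Finset ι)
    (h : ∀ i ∈ s, SuppOn S (f i)) : SuppOn S (∏ i ∈ s, f i) := by
  classical
  induction s using Finset.induction_on with
  | empty => simpa using SuppOn.one S
  | insert a s ha ih =>
    rw [Finset.prod_insert ha]
    exact (h a (by simp)).mul (ih fun i hi => h i (by simp [hi]))

lemma SuppOn.rename {τ : Type} (e : τ ↪ σ) (f : MvPowerSeries τ A) :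
    SuppOn (Set.range e) (MvPowerSeries.rename e f) := by
  intro d hd x hx
  by_contra h
  apply hd
  apply coeff_rename_eq_zero
  rintro ⟨y, rfl⟩
  exact h (Finsupp.mapDomain_of_notMem_range _ _ hx)

/-- An exponent splits in only one way into a part on `S` and a part off `S`, so the Cauchy product
has a single term. -/
lemma coeff_add_mul_of_suppOn {S : Set σ} {f g : MvPowerSeries σ A} (hf : SuppOn S f)
    (hg : SuppOn Sᶜ g) {a b : σ →₀ ℕ} (ha : ∀ x ∉ S, a x = 0) (hb : ∀ x ∈ S, b x = 0) :
    coeff (a + b) (f * g) = coeff a f * coeff b g := by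
  classical
  rw [coeff_mul, Finset.sum_eq_single (a, b)]
  · rintro ⟨c, d⟩ hcd hne
    by_contra h0
    apply hne
    have h1 := hf c (fun h => h0 (by simp [h]))
    have h2 := hg d (fun h => h0 (by simp [h]))
    have h3 := Finset.HasAntidiagonal.mem_antidiagonal.mp hcd
    have key : ∀ x, c x = a x ∧ d x = b x := by
      intro x
      have h4 := DFunLike.congr_fun h3 x
      simp only [Finsupp.add_apply] at h4
      by_cases hx : x ∈ S
      · have := h2 x (by simpa using hx)
        have := hb x hx
        omega
      · have := h1 x hx
        have := ha x hx
        omega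
    exact Prod.ext (Finsupp.ext fun x => (key x).1) (Finsupp.ext fun x => (key x).2)
  · intro h
    simp at h

/-- The coefficients of a product of series in disjoint sets of variables. -/
lemma coeff_sum_prod_of_suppOn {ι : Type*} {S : ι → Set σ}
    (hS : Pairwise fun i j => Disjoint (S i) (S j)) {f : ι → MvPowerSeries σ A}
    (hf : ∀ i, SuppOn (S i) (f i)) {a : ι → (σ →₀ ℕ)} (ha : ∀ i, ∀ x ∉ S i, a i x = 0)
    (s : Finset ι) : coeff (∑ i ∈ s, a i) (∏ i ∈ s, f i) = ∏ i ∈ s, coeff (a i) (f i) := by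
  classical
  induction s using Finset.induction_on with
  | empty => simp
  | insert i s hi ih =>
    rw [Finset.prod_insert hi, Finset.prod_insert hi, Finset.sum_insert hi, ← ih]
    have hd : ∀ j ∈ s, Disjoint (S i) (S j) := fun j hj => hS fun h => hi (h ▸ hj)
    refine coeff_add_mul_of_suppOn (hf i) (SuppOn.prod _ fun j hj => (hf j).mono ?_) (ha i) ?_
    · exact (hd j hj).subset_compl_left
    · intro x hx
      rw [Finsupp.finsetSum_apply]
      exact Finset.sum_eq_zero fun j hj => ha j x fun h => Set.disjoint_left.mp (hd j hj) hx h

end MvPowerSeries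

namespace FormalGroupLaw

open MvPowerSeries

variable {R : Type u} [CommRing R] {m : ℕ} (G : FormalGroupLaw R m)

section Blocks

/-- The inclusion of the `i`-th block of variables. -/
def singleEmb {n : ℕ} (i : Fin n) : Fin m ↪ Fin n × Fin m :=
  ⟨fun j => (i, j), fun _ _ h => congrArg Prod.snd h⟩

/-- The variables of the `i`-th block. -/
def block (m : ℕ) {n : ℕ} (i : Fin n) : Set (Fin n × Fin m) := {q | q.1 = i}

lemma disjoint_block {n : ℕ} {i j : Fin n} (h : i ≠ j) : Disjoint (block m i) (block m j) :=
  Set.disjoint_left.mpr fun _ hi hj => h (hi.symm.trans hj)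

lemma joinExp_eq_sum {n : ℕ} (p : Fin n → (Fin m →₀ ℕ)) :
    joinExp p = ∑ i, joinExp (Pi.single i (p i)) := by
  ext ⟨k, j⟩
  rw [Finsupp.finsetSum_apply, joinExp_apply, Finset.sum_eq_single k]
  · simp [joinExp_apply]
  · intro b _ hb
    simp [joinExp_apply, Pi.single_eq_of_ne hb.symm]
  · simp

lemma joinExp_single {n : ℕ} (i : Fin n) (d : Fin m →₀ ℕ) :
    joinExp (Pi.single i d) = Finsupp.embDomain (singleEmb i) d := by
  ext ⟨k, j⟩
  rw [joinExp_apply]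
  by_cases hk : k = i
  · subst hk
    have := Finsupp.embDomain_apply_self (singleEmb k) d j
    rw [show singleEmb k j = (k, j) from rfl] at this
    rw [this, Pi.single_eq_same]
  · rw [Finsupp.embDomain_of_notMem_range, Pi.single_eq_of_ne hk]
    · rfl
    · rintro ⟨x, hx⟩
      exact hk (congrArg Prod.fst hx).symm

lemma range_singleEmb {n : ℕ} (i : Fin n) : Set.range (singleEmb (m := m) i) = block m i := by
  ext ⟨k, j⟩
  constructor
  · rintro ⟨x, hx⟩; exact (congrArg Prod.fst hx).symm
  · rintro h
    exact ⟨j, by rw [show k = i from h]; rfl⟩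

lemma coeff_pureTensor {A : Type u} [CommRing A] {n : ℕ} (f : Fin n → MvPowerSeries (Fin m) A)
    (p : Fin n → (Fin m →₀ ℕ)) :
    coeff (joinExp p) (pureTensor f) = ∏ i, coeff (p i) (f i) := by
  have h : ∀ i, subst (fun j => X (i, j) : Fin m → MvPowerSeries (Fin n × Fin m) A) (f i) =
      rename (singleEmb i) (f i) := fun i => (rename_eq_subst _ _).symm
  rw [pureTensor, joinExp_eq_sum, Finset.prod_congr rfl fun i _ => h i,
    coeff_sum_prod_of_suppOn (S := block m) (fun _ _ h => disjoint_block h)]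
  · refine Finset.prod_congr rfl fun i _ => ?_
    rw [joinExp_single, coeff_embDomain_rename]
  · intro i
    rw [← range_singleEmb]
    exact SuppOn.rename _ _
  · rintro i ⟨k, j⟩ hx
    rw [joinExp_apply, Pi.single_eq_of_ne hx]
    rfl

end Blocks

/-! ### Duality between modified cochains and tensor powers of the enveloping algebra -/

section Pairing

variable (A : Type u) [CommRing A] [Algebra R A]

lemma pairing_tprod_delta (n : ℕ) (f : MvPowerSeries (Fin n × Fin m) A)
    (p : Fin n → (Fin m →₀ ℕ)) :
    G.pairing A n f (PiTensorProduct.tprod R fun i => G.delta (p i)) = coeff (joinExp p) f := by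
  have h : (PiTensorProduct.tprod R fun i => G.delta (p i)) =
      Basis.piTensorProduct (fun _ : Fin n => G.deltaBasis) p := by
    rw [Basis.piTensorProduct_apply]
    rfl
  rw [h]
  change ((Basis.piTensorProduct fun _ : Fin n => G.deltaBasis).constr R _) _ = _
  rw [Module.Basis.constr_basis]
  rfl

lemma dualAlpha_apply_tprod (n : ℕ) (f : MvPowerSeries (Fin n × Fin m) A) (u : Fin n → G.U) :
    G.dualAlpha A n f (PiTensorProduct.tprod R u) =
      G.pairing A n f (PiTensorProduct.tprod R fun i => G.alpha (u i)) := by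
  simp only [dualAlpha, LinearMap.comp_apply, LinearMap.lcomp_apply, PiTensorProduct.map_tprod]
  rfl

/-- The pairing of a power series in `m` variables with a distribution. -/
def pairingOne : MvPowerSeries (Fin m) A →ₗ[R] G.Distr →ₗ[R] A :=
  (G.deltaBasis.constr R).toLinearMap ∘ₗ LinearMap.pi fun d => (coeff d).restrictScalars R

lemma pairingOne_delta (f : MvPowerSeries (Fin m) A) (d : Fin m →₀ ℕ) :
    G.pairingOne A f (G.delta d) = coeff d f := by
  simp only [pairingOne, LinearMap.comp_apply, LinearEquiv.coe_coe, delta,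
    Module.Basis.constr_basis]
  rfl

lemma dualAlphaOne_apply (f : MvPowerSeries (Fin m) A) (u : G.U) :
    G.dualAlphaOne A f u = G.pairingOne A f (G.alpha u) := rfl

variable {A} in
lemma linearMap_eq_finsum {M : Type*} [AddCommGroup M] [Module R M] (F : G.Distr →ₗ[R] M)
    (a : G.Distr) : F a = ∑ᶠ d, G.value d a • F (G.delta d) := by
  have h := G.deltaBasis.linearCombination_repr a
  conv_lhs => rw [← h]
  rw [Finsupp.linearCombination_apply, map_finsuppSum, Finsupp.sum,
    finsum_eq_sum_of_support_subset (s := (G.deltaBasis.repr a).support)]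
  · simp [value, delta]
  · intro d hd
    simp only [Finset.mem_coe, Finsupp.mem_support_iff]
    intro h0
    apply hd
    simp [value, h0]

/-- Both sides are multilinear in `a`; on the functionals δ_d they agree by the formula for the
coefficients of a pure tensor. -/
lemma pairing_pureTensor (n : ℕ) (f : Fin n → MvPowerSeries (Fin m) A) (a : Fin n → G.Distr) :
    G.pairing A n (pureTensor f) (PiTensorProduct.tprod R a) =
      ∏ i, G.pairingOne A (f i) (a i) := by
  have h : (G.pairing A n (pureTensor f)).compMultilinearMap (PiTensorProduct.tprod R) =
      (MultilinearMap.mkPiAlgebra R (Fin n) A).compLinearMap fun i => G.pairingOne A (f i) := by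
    refine Module.Basis.ext_multilinear (fun _ => G.deltaBasis) fun p => ?_
    have := G.pairing_tprod_delta A n (pureTensor f) p
    rw [coeff_pureTensor] at this
    refine this.trans ?_
    rw [MultilinearMap.compLinearMap_apply, MultilinearMap.mkPiAlgebra_apply]
    exact Finset.prod_congr rfl fun i _ => (G.pairingOne_delta A (f i) (p i)).symm
  exact congrArg (fun F => F a) h

variable [IsDomain R] [CharZero R]

lemma algebraMap_alphaTilde (n : ℕ) (f : G.KTilde n) (x : LieCochains.UPow R G.LieAlg n) :
    algebraMap R (FractionRing R) (G.alphaTilde n f x) =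
      G.dualAlpha (FractionRing R) n f.1 x :=
  algebraMap_descend (G.dualAlpha (FractionRing R) n ∘ₗ
    (Subalgebra.toSubmodule (G.KTilde n)).subtype) (fun f => G.dualAlpha_mem f.2) f x

lemma algebraMap_alphaTildeOne (f : G.OTilde) (u : G.U) :
    algebraMap R (FractionRing R) (G.alphaTildeOne f u) =
      G.pairingOne (FractionRing R) f.1 (G.alpha u) :=
  algebraMap_descend (G.dualAlphaOne (FractionRing R) ∘ₗ
    (Subalgebra.toSubmodule G.OTilde).subtype) (fun f => G.dualAlphaOne_mem f.2) f u

omit [IsDomain R] [CharZero R] in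
lemma algebraMap_inj {x y : R}
    (h : algebraMap R (FractionRing R) x = algebraMap R (FractionRing R) y) : x = y :=
  FaithfulSMul.algebraMap_injective R (FractionRing R) h

theorem alphaTilde_pureTensor (n : ℕ) (f : Fin n → G.OTilde) (u : Fin n → G.U) :
    G.alphaTilde n (G.pureTensorTilde f) (PiTensorProduct.tprod R u) =
      ∏ i, G.alphaTildeOne (f i) (u i) := by
  apply algebraMap_inj
  rw [algebraMap_alphaTilde, dualAlpha_apply_tprod, map_prod]
  refine (G.pairing_pureTensor (FractionRing R) n _ _).trans ?_
  exact Finset.prod_congr rfl fun i _ => (G.algebraMap_alphaTildeOne _ _).symm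

omit [IsDomain R] [CharZero R] in
theorem alphaStar_pureTensor (n : ℕ) (f : Fin n → MvPowerSeries (Fin m) R) (u : Fin n → G.U) :
    G.alphaStar n (pureTensor f) (PiTensorProduct.tprod R u) = ∏ i, G.alphaStarOne (f i) (u i) :=
  (G.dualAlpha_apply_tprod R n _ u).trans (G.pairing_pureTensor R n f _)

theorem alphaTilde_comp_incl (n : ℕ) : G.alphaTilde n ∘ₗ G.incl n = G.alphaStar n := by
  ext f u
  apply algebraMap_inj
  change algebraMap R (FractionRing R) (G.alphaTilde n (G.incl n f) _) =
    algebraMap R (FractionRing R) (G.dualAlpha R n f (PiTensorProduct.tprod R u))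
  rw [algebraMap_alphaTilde, dualAlpha_tprod, dualAlpha_tprod, Finsupp.sum, Finsupp.sum, map_sum]
  refine Finset.sum_congr rfl fun p _ => ?_
  change _ • coeff _ (MvPowerSeries.map (algebraMap R (FractionRing R)) f) = _
  rw [coeff_map, smul_eq_mul, map_mul, Algebra.smul_def]

lemma multiFactorial_joinExp {n : ℕ} (p : Fin n → (Fin m →₀ ℕ)) :
    multiFactorial (joinExp p) = ∏ i, multiFactorial (p i) := by
  simp [multiFactorial, Fintype.prod_prod_type, joinExp_apply]

/-- The pairing reads off d! b_d, exactly the quantity which the definition of the modified ring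
requires to be in `R`. -/
lemma dualAlpha_tprod_divBasis (n : ℕ) (f : MvPowerSeries (Fin n × Fin m) A)
    (p : Fin n → (Fin m →₀ ℕ)) :
    G.dualAlpha A n f (PiTensorProduct.tprod R fun i => G.divBasis (p i)) =
      (multiFactorial (joinExp p) : A) * coeff (joinExp p) f := by
  rw [dualAlpha_apply_tprod]
  simp only [alpha_divBasis]
  rw [MultilinearMap.map_smul_univ, map_smul, pairing_tprod_delta, Algebra.smul_def,
    multiFactorial_joinExp]
  simp

/-- The basis of `U(𝔤)^{⊗ n}` formed by the tensor products of the elements of `divBasis`. -/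
def divBasisPow (n : ℕ) : Module.Basis (Fin n → (Fin m →₀ ℕ)) R (LieCochains.UPow R G.LieAlg n) :=
  Basis.piTensorProduct fun _ => G.divBasis

lemma divBasisPow_apply (n : ℕ) (p : Fin n → (Fin m →₀ ℕ)) :
    G.divBasisPow n p = PiTensorProduct.tprod R fun i => G.divBasis (p i) :=
  Basis.piTensorProduct_apply _ _

/-- A functional is an arbitrary family of values in `R` on `divBasisPow`, and a modified series is
an arbitrary family of numbers d! b_d in `R`; the two families correspond. -/
theorem alphaTilde_bijective (n : ℕ) : Function.Bijective (G.alphaTilde n) := by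
  have hne : ∀ d : Fin n × Fin m →₀ ℕ, (multiFactorial d : FractionRing R) ≠ 0 := fun d => by
    exact_mod_cast multiFactorial_ne_zero d
  constructor
  · rw [injective_iff_map_eq_zero]
    intro f hf
    apply Subtype.ext
    ext d
    obtain ⟨p, rfl⟩ := joinExp_surjective d
    have h := G.algebraMap_alphaTilde n f (PiTensorProduct.tprod R fun i => G.divBasis (p i))
    rw [hf, LinearMap.zero_apply, map_zero, dualAlpha_tprod_divBasis] at h
    exact (mul_eq_zero.mp h.symm).resolve_left (hne _)
  · intro φ
    let split : (Fin n × Fin m →₀ ℕ) → Fin n → (Fin m →₀ ℕ) :=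
      fun d => (joinExp_surjective d).choose
    have hsplit : ∀ p, split (joinExp p) = p := fun p =>
      joinExp_injective (joinExp_surjective (joinExp p)).choose_spec
    let f : MvPowerSeries (Fin n × Fin m) (FractionRing R) := fun d =>
      (multiFactorial d : FractionRing R)⁻¹ *
        algebraMap R (FractionRing R) (φ (G.divBasisPow n (split d)))
    have hfc : ∀ p, (multiFactorial (joinExp p) : FractionRing R) * coeff (joinExp p) f =
        algebraMap R (FractionRing R) (φ (G.divBasisPow n p)) := by
      intro p
      change (multiFactorial _ : FractionRing R) * ((multiFactorial _ : FractionRing R)⁻¹ * _) = _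
      rw [mul_inv_cancel_left₀ (hne _), hsplit]
    have hf : f ∈ G.KTilde n := by
      intro d
      obtain ⟨p, rfl⟩ := joinExp_surjective d
      rw [hfc]
      exact ⟨_, rfl⟩
    refine ⟨⟨f, hf⟩, (G.divBasisPow n).ext fun p => ?_⟩
    apply algebraMap_inj
    rw [algebraMap_alphaTilde, ← hfc, divBasisPow_apply, dualAlpha_tprod_divBasis]

lemma algebraMap_alphaTildeOne_divBasis (f : G.OTilde) (d : Fin m →₀ ℕ) :
    algebraMap R (FractionRing R) (G.alphaTildeOne f (G.divBasis d)) =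
      (multiFactorial d : FractionRing R) * coeff d f.1 := by
  rw [algebraMap_alphaTildeOne, alpha_divBasis, map_smul, pairingOne_delta, Algebra.smul_def,
    map_natCast]

theorem alphaTildeOne_bijective : Function.Bijective G.alphaTildeOne := by
  have hne : ∀ d : Fin m →₀ ℕ, (multiFactorial d : FractionRing R) ≠ 0 := fun d => by
    exact_mod_cast multiFactorial_ne_zero d
  constructor
  · rw [injective_iff_map_eq_zero]
    intro f hf
    apply Subtype.ext
    ext d
    have h := G.algebraMap_alphaTildeOne_divBasis f d
    rw [hf, LinearMap.zero_apply, map_zero] at h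
    exact (mul_eq_zero.mp h.symm).resolve_left (hne _)
  · intro φ
    let f : MvPowerSeries (Fin m) (FractionRing R) := fun d =>
      (multiFactorial d : FractionRing R)⁻¹ * algebraMap R (FractionRing R) (φ (G.divBasis d))
    have hfc : ∀ d, (multiFactorial d : FractionRing R) * coeff d f =
        algebraMap R (FractionRing R) (φ (G.divBasis d)) := by
      intro p
      change (multiFactorial _ : FractionRing R) * ((multiFactorial _ : FractionRing R)⁻¹ * _) = _
      rw [mul_inv_cancel_left₀ (hne _)]
    have hf : f ∈ G.OTilde := by
      intro d
      rw [hfc]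
      exact ⟨_, rfl⟩
    refine ⟨⟨f, hf⟩, G.divBasis.ext fun p => ?_⟩
    apply algebraMap_inj
    rw [algebraMap_alphaTildeOne_divBasis, hfc]

/-- If `f` has no terms of degree below |j|, then by triangularity pairing with e^j sees only j!
b_j. One direction is immediate, the other is an induction on the degree, dividing by j! in the
fraction field. -/
theorem alphaTildeOne_filtration (f : G.OTilde) (i : ℕ) :
    (∀ d : Fin m →₀ ℕ, d.degree < i → coeff d f.1 = 0) ↔
      ∀ j : Fin m →₀ ℕ, j.degree < i → G.alphaTildeOne f (G.pbwMonomial j) = 0 := by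
  have key : ∀ j : Fin m →₀ ℕ, (∀ d : Fin m →₀ ℕ, d.degree < j.degree → coeff d f.1 = 0) →
      algebraMap R (FractionRing R) (G.alphaTildeOne f (G.pbwMonomial j)) =
        (multiFactorial j : FractionRing R) * coeff j f.1 := by
    intro j hj
    rw [algebraMap_alphaTildeOne, linearMap_eq_finsum, finsum_eq_single _ j]
    · rw [value_alpha_pbwMonomial _ _ _ le_rfl, if_pos rfl, pairingOne_delta, Algebra.smul_def,
        map_natCast]
    · intro d hd
      rw [pairingOne_delta]
      by_cases h : j.degree ≤ d.degree
      · rw [value_alpha_pbwMonomial _ _ _ h, if_neg hd, zero_smul]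
      · rw [hj d (by omega), smul_zero]
  constructor
  · intro h j hj
    apply algebraMap_inj
    rw [key j fun d hd => h d (by omega), h j hj, mul_zero, map_zero]
  · intro h d hd
    induction hn : d.degree using Nat.strong_induction_on generalizing d with
    | h n ih =>
      have h1 := key d fun e he => ih _ (by omega) e (by omega) rfl
      rw [h d hd, map_zero] at h1
      refine (mul_eq_zero.mp h1.symm).resolve_left ?_
      exact_mod_cast multiFactorial_ne_zero d

end Pairing

end FormalGroupLaw

namespace FormalGroupLaw

open MvPowerSeries

variable {R : Type u} [CommRing R] {m : ℕ} (G : FormalGroupLaw R m)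

/-! ### The counit as evaluation on the constant series 1 -/

section Counit

lemma structureConst_zero (x y : Fin m →₀ ℕ) :
    G.structureConst x y 0 = if x = 0 ∧ y = 0 then 1 else 0 := by
  classical
  rw [structureConst, monomialImage_zero, coeff_one]
  refine if_congr ?_ rfl rfl
  have h := degree_joinExp_two x y
  rw [← Finsupp.degree_eq_zero_iff, h, Nat.add_eq_zero_iff, Finsupp.degree_eq_zero_iff,
    Finsupp.degree_eq_zero_iff]

/-- This is dual to μ(1) = 1 ⊗ 1: the structure constants for `d = 0` vanish unless both other
exponents are zero. -/
lemma value_zero_mul (a b : G.Distr) : G.value 0 (a * b) = G.value 0 a * G.value 0 b := by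
  classical
  have h : ∀ x, G.value 0 (G.delta x * b) = (if x = 0 then 1 else 0) * G.value 0 b := by
    intro x
    refine LinearMap.congr_fun (G.deltaBasis.ext (f₁ := (G.value 0).comp (G.mulLin (G.delta x)))
      (f₂ := (if x = 0 then (1 : R) else 0) • G.value 0) fun y => ?_) b
    change G.value 0 (G.mulLin (G.delta x) (G.delta y)) = _ * G.value 0 (G.delta y)
    rw [mulLin_delta, value_deltaMul, structureConst_zero, value_delta]
    split_ifs <;> simp_all
  refine LinearMap.congr_fun (G.deltaBasis.ext (f₁ := (G.value 0).comp (G.mulLin.flip b))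
    (f₂ := (G.value 0 b) • G.value 0) fun x => ?_) a |>.trans (mul_comm _ _)
  refine (h x).trans ?_
  change _ = G.value 0 b * G.value 0 (G.delta x)
  rw [value_delta, mul_comm]

-- Both sides are algebra morphisms to `R` that vanish on the Lie algebra, a tangent vector having
-- no δ_0 component.
attribute [local instance] LieRing.ofAssociativeRing in
lemma value_zero_alpha (u : G.U) : G.value 0 (G.alpha u) = LieCochains.counit R G.LieAlg u := by
  classical
  let ε : G.Distr →ₐ[R] R := AlgHom.ofLinearMap (G.value 0)
    ((G.value_delta 0 0).trans (if_pos rfl)) G.value_zero_mul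
  have h : ε.comp G.alpha = LieCochains.counit R G.LieAlg := by
    refine UniversalEnvelopingAlgebra.hom_ext R (LieHom.ext fun x => ?_)
    have h1 : G.value 0 (G.tangent x) = 0 := by
      rw [tangent, Module.Basis.constr_apply_fintype, map_sum]
      refine Finset.sum_eq_zero fun j _ => ?_
      rw [map_smul, value_delta, if_neg (by simp), smul_zero]
    have h2 : LieCochains.counit R G.LieAlg (UniversalEnvelopingAlgebra.ι R x) = 0 := by
      simp [LieCochains.counit]
    change G.value 0 (G.alpha (UniversalEnvelopingAlgebra.ι R x)) =
      LieCochains.counit R G.LieAlg (UniversalEnvelopingAlgebra.ι R x)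
    rw [alpha_ι, h1, h2]
  exact DFunLike.congr_fun h u

lemma counit_divBasis [IsDomain R] [CharZero R] (d : Fin m →₀ ℕ) :
    LieCochains.counit R G.LieAlg (G.divBasis d) = if d = 0 then 1 else 0 := by
  classical
  rw [← value_zero_alpha, alpha_divBasis, map_smul, value_delta]
  split_ifs with h
  · subst h; simp [multiFactorial]
  · simp

end Counit

/-! ### Coefficients of the cofaces -/

section Contract

variable {n : ℕ}

/-- The tuple `u` with the neighbouring entries `u_i`, `u_{i+1}` replaced by the single entry
`x`. -/
def contract {B : Type*} (i : Fin n) (u : Fin (n + 1) → B) (x : B) : Fin n → B :=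
  Function.update (fun k => u (i.castSucc.succAbove k)) i x

lemma castSucc_succAbove (i k : Fin n) :
    i.castSucc.succAbove k = if k < i then k.castSucc else k.succ := by
  simp [Fin.succAbove]

lemma mulNeighbours_eq_contract (L : Type u) [LieRing L] [LieAlgebra R L] (i : Fin n)
    (u : Fin (n + 1) → UniversalEnvelopingAlgebra R L) :
    LieCochains.mulNeighbours R L i u = contract i u (u i.castSucc * u i.succ) := by
  funext k
  rw [LieCochains.mulNeighbours, contract, Function.update_apply, castSucc_succAbove]
  by_cases h : k = i
  · subst h; simp
  · simp only [h, if_false]; split_ifs <;> rfl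

/-- The map `i.predAbove` records which argument of the coface uses the block `c`. Its fibres,
single blocks except for the pair at `i`, are the disjoint sets of variables in
`coeff_prod_cofaceArgs`. -/
lemma predAbove_eq_iff (i k : Fin n) (hk : k ≠ i) (c : Fin (n + 1)) :
    i.predAbove c = k ↔ c = i.castSucc.succAbove k := by
  have hne : (k : ℕ) ≠ i := fun h => hk (Fin.ext h)
  rw [castSucc_succAbove, Fin.predAbove]
  by_cases h1 : i.castSucc < c
  · have h1' : (i : ℕ) < c := h1
    rw [dif_pos h1]
    split_ifs with h2
    · have h2' : (k : ℕ) < i := h2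
      simp only [Fin.ext_iff, Fin.val_pred, Fin.val_castSucc]
      omega
    · simp only [Fin.ext_iff, Fin.val_pred, Fin.val_succ]
      omega
  · have h1' : ¬ (i : ℕ) < c := h1
    rw [dif_neg h1]
    split_ifs with h2
    · simp only [Fin.ext_iff, Fin.val_castSucc, Fin.coe_castPred]
    · have h2' : ¬ (k : ℕ) < i := h2
      simp only [Fin.ext_iff, Fin.val_succ, Fin.coe_castPred]
      omega

lemma predAbove_eq_self_iff (i : Fin n) (c : Fin (n + 1)) :
    i.predAbove c = i ↔ c = i.castSucc ∨ c = i.succ := by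
  rw [Fin.predAbove]
  by_cases h1 : i.castSucc < c
  · have h1' : (i : ℕ) < c := h1
    rw [dif_pos h1]
    simp only [Fin.ext_iff, Fin.val_pred, Fin.val_castSucc, Fin.val_succ]
    omega
  · have h1' : ¬ (i : ℕ) < c := h1
    rw [dif_neg h1]
    simp only [Fin.ext_iff, Fin.val_castSucc, Fin.val_succ, Fin.coe_castPred]
    omega

/-- The inclusion of two neighbouring blocks of variables. -/
def doubleEmb (m : ℕ) (i : Fin n) : Fin 2 × Fin m ↪ Fin (n + 1) × Fin m :=
  Function.Embedding.prodMap ⟨![i.castSucc, i.succ], by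
    intro a b h
    fin_cases a <;> fin_cases b <;> simp_all [Fin.ext_iff]⟩ (Function.Embedding.refl _)

lemma doubleEmb_zero (i : Fin n) (j : Fin m) : doubleEmb m i (0, j) = (i.castSucc, j) := rfl

lemma doubleEmb_one (i : Fin n) (j : Fin m) : doubleEmb m i (1, j) = (i.succ, j) := rfl

end Contract

section CofaceCoeff

variable (A : Type u) [CommRing A] [Algebra R A]

variable {n : ℕ}

/-- The inner cofaces have index `i.castSucc.succ`, that is number i + 1, and merge the blocks i and
i + 1 counted from zero. The indices `0` and `(Fin.last n).succ` are the two outer cofaces. -/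
lemma cofaceArgs_of_ne (i k : Fin n) (hk : k ≠ i) (j : Fin m) :
    G.cofaceArgs A n i.castSucc.succ (k, j) = X (i.castSucc.succAbove k, j) := by
  have : (k : ℕ) ≠ i := fun h => hk (Fin.ext h)
  rw [cofaceArgs, castSucc_succAbove]
  simp only [Fin.val_succ, Fin.val_castSucc, add_lt_add_iff_right, add_left_inj, this, if_false,
    Fin.lt_def]
  split_ifs <;> rfl

lemma cofaceArgs_self (i : Fin n) (j : Fin m) :
    G.cofaceArgs A n i.castSucc.succ (i, j) = rename (doubleEmb m i) (G.seriesOver A j) := by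
  rw [cofaceArgs]
  simp only [Fin.val_succ, Fin.val_castSucc, lt_irrefl, if_false, if_true]
  rw [eval, rename_eq_subst]
  congr 1
  funext ⟨b, k⟩
  fin_cases b <;> rfl

lemma prod_seriesOver (e : Fin m →₀ ℕ) : ∏ j, G.seriesOver A j ^ e j =
    MvPowerSeries.map (algebraMap R A) (G.monomialImage e) := by
  simp [monomialImage, seriesOver, map_prod]

/-- The factors for different arguments use disjoint blocks, so the coefficient is a product: a
Kronecker delta for each untouched block and a structure constant for the merged pair. -/
lemma coeff_prod_cofaceArgs (i : Fin n) (p : Fin (n + 1) → (Fin m →₀ ℕ))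
    (P : Fin n → (Fin m →₀ ℕ)) :
    coeff (joinExp p) ((joinExp P).prod fun s e => G.cofaceArgs A n i.castSucc.succ s ^ e) =
      if P = contract i p (P i) then
        algebraMap R A (G.structureConst (p i.castSucc) (p i.succ) (P i)) else 0 := by
  classical
  rw [Finsupp.prod_fintype _ _ (by simp), Fintype.prod_prod_type]
  simp only [joinExp_apply]
  let S : Fin n → Set (Fin (n + 1) × Fin m) := fun k => {q | i.predAbove q.1 = k}
  let a : Fin n → (Fin (n + 1) × Fin m →₀ ℕ) := fun k =>
    (joinExp p).filter fun q => i.predAbove q.1 = k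
  have hsum : joinExp p = ∑ k, a k := by
    ext q
    rw [Finsupp.finsetSum_apply]
    simp [a, Finsupp.filter_apply]
  have hFi : ∏ j, G.cofaceArgs A n i.castSucc.succ (i, j) ^ P i j =
      rename (doubleEmb m i) (MvPowerSeries.map (algebraMap R A) (G.monomialImage (P i))) := by
    rw [← prod_seriesOver, map_prod]
    simp only [cofaceArgs_self, map_pow]
  have hFk : ∀ k, k ≠ i → ∏ j, G.cofaceArgs A n i.castSucc.succ (k, j) ^ P k j =
      rename (singleEmb (i.castSucc.succAbove k)) (monomial (P k) (1 : A)) := by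
    intro k hk
    have h1 : (monomial (P k) (1 : A)) = ∏ j, X j ^ P k j := by
      rw [monomial_one_eq, Finsupp.prod_fintype _ _ (by simp)]
    rw [h1, map_prod]
    refine Finset.prod_congr rfl fun j _ => ?_
    rw [cofaceArgs_of_ne _ _ _ _ hk, map_pow, rename_X]
    rfl
  have hai : a i = Finsupp.embDomain (doubleEmb m i) (joinExp ![p i.castSucc, p i.succ]) := by
    ext ⟨c, j⟩
    simp only [a, Finsupp.filter_apply]
    split_ifs with h
    · rcases (predAbove_eq_self_iff i c).mp h with rfl | rfl
      · rw [← doubleEmb_zero, Finsupp.embDomain_apply_self]; rfl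
      · rw [← doubleEmb_one, Finsupp.embDomain_apply_self]; rfl
    · rw [Finsupp.embDomain_of_notMem_range]
      rintro ⟨⟨b, k⟩, hb⟩
      apply h
      rw [predAbove_eq_self_iff]
      fin_cases b
      · exact Or.inl (congrArg Prod.fst hb).symm
      · exact Or.inr (congrArg Prod.fst hb).symm
  have hak : ∀ k, k ≠ i → a k = Finsupp.embDomain (singleEmb (i.castSucc.succAbove k))
      (p (i.castSucc.succAbove k)) := by
    intro k hk
    rw [← joinExp_single]
    ext ⟨c, j⟩
    simp only [a, Finsupp.filter_apply, joinExp_apply, predAbove_eq_iff i k hk]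
    split_ifs with h
    · rw [h, Pi.single_eq_same]
    · rw [Pi.single_eq_of_ne h]; rfl
  rw [hsum, coeff_sum_prod_of_suppOn (S := S)]
  · rw [← Finset.mul_prod_erase _ _ (Finset.mem_univ i), hFi, hai, coeff_embDomain_rename, coeff_map]
    have h2 : ∀ k ∈ Finset.univ.erase i,
        coeff (a k) (∏ j, G.cofaceArgs A n i.castSucc.succ (k, j) ^ P k j) =
          if P k = p (i.castSucc.succAbove k) then 1 else 0 := by
      intro k hk
      have hk := Finset.ne_of_mem_erase hk
      rw [hFk k hk, hak k hk, coeff_embDomain_rename, coeff_monomial]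
      exact if_congr eq_comm rfl rfl
    rw [Finset.prod_congr rfl h2, Finset.prod_ite_zero, Finset.prod_const_one]
    have h3 : (∀ k ∈ Finset.univ.erase i, P k = p (i.castSucc.succAbove k)) ↔
        P = contract i p (P i) := by
      rw [funext_iff]
      refine forall_congr' fun k => ?_
      rw [contract, Function.update_apply]
      by_cases hk : k = i
      · subst hk; simp
      · simp [hk]
    by_cases h4 : P = contract i p (P i)
    · rw [if_pos h4, if_pos (h3.mpr h4), mul_one]
      rfl
    · rw [if_neg h4, if_neg fun h => h4 (h3.mp h), mul_zero]
  · intro k l hkl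
    refine Set.disjoint_left.mpr fun q hk hl => hkl ?_
    exact (show i.predAbove q.1 = k from hk).symm.trans hl
  · intro k
    by_cases hk : k = i
    · subst hk
      rw [hFi]
      refine (SuppOn.rename _ _).mono ?_
      rintro _ ⟨⟨b, j⟩, rfl⟩
      refine (predAbove_eq_self_iff _ _).mpr ?_
      fin_cases b
      · exact Or.inl rfl
      · exact Or.inr rfl
    · rw [hFk k hk]
      refine (SuppOn.rename _ _).mono ?_
      rintro _ ⟨j, rfl⟩
      exact (predAbove_eq_iff _ _ hk _).mpr rfl
  · intro k q hq
    exact Finsupp.filter_apply_neg _ _ hq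

lemma contract_self {B : Type*} (i : Fin n) (u : Fin (n + 1) → B) (x : B) :
    contract i u x i = x := Function.update_self _ _ _

/-- Only exponents agreeing with `p` outside position `i` contribute, so the substitution sum
collapses to one free multi-index. The result is the transpose of the expansion of δ_x δ_y in the
basis of functionals. -/
lemma coeff_coface_mid (i : Fin n) (p : Fin (n + 1) → (Fin m →₀ ℕ))
    (f : MvPowerSeries (Fin n × Fin m) A) :
    coeff (joinExp p) (G.coface A n i.castSucc.succ f) =
      ∑ᶠ e, G.structureConst (p i.castSucc) (p i.succ) e • coeff (joinExp (contract i p e)) f := by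
  classical
  rw [coface, substAlgHom_apply, coeff_subst (G.hasSubst_cofaceArgs A n _), finsum_joinExp]
  have hinj : Function.Injective (contract i p) := by
    intro d d' h
    rw [← contract_self i p d, h, contract_self]
  rw [← finsum_mem_univ]
  have h1 : ∑ᶠ P ∈ Set.univ, (coeff (joinExp P) f • coeff (joinExp p)
      ((joinExp P).prod fun s e => G.cofaceArgs A n i.castSucc.succ s ^ e)) =
      ∑ᶠ P ∈ Set.range (contract i p), (coeff (joinExp P) f • coeff (joinExp p)
        ((joinExp P).prod fun s e => G.cofaceArgs A n i.castSucc.succ s ^ e)) := by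
    apply finsum_mem_inter_support_eq
    ext P
    simp only [Set.univ_inter, Set.mem_inter_iff, Function.mem_support]
    constructor
    · intro h
      refine ⟨?_, h⟩
      by_contra h'
      apply h
      rw [coeff_prod_cofaceArgs, if_neg, smul_zero]
      exact fun h2 => h' ⟨P i, h2.symm⟩
    · exact fun h => h.2
  rw [h1, finsum_mem_range hinj]
  refine finsum_congr fun e => ?_
  rw [coeff_prod_cofaceArgs, contract_self, if_pos rfl, smul_eq_mul, mul_comm, Algebra.smul_def]

/-- The renaming of blocks of variables along an embedding. -/
def blocksEmb (m : ℕ) {k l : ℕ} (φ : Fin k ↪ Fin l) : Fin k × Fin m ↪ Fin l × Fin m :=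
  φ.prodMap (Function.Embedding.refl _)

omit [Algebra R A] in
lemma coeff_rename_blocksEmb {k l : ℕ} (φ : Fin k ↪ Fin l) (c : Fin l)
    (hc : ∀ a, a ≠ c ↔ a ∈ Set.range φ)
    (p : Fin l → (Fin m →₀ ℕ)) (f : MvPowerSeries (Fin k × Fin m) A) :
    coeff (joinExp p) (rename (blocksEmb m φ) f) =
      if p c = 0 then coeff (joinExp (p ∘ φ)) f else 0 := by
  split_ifs with h
  · rw [← coeff_embDomain_rename (blocksEmb m φ) f]
    congr 1
    congr 1
    ext ⟨a, j⟩
    by_cases ha : a = c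
    · subst ha
      rw [Finsupp.embDomain_of_notMem_range, joinExp_apply]
      · simp [h]
      · rintro ⟨⟨b, k⟩, hb⟩
        exact (hc a).mpr ⟨b, congrArg Prod.fst hb⟩ rfl
    · obtain ⟨b, rfl⟩ := (hc a).mp ha
      have := Finsupp.embDomain_apply_self (blocksEmb m φ) (joinExp (p ∘ φ)) (b, j)
      rw [show blocksEmb m φ (b, j) = (φ b, j) from rfl] at this
      rw [this]
      rfl
  · apply coeff_rename_eq_zero
    rintro ⟨x, hx⟩
    apply h
    ext j
    have := DFunLike.congr_fun hx (c, j)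
    rw [Finsupp.mapDomain_of_notMem_range] at this
    · exact this.symm
    · rintro ⟨⟨b, k⟩, hb⟩
      exact (hc c).mpr ⟨b, congrArg Prod.fst hb⟩ rfl

lemma coface_zero_eq (f : MvPowerSeries (Fin n × Fin m) A) :
    G.coface A n 0 f = rename (blocksEmb m (Fin.succEmb n)) f := by
  rw [coface, substAlgHom_apply, rename_eq_subst]
  congr 1

lemma coface_last_eq (f : MvPowerSeries (Fin n × Fin m) A) :
    G.coface A n (Fin.last n).succ f = rename (blocksEmb m Fin.castSuccEmb) f := by
  rw [coface, substAlgHom_apply, rename_eq_subst]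
  congr 1
  funext ⟨k, j⟩
  rw [cofaceArgs, if_pos (by simp)]
  rfl

lemma coeff_coface_zero (p : Fin (n + 1) → (Fin m →₀ ℕ)) (f : MvPowerSeries (Fin n × Fin m) A) :
    coeff (joinExp p) (G.coface A n 0 f) =
      if p 0 = 0 then coeff (joinExp fun k => p k.succ) f else 0 := by
  rw [coface_zero_eq, coeff_rename_blocksEmb _ _ 0]
  · rfl
  · intro a
    exact ⟨fun h => ⟨a.pred h, Fin.succ_pred a h⟩, fun ⟨b, hb⟩ => hb ▸ Fin.succ_ne_zero b⟩

lemma coeff_coface_last (p : Fin (n + 1) → (Fin m →₀ ℕ)) (f : MvPowerSeries (Fin n × Fin m) A) :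
    coeff (joinExp p) (G.coface A n (Fin.last n).succ f) =
      if p (Fin.last n) = 0 then coeff (joinExp fun k => p k.castSucc) f else 0 := by
  rw [coface_last_eq, coeff_rename_blocksEmb _ _ (Fin.last n)]
  · rfl
  · intro a
    exact ⟨fun h => ⟨a.castPred h, Fin.castSucc_castPred a h⟩,
      fun ⟨b, hb⟩ => hb ▸ (Fin.castSucc_lt_last b).ne⟩

end CofaceCoeff

/-! ### Compatibility with differentials and comultiplication -/

section CofaceDual

variable [IsDomain R] [CharZero R] (A : Type u) [CommRing A] [Algebra R A] {n : ℕ}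

lemma multiFactorial_joinExp_contract (i : Fin n) (p : Fin (n + 1) → (Fin m →₀ ℕ)) :
    multiFactorial (joinExp p) = multiFactorial (p i.castSucc) * multiFactorial (p i.succ) *
      ∏ k, if k = i then 1 else multiFactorial (p (i.castSucc.succAbove k)) := by
  classical
  rw [multiFactorial_joinExp, Fin.prod_univ_succAbove _ i.castSucc, mul_assoc,
    ← Finset.mul_prod_erase _ _ (Finset.mem_univ i),
    ← Finset.mul_prod_erase (Finset.univ : Finset (Fin n)) _ (Finset.mem_univ i), if_pos rfl,
    one_mul, Fin.succAbove_castSucc_self]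
  congr 2
  exact Finset.prod_congr rfl fun k hk => (if_neg (Finset.ne_of_mem_erase hk)).symm

/-- In position `i` the product of two elements of `divBasis` becomes x! y! δ_x δ_y, whose expansion
matches `coeff_coface_mid`. The factorials of the other blocks are common to both sides. -/
lemma dualAlpha_faceMul (i : Fin n) (p : Fin (n + 1) → (Fin m →₀ ℕ))
    (f : MvPowerSeries (Fin n × Fin m) A) :
    G.dualAlpha A n f (LieCochains.faceMul R G.LieAlg n i
      (PiTensorProduct.tprod R fun k => G.divBasis (p k))) =
      G.dualAlpha A (n + 1) (G.coface A n i.castSucc.succ f)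
        (PiTensorProduct.tprod R fun k => G.divBasis (p k)) := by
  classical
  rw [dualAlpha_tprod_divBasis, LieCochains.faceMul_tprod, mulNeighbours_eq_contract,
    dualAlpha_apply_tprod, coeff_coface_mid]
  let w : Fin n → G.Distr := fun k => G.alpha (G.divBasis (p (i.castSucc.succAbove k)))
  -- All positions except `i` are frozen, so that the product in position `i` may be expanded
  -- linearly.
  let L : G.Distr →ₗ[R] A :=
    (((G.pairing A n f).compMultilinearMap (PiTensorProduct.tprod R)).toLinearMap w i)
  have hL : ∀ a, L a = G.pairing A n f (PiTensorProduct.tprod R (Function.update w i a)) :=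
    fun a => rfl
  have h1 : (fun k => G.alpha (contract i (fun k => G.divBasis (p k))
      (G.divBasis (p i.castSucc) * G.divBasis (p i.succ)) k)) =
      Function.update w i (((multiFactorial (p i.castSucc) : R) * multiFactorial (p i.succ)) •
        G.deltaMul (p i.castSucc) (p i.succ)) := by
    funext k
    rw [contract, Function.update_apply, Function.update_apply, apply_ite G.alpha, map_mul,
      alpha_divBasis, alpha_divBasis, smul_mul_smul_comm, mul_def, mulLin_delta]
  have h2 : ∀ e, L (G.delta e) =
      (((∏ k, if k = i then 1 else multiFactorial (p (i.castSucc.succAbove k)) : ℕ)) : R) •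
        coeff (joinExp (contract i p e)) f := by
    intro e
    have h3 : Function.update w i (G.delta e) = fun k =>
        (((if k = i then 1 else multiFactorial (p (i.castSucc.succAbove k)) : ℕ)) : R) •
          G.delta (contract i p e k) := by
      funext k
      rw [contract, Function.update_apply, Function.update_apply]
      split_ifs with hk
      · simp
      · exact G.alpha_divBasis _
    rw [hL, h3, MultilinearMap.map_smul_univ, map_smul, pairing_tprod_delta, Nat.cast_prod]
  rw [h1, ← hL, map_smul, linearMap_eq_finsum]
  simp only [value_deltaMul, h2]
  rw [multiFactorial_joinExp_contract i p]
  have h4 : ∀ e, G.structureConst (p i.castSucc) (p i.succ) e •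
      (((∏ k, if k = i then 1 else multiFactorial (p (i.castSucc.succAbove k)) : ℕ)) : R) •
        coeff (joinExp (contract i p e)) f =
      (((∏ k, if k = i then 1 else multiFactorial (p (i.castSucc.succAbove k)) : ℕ)) : R) •
        G.structureConst (p i.castSucc) (p i.succ) e • coeff (joinExp (contract i p e)) f :=
    fun e => smul_comm _ _ _
  -- Finiteness is needed to move the scalar out of the `finsum`, since `A` is an arbitrary algebra.
  have h5 : (Function.support fun e => G.structureConst (p i.castSucc) (p i.succ) e •
      coeff (joinExp (contract i p e)) f).Finite := by
    refine (G.finite_structureConst (p i.castSucc) (p i.succ)).subset fun e he h0 => he ?_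
    simp only at h0 ⊢
    rw [h0, zero_smul]
  simp only [h4]
  rw [← smul_finsum' _ h5, smul_smul, Algebra.smul_def, map_mul, map_mul, map_natCast,
    map_natCast, map_natCast, Nat.cast_mul, Nat.cast_mul]

lemma dualAlpha_faceFirst (p : Fin (n + 1) → (Fin m →₀ ℕ))
    (f : MvPowerSeries (Fin n × Fin m) A) :
    G.dualAlpha A n f (LieCochains.faceFirst R G.LieAlg n
      (PiTensorProduct.tprod R fun k => G.divBasis (p k))) =
      G.dualAlpha A (n + 1) (G.coface A n 0 f)
        (PiTensorProduct.tprod R fun k => G.divBasis (p k)) := by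
  classical
  rw [dualAlpha_tprod_divBasis, LieCochains.faceFirst_tprod, map_smul, dualAlpha_tprod_divBasis,
    counit_divBasis, coeff_coface_zero]
  split_ifs with h
  · rw [one_smul, multiFactorial_joinExp, multiFactorial_joinExp, Fin.prod_univ_succ, h]
    simp [multiFactorial]
  · simp

lemma dualAlpha_faceLast (p : Fin (n + 1) → (Fin m →₀ ℕ))
    (f : MvPowerSeries (Fin n × Fin m) A) :
    G.dualAlpha A n f (LieCochains.faceLast R G.LieAlg n
      (PiTensorProduct.tprod R fun k => G.divBasis (p k))) =
      G.dualAlpha A (n + 1) (G.coface A n (Fin.last n).succ f)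
        (PiTensorProduct.tprod R fun k => G.divBasis (p k)) := by
  classical
  rw [dualAlpha_tprod_divBasis, LieCochains.faceLast_tprod, map_smul, dualAlpha_tprod_divBasis,
    counit_divBasis, coeff_coface_last]
  split_ifs with h
  · rw [one_smul, multiFactorial_joinExp, multiFactorial_joinExp, Fin.prod_univ_castSucc, h]
    simp [multiFactorial]
  · simp

/-- Coface by coface this is the duality checked on `divBasis`. The coefficients `A` are arbitrary
so that the same identity serves `R`, for the cochains of G, and the fraction field, for the
modified cochains. -/
lemma dualAlpha_cobarD (f : MvPowerSeries (Fin n × Fin m) A)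
    (x : LieCochains.UPow R G.LieAlg (n + 1)) :
    G.dualAlpha A (n + 1) (G.cobarD A n f) x =
      G.dualAlpha A n f ((LieCochains.faceFirst R G.LieAlg n +
        ∑ i : Fin n, (-1 : R) ^ ((i : ℕ) + 1) • LieCochains.faceMul R G.LieAlg n i +
          (-1 : R) ^ (n + 1) • LieCochains.faceLast R G.LieAlg n) x) := by
  refine LinearMap.congr_fun ((G.divBasisPow (n + 1)).ext (f₁ := G.dualAlpha A (n + 1)
    (G.cobarD A n f)) (f₂ := (G.dualAlpha A n f) ∘ₗ (LieCochains.faceFirst R G.LieAlg n +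
        ∑ i : Fin n, (-1 : R) ^ ((i : ℕ) + 1) • LieCochains.faceMul R G.LieAlg n i +
          (-1 : R) ^ (n + 1) • LieCochains.faceLast R G.LieAlg n)) fun p => ?_) x
  simp only [divBasisPow_apply, cobarD, LinearMap.sum_apply, LinearMap.smul_apply,
    LinearMap.comp_apply, LinearMap.add_apply, map_add, map_sum, map_smul, dualAlpha_faceFirst,
    dualAlpha_faceMul, dualAlpha_faceLast]
  rw [Fin.sum_univ_succ, Fin.sum_univ_castSucc]
  refine (add_assoc _ _ _).symm.trans ?_
  simp

theorem alphaTilde_comm (n : ℕ) :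
    G.alphaTilde (n + 1) ∘ₗ G.cobarTildeD n = G.inhomD n ∘ₗ G.alphaTilde n := by
  refine LinearMap.ext fun f => LinearMap.ext fun x => algebraMap_inj ?_
  change algebraMap R (FractionRing R) (G.alphaTilde (n + 1) (G.cobarTildeD n f) x) =
    algebraMap R (FractionRing R) (G.alphaTilde n f _)
  rw [algebraMap_alphaTilde, algebraMap_alphaTilde]
  exact G.dualAlpha_cobarD (FractionRing R) f.1 x

omit [IsDomain R] [CharZero R] in
lemma pairing_two_subst (f : MvPowerSeries (Fin m) A) (a b : G.Distr) :
    G.pairing A 2 (subst (G.seriesOver A) f) (PiTensorProduct.tprod R ![a, b]) =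
      G.pairingOne A f (a * b) := by
  have h : (G.pairing A 2 (subst (G.seriesOver A) f)).compMultilinearMap
      (PiTensorProduct.tprod R) =
      (G.pairingOne A f).compMultilinearMap (MultilinearMap.mkPiAlgebraFin R 2 G.Distr) := by
    refine Module.Basis.ext_multilinear (fun _ => G.deltaBasis) fun p => ?_
    refine (G.pairing_tprod_delta A 2 _ p).trans ?_
    have h1 : (G.pairingOne A f).compMultilinearMap (MultilinearMap.mkPiAlgebraFin R 2 G.Distr)
        (fun i => G.deltaBasis (p i)) = G.pairingOne A f (G.delta (p 0) * G.delta (p 1)) := by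
      simp [delta]
    have e1 : p = ![p 0, p 1] := by
      funext b; fin_cases b <;> rfl
    rw [h1, mul_def, mulLin_delta, linearMap_eq_finsum,
      coeff_subst (hasSubst_of_constantCoeff_zero (G.constantCoeff_seriesOver A))]
    refine finsum_congr fun d => ?_
    rw [value_deltaMul, pairingOne_delta, Finsupp.prod_fintype _ _ (by simp), prod_seriesOver,
      coeff_map, smul_eq_mul, mul_comm, ← Algebra.smul_def, structureConst, ← e1]
  have := congrArg (fun F => F ![a, b]) h
  simpa using this

theorem alphaTildeOne_comul (f : G.OTilde) (u v : G.U) :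
    G.alphaTilde 2 (G.comulTilde f) (PiTensorProduct.tprod R ![u, v]) =
      G.alphaTildeOne f (u * v) := by
  apply algebraMap_inj
  rw [algebraMap_alphaTilde, algebraMap_alphaTildeOne, dualAlpha_apply_tprod, map_mul,
    ← pairing_two_subst]
  congr 2
  funext b
  fin_cases b <;> rfl

/-- Rather than comparing substitutions over `R` and over its fraction field, one applies the
injective `alphaTilde`; both sides then become the transpose of the same map on tensor powers of
`U`. -/
theorem incl_comm (n : ℕ) : G.incl (n + 1) ∘ₗ G.cobarD R n = G.cobarTildeD n ∘ₗ G.incl n := by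
  refine LinearMap.ext fun f => (G.alphaTilde_bijective (n + 1)).1 ?_
  rw [← LinearMap.comp_apply, ← LinearMap.comp_apply, ← LinearMap.comp_assoc,
    ← LinearMap.comp_assoc, alphaTilde_comm, alphaTilde_comp_incl, LinearMap.comp_assoc,
    alphaTilde_comp_incl]
  exact LinearMap.ext fun x => G.dualAlpha_cobarD R f x

omit [IsDomain R] [CharZero R] in
lemma incl_injective (n : ℕ) : Function.Injective (G.incl n) := by
  intro f g h
  ext d
  have := congrArg (fun x => coeff d x.1) h
  exact FaithfulSMul.algebraMap_injective R (FractionRing R) (by simpa [incl] using this)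

end CofaceDual

end FormalGroupLaw

/-! ### The bar resolution and homogeneous cochains -/

namespace LieCochains

variable (R : Type u) [CommRing R] (L : Type u) [LieRing L] [LieAlgebra R L]

section Extend

variable {R L} {N P : Type u} [AddCommGroup N] [Module R N] [AddCommGroup P] [Module R P]
  [Module (UniversalEnvelopingAlgebra R L) P] [IsScalarTower R (UniversalEnvelopingAlgebra R L) P]

/-- The `U(L)`-linear extension `u ⊗ x ↦ u • g x` of a linear map. -/
def extend (g : N →ₗ[R] P) :
    UniversalEnvelopingAlgebra R L ⊗[R] N →ₗ[UniversalEnvelopingAlgebra R L] P where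
  __ := TensorProduct.lift ((LinearMap.lcomp R P g) ∘ₗ
    (Algebra.lsmul R R P : UniversalEnvelopingAlgebra R L →ₐ[R] _).toLinearMap)
  map_smul' u x := by
    induction x with
    | zero => simp
    | add x y hx hy =>
      simp only [AddHom.toFun_eq_coe, LinearMap.coe_toAddHom, RingHom.id_apply, smul_add,
        map_add] at hx hy ⊢
      rw [hx, hy]
    | tmul v x => simp [TensorProduct.smul_tmul']

@[simp] lemma extend_tmul (g : N →ₗ[R] P) (u : UniversalEnvelopingAlgebra R L) (x : N) :
    extend g (u ⊗ₜ[R] x) = u • g x := by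
  simp [extend]

omit [Module R P] [IsScalarTower R (UniversalEnvelopingAlgebra R L) P] in
lemma hom_ext_tmul {F F' : UniversalEnvelopingAlgebra R L ⊗[R] N →ₗ[UniversalEnvelopingAlgebra R L] P}
    (h : ∀ x, F (1 ⊗ₜ[R] x) = F' (1 ⊗ₜ[R] x)) : F = F' := by
  refine LinearMap.ext fun y => ?_
  induction y with
  | zero => simp
  | add x y hx hy => rw [map_add, map_add, hx, hy]
  | tmul u x =>
    rw [show u ⊗ₜ[R] x = u • (1 : UniversalEnvelopingAlgebra R L) ⊗ₜ[R] x by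
      rw [TensorProduct.smul_tmul', smul_eq_mul, mul_one], map_smul, map_smul, h]

variable (R L) in
/-- The reduction `u ⊗ x ↦ ε(u) x`. -/
def reduce (N : Type u) [AddCommGroup N] [Module R N] :
    UniversalEnvelopingAlgebra R L ⊗[R] N →ₗ[R] N :=
  TensorProduct.lift ((LinearMap.lsmul R N) ∘ₗ (counit R L).toLinearMap)

@[simp] lemma reduce_tmul (u : UniversalEnvelopingAlgebra R L) (x : N) :
    reduce R L N (u ⊗ₜ[R] x) = counit R L u • x := by
  simp [reduce]

lemma reduce_smul (u : UniversalEnvelopingAlgebra R L) (y : UniversalEnvelopingAlgebra R L ⊗[R] N) :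
    reduce R L N (u • y) = counit R L u • reduce R L N y := by
  induction y with
  | zero => simp
  | add x y hx hy => rw [smul_add, map_add, map_add, hx, hy, smul_add]
  | tmul v x => rw [TensorProduct.smul_tmul', reduce_tmul, reduce_tmul, smul_eq_mul, map_mul,
      mul_smul]

/-- With values in the trivial module, a U-linear functional factors through the coinvariants of U ⊗
N, which are N via `reduce`. -/
lemma equivariantDual_apply (F : equivariantDual R L N)
    (y : UniversalEnvelopingAlgebra R L ⊗[R] N) :
    F.1 y = F.1 (1 ⊗ₜ[R] reduce R L N y) := by
  induction y with
  | zero => simp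
  | add x y hx hy => rw [map_add, map_add, hx, hy, TensorProduct.tmul_add, map_add]
  | tmul u x =>
    rw [reduce_tmul, TensorProduct.tmul_smul, map_smul]
    have := F.2 u (1 ⊗ₜ[R] x)
    rwa [TensorProduct.smul_tmul', smul_eq_mul, mul_one] at this

variable {N' N'' : Type u} [AddCommGroup N'] [Module R N'] [AddCommGroup N''] [Module R N'']

/-- Precomposition with a `U(L)`-linear map. -/
def pull (φ : UniversalEnvelopingAlgebra R L ⊗[R] N →ₗ[UniversalEnvelopingAlgebra R L]
    UniversalEnvelopingAlgebra R L ⊗[R] N') :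
    equivariantDual R L N' →ₗ[R] equivariantDual R L N where
  toFun F := ⟨F.1 ∘ₗ φ.restrictScalars R, fun u x => by
    change F.1 (φ (u • x)) = _ * F.1 (φ x)
    rw [map_smul, F.2]⟩
  map_add' _ _ := rfl
  map_smul' _ _ := rfl

lemma pull_apply (φ : UniversalEnvelopingAlgebra R L ⊗[R] N →ₗ[UniversalEnvelopingAlgebra R L]
    UniversalEnvelopingAlgebra R L ⊗[R] N') (F : equivariantDual R L N')
    (x : UniversalEnvelopingAlgebra R L ⊗[R] N) : (pull φ F).1 x = F.1 (φ x) := rfl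

lemma pull_comp (φ : UniversalEnvelopingAlgebra R L ⊗[R] N →ₗ[UniversalEnvelopingAlgebra R L]
    UniversalEnvelopingAlgebra R L ⊗[R] N')
    (ψ : UniversalEnvelopingAlgebra R L ⊗[R] N' →ₗ[UniversalEnvelopingAlgebra R L]
    UniversalEnvelopingAlgebra R L ⊗[R] N'') : pull (ψ ∘ₗ φ) = pull φ ∘ₗ pull ψ := rfl

lemma pull_zero : pull (0 : UniversalEnvelopingAlgebra R L ⊗[R] N →ₗ[UniversalEnvelopingAlgebra R L]
    UniversalEnvelopingAlgebra R L ⊗[R] N') = 0 := by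
  refine LinearMap.ext fun F => Subtype.ext (LinearMap.ext fun x => ?_)
  change F.1 0 = 0
  rw [map_zero]

end Extend

section Bar

/-- Splitting off the first factor, `u_0 ⊗ ⋯ ⊗ u_n ↦ u_0 ⊗ (u_1 ⊗ ⋯ ⊗ u_n)`. -/
def splitFirst (n : ℕ) : UPow R L (n + 1) →ₗ[R] UniversalEnvelopingAlgebra R L ⊗[R] UPow R L n :=
  PiTensorProduct.lift (LinearMap.uncurryLeft
    { toFun := fun v => (TensorProduct.mk R _ _ v).compMultilinearMap (PiTensorProduct.tprod R
        (s := fun _ : Fin n => UniversalEnvelopingAlgebra R L))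
      map_add' := fun v v' => by ext u; simp
      map_smul' := fun r v => by ext u; simp [TensorProduct.smul_tmul'] })

lemma splitFirst_tprod (n : ℕ) (u : Fin (n + 1) → UniversalEnvelopingAlgebra R L) :
    splitFirst R L n (PiTensorProduct.tprod R u) =
      u 0 ⊗ₜ[R] PiTensorProduct.tprod R fun k => u k.succ := by
  simp [splitFirst, Fin.tail_def]

/-- `u_0 ⊗ (u_1 ⊗ ⋯ ⊗ u_n) ↦ u_0 ⊗ ⋯ ⊗ u_n`. -/
def joinFirst (n : ℕ) : UniversalEnvelopingAlgebra R L ⊗[R] UPow R L n →ₗ[R] UPow R L (n + 1) :=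
  TensorProduct.lift (PiTensorProduct.lift.toLinearMap ∘ₗ (PiTensorProduct.tprod R
    (s := fun _ : Fin (n + 1) => UniversalEnvelopingAlgebra R L)).curryLeft)

lemma joinFirst_tprod (n : ℕ) (v : UniversalEnvelopingAlgebra R L)
    (u : Fin n → UniversalEnvelopingAlgebra R L) :
    joinFirst R L n (v ⊗ₜ[R] PiTensorProduct.tprod R u) =
      PiTensorProduct.tprod R (Fin.cons v u : Fin (n + 1) → UniversalEnvelopingAlgebra R L) := by
  simp [joinFirst]

variable {R L} in
lemma tmul_ext {N : Type u} [AddCommGroup N] [Module R N] {n : ℕ}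
    {F F' : UniversalEnvelopingAlgebra R L ⊗[R] UPow R L n →ₗ[R] N}
    (h : ∀ v (u : Fin n → UniversalEnvelopingAlgebra R L),
      F (v ⊗ₜ[R] PiTensorProduct.tprod R u) = F' (v ⊗ₜ[R] PiTensorProduct.tprod R u)) :
    F = F' := by
  refine TensorProduct.ext (LinearMap.ext fun v => ?_)
  exact PiTensorProduct.ext (MultilinearMap.ext fun u => h v u)

lemma splitFirst_joinFirst (n : ℕ) (y : UniversalEnvelopingAlgebra R L ⊗[R] UPow R L n) :
    splitFirst R L n (joinFirst R L n y) = y := by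
  refine LinearMap.congr_fun (tmul_ext (F := splitFirst R L n ∘ₗ joinFirst R L n)
    (F' := LinearMap.id) fun v u => ?_) y
  rw [LinearMap.comp_apply, joinFirst_tprod, splitFirst_tprod]
  rfl

lemma joinFirst_splitFirst (n : ℕ) (w : UPow R L (n + 1)) :
    joinFirst R L n (splitFirst R L n w) = w := by
  refine LinearMap.congr_fun (PiTensorProduct.ext (φ₁ := joinFirst R L n ∘ₗ splitFirst R L n)
    (φ₂ := LinearMap.id) (MultilinearMap.ext fun u => ?_)) w
  change joinFirst R L n (splitFirst R L n (PiTensorProduct.tprod R u)) = PiTensorProduct.tprod R u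
  rw [splitFirst_tprod, joinFirst_tprod]
  congr 1
  exact Fin.cons_self_tail u

/-- The part of the differential of the bar complex which does not involve the module factor. -/
def barRest (n : ℕ) : UPow R L (n + 1) →ₗ[R] UPow R L n :=
  ∑ i : Fin n, (-1 : R) ^ ((i : ℕ) + 1) • faceMul R L n i + (-1 : R) ^ (n + 1) • faceLast R L n

/-- The differential of the bar resolution. -/
def barD (n : ℕ) : UniversalEnvelopingAlgebra R L ⊗[R] UPow R L (n + 1)
    →ₗ[UniversalEnvelopingAlgebra R L] UniversalEnvelopingAlgebra R L ⊗[R] UPow R L n :=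
  extend (splitFirst R L n + TensorProduct.mk R _ _ 1 ∘ₗ barRest R L n)

lemma barD_one_tmul (n : ℕ) (w : UPow R L (n + 1)) :
    barD R L n (1 ⊗ₜ[R] w) = splitFirst R L n w + 1 ⊗ₜ[R] barRest R L n w := by
  simp [barD]

lemma mulNeighbours_zero_cons {n : ℕ} (v : UniversalEnvelopingAlgebra R L)
    (u : Fin (n + 1) → UniversalEnvelopingAlgebra R L) :
    mulNeighbours R L 0 (Fin.cons v u : Fin (n + 2) → UniversalEnvelopingAlgebra R L) =
      Fin.cons (v * u 0) fun k => u k.succ := by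
  funext k
  refine Fin.cases ?_ (fun k => ?_) k
  · simp [mulNeighbours]
  · simp [mulNeighbours]

lemma mulNeighbours_succ_cons {n : ℕ} (i : Fin n) (v : UniversalEnvelopingAlgebra R L)
    (u : Fin (n + 1) → UniversalEnvelopingAlgebra R L) :
    mulNeighbours R L i.succ (Fin.cons v u : Fin (n + 2) → UniversalEnvelopingAlgebra R L) =
      Fin.cons v (mulNeighbours R L i u) := by
  funext k
  refine Fin.cases ?_ (fun k => ?_) k
  · simp [mulNeighbours]
  · simp [mulNeighbours]

/-- Regarding the module factor as a first tensor factor raises the number of every face by one,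
whence the sign; the face multiplying u_0 and u_1 becomes the first inner face. This is what makes
`barHtpy` a contracting homotopy. -/
lemma barRest_joinFirst (n : ℕ) (y : UniversalEnvelopingAlgebra R L ⊗[R] UPow R L (n + 1)) :
    barRest R L (n + 1) (joinFirst R L (n + 1) y) = - joinFirst R L n (barD R L n y) := by
  refine LinearMap.congr_fun (tmul_ext (F := barRest R L (n + 1) ∘ₗ joinFirst R L (n + 1))
    (F' := - (joinFirst R L n ∘ₗ (barD R L n).restrictScalars R)) fun v u => ?_) y
  have h1 : barD R L n (v ⊗ₜ[R] PiTensorProduct.tprod R u) =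
      (v * u 0) ⊗ₜ[R] PiTensorProduct.tprod R (fun k => u k.succ) +
        v ⊗ₜ[R] barRest R L n (PiTensorProduct.tprod R u) := by
    simp [barD, splitFirst_tprod, TensorProduct.smul_tmul']
  change barRest R L (n + 1) (joinFirst R L (n + 1) (v ⊗ₜ[R] PiTensorProduct.tprod R u)) =
    - joinFirst R L n (barD R L n (v ⊗ₜ[R] PiTensorProduct.tprod R u))
  have h2 : (fun k : Fin (n + 1) => (Fin.cons v u : Fin (n + 2) → UniversalEnvelopingAlgebra R L)
      k.castSucc) = Fin.cons v fun k : Fin n => u k.castSucc := by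
    funext k
    refine Fin.cases rfl (fun k => ?_) k
    rw [← Fin.succ_castSucc, Fin.cons_succ, Fin.cons_succ]
  have h3 : (Fin.cons v u : Fin (n + 2) → UniversalEnvelopingAlgebra R L) (Fin.last (n + 1)) =
      u (Fin.last n) := by
    rw [← Fin.succ_last, Fin.cons_succ]
  rw [h1, joinFirst_tprod, barRest, barRest]
  simp only [LinearMap.add_apply, LinearMap.sum_apply, LinearMap.smul_apply, faceMul_tprod,
    faceLast_tprod, map_add, TensorProduct.tmul_add, TensorProduct.tmul_sum, TensorProduct.tmul_smul,
    map_sum, map_smul, joinFirst_tprod, h2, h3]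
  rw [Fin.sum_univ_succ]
  simp only [mulNeighbours_zero_cons, mulNeighbours_succ_cons, Fin.val_zero, Fin.val_succ, pow_succ,
    pow_zero, mul_neg, mul_one, neg_smul, neg_neg, one_smul, Finset.sum_neg_distrib]
  abel

/-- The contracting homotopy `u_0 ⊗ ⋯ ⊗ u_n ↦ 1 ⊗ u_0 ⊗ ⋯ ⊗ u_n` of the bar resolution. -/
def barHtpy (n : ℕ) : UniversalEnvelopingAlgebra R L ⊗[R] UPow R L n →ₗ[R]
    UniversalEnvelopingAlgebra R L ⊗[R] UPow R L (n + 1) :=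
  TensorProduct.mk R _ _ 1 ∘ₗ joinFirst R L n

lemma barD_barHtpy (n : ℕ) (y : UniversalEnvelopingAlgebra R L ⊗[R] UPow R L (n + 1)) :
    barD R L (n + 1) (barHtpy R L (n + 1) y) = y - barHtpy R L n (barD R L n y) := by
  change barD R L (n + 1) (1 ⊗ₜ[R] joinFirst R L (n + 1) y) =
    y - 1 ⊗ₜ[R] joinFirst R L n (barD R L n y)
  rw [barD_one_tmul, splitFirst_joinFirst, barRest_joinFirst, TensorProduct.tmul_neg,
    sub_eq_add_neg]

lemma barRest_zero : barRest R L 0 = - faceLast R L 0 := by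
  have h : (-1 : R) ^ (0 + 1) = -1 := pow_one _
  refine LinearMap.ext fun w => ?_
  rw [barRest, Finset.univ_eq_empty, Finset.sum_empty, h, LinearMap.add_apply,
    LinearMap.smul_apply, neg_one_smul]
  exact zero_add _

lemma barD_barHtpy_zero (y : UniversalEnvelopingAlgebra R L ⊗[R] UPow R L 0) :
    barD R L 0 (barHtpy R L 0 y) = y - 1 ⊗ₜ[R] reduce R L _ y := by
  change barD R L 0 (1 ⊗ₜ[R] joinFirst R L 0 y) = _
  rw [barD_one_tmul, splitFirst_joinFirst, sub_eq_add_neg, ← TensorProduct.tmul_neg]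
  congr 2
  refine LinearMap.congr_fun (tmul_ext (F := barRest R L 0 ∘ₗ joinFirst R L 0)
    (F' := - (reduce R L (UPow R L 0))) fun v u => ?_) y
  rw [LinearMap.comp_apply, joinFirst_tprod, barRest_zero, LinearMap.neg_apply, LinearMap.neg_apply,
    faceLast_tprod, reduce_tmul]
  exact congrArg (fun w => -(counit R L v • PiTensorProduct.tprod R w)) (Subsingleton.elim _ _)

lemma reduce_barD_zero (y : UniversalEnvelopingAlgebra R L ⊗[R] UPow R L 1) :
    reduce R L _ (barD R L 0 y) = 0 := by
  refine LinearMap.congr_fun (tmul_ext (F := reduce R L _ ∘ₗ (barD R L 0).restrictScalars R)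
    (F' := 0) fun v u => ?_) y
  change reduce R L _ (barD R L 0 (v ⊗ₜ[R] PiTensorProduct.tprod R u)) = 0
  have h : splitFirst R L 0 (PiTensorProduct.tprod R u) =
      u 0 ⊗ₜ[R] PiTensorProduct.tprod R fun k : Fin 0 => u k.castSucc := by
    rw [splitFirst_tprod]
    exact congrArg (fun w => u 0 ⊗ₜ[R] PiTensorProduct.tprod R w) (Subsingleton.elim _ _)
  have h' : faceLast R L 0 (PiTensorProduct.tprod R u) =
      counit R L (u 0) • PiTensorProduct.tprod R fun k : Fin 0 => u k.castSucc :=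
    faceLast_tprod R L 0 u
  rw [barD, extend_tmul, reduce_smul, LinearMap.add_apply, map_add, LinearMap.comp_apply,
    TensorProduct.mk_apply, reduce_tmul, barRest_zero, LinearMap.neg_apply, h, h', reduce_tmul,
    map_one, one_smul, add_neg_cancel, smul_zero]

/-- No simplicial identities are used. With h the homotopy, dh = 1 - hd gives ddh = d - dhd = d - (1
- hd)d = hdd, which is zero by induction; in degree zero the remainder is 1 ⊗ ε(d z) = 0. This
suffices since the image of h generates over `U`. -/
lemma barD_barD (n : ℕ) (y : UniversalEnvelopingAlgebra R L ⊗[R] UPow R L (n + 2)) :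
    barD R L n (barD R L (n + 1) y) = 0 := by
  -- Every `1 ⊗ w` is in the image of the homotopy because `joinFirst` is onto, and these elements
  -- determine a U-linear map.
  have key : ∀ n, (∀ z, barD R L n (barD R L (n + 1) (barHtpy R L (n + 1) z)) = 0) →
      ∀ y, barD R L n (barD R L (n + 1) y) = 0 := fun n h =>
    LinearMap.congr_fun (hom_ext_tmul (F := barD R L n ∘ₗ barD R L (n + 1)) (F' := 0)
      fun w => by
        have := h (splitFirst R L (n + 1) w)
        rwa [barHtpy, LinearMap.comp_apply, joinFirst_splitFirst] at this)
  induction n with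
  | zero =>
    refine key 0 (fun z => ?_) y
    rw [barD_barHtpy, map_sub, barD_barHtpy_zero, reduce_barD_zero, TensorProduct.tmul_zero,
      sub_zero, sub_self]
  | succ n ih =>
    refine key (n + 1) (fun z => ?_) y
    rw [barD_barHtpy, map_sub, barD_barHtpy, ih, map_zero, sub_zero, sub_self]

lemma faceFirst_eq (n : ℕ) (w : UPow R L (n + 1)) :
    faceFirst R L n w = reduce R L _ (splitFirst R L n w) := by
  refine LinearMap.congr_fun (PiTensorProduct.ext (φ₁ := faceFirst R L n)
    (φ₂ := reduce R L _ ∘ₗ splitFirst R L n) (MultilinearMap.ext fun u => ?_)) w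
  change faceFirst R L n (PiTensorProduct.tprod R u) =
    reduce R L _ (splitFirst R L n (PiTensorProduct.tprod R u))
  rw [faceFirst_tprod, splitFirst_tprod, reduce_tmul]

lemma inhomD_apply (n : ℕ) (f : Module.Dual R (UPow R L n)) (w : UPow R L (n + 1)) :
    inhomD R L n f w = f (faceFirst R L n w + barRest R L n w) := by
  rw [inhomD, barRest, ← LinearMap.add_apply, ← add_assoc]
  rfl

/-- The differential was obtained by transport along ι. Since functionals have values in the trivial
module, the face u_0 u_1 ⊗ ⋯ is seen only through ε(u_0) ε(u_1), which is the first face of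
`inhomD`. -/
lemma homD_eq_pull (n : ℕ) : homD R L n = pull (barD R L n) := by
  refine LinearMap.ext fun F => Subtype.ext (TensorProduct.ext' fun u w => ?_)
  obtain ⟨f, rfl⟩ := (iota R L n).surjective F
  refine Eq.trans ?_ (equivariantDual_apply (iota R L n f) _).symm
  change (freeEquiv R L _ (inhomD R L n ((iota R L n).symm (iota R L n f)))).1 (u ⊗ₜ[R] w) =
    (freeEquiv R L _ f).1 (1 ⊗ₜ[R] reduce R L _ (barD R L n (u ⊗ₜ[R] w)))
  rw [LinearEquiv.symm_apply_apply, freeEquiv_apply_tmul, freeEquiv_apply_tmul, inhomD_apply,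
    map_one, one_mul, barD, extend_tmul, reduce_smul, map_smul, smul_eq_mul, faceFirst_eq]
  congr 2
  simp

lemma homD_homD (n : ℕ) : homD R L (n + 1) ∘ₗ homD R L n = 0 := by
  rw [homD_eq_pull, homD_eq_pull, ← pull_comp, ← pull_zero]
  congr 1
  exact LinearMap.ext fun y => barD_barD R L n y

lemma inhomD_inhomD (n : ℕ) : inhomD R L (n + 1) ∘ₗ inhomD R L n = 0 := by
  refine LinearMap.ext fun f => (iota R L (n + 2)).injective ?_
  have := LinearMap.congr_fun (homD_homD R L n) (iota R L n f)
  simpa [homD] using this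

end Bar

end LieCochains

/-! ### Signed sums over permutations -/

section Signed

variable {M N : Type*} [AddCommGroup N]

/-- The signed sum `∑ sgn(σ) f(x ∘ σ)` over all permutations of the entries of a tuple. -/
def signedSum {n : ℕ} (f : (Fin n → M) → N) (x : Fin n → M) : N :=
  ∑ σ : Equiv.Perm (Fin n), Equiv.Perm.sign σ • f (x ∘ σ)

lemma signedSum_congr {n : ℕ} {f g : (Fin n → M) → N} (h : ∀ x, f x = g x) (x : Fin n → M) :
    signedSum f x = signedSum g x := by
  rw [show f = g from funext h]

lemma signedSum_add {n : ℕ} (f g : (Fin n → M) → N) (x : Fin n → M) :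
    signedSum (fun y => f y + g y) x = signedSum f x + signedSum g x := by
  simp only [signedSum, smul_add, Finset.sum_add_distrib]

lemma signedSum_eq_zero {n : ℕ} {f : (Fin n → M) → N} (h : ∀ x, f x = 0) (x : Fin n → M) :
    signedSum f x = 0 :=
  Finset.sum_eq_zero fun σ _ => by rw [h, smul_zero]

lemma map_signedSum {P : Type*} [AddCommGroup P] {n : ℕ} (φ : N →+ P)
    (f : (Fin n → M) → N) (x : Fin n → M) :
    φ (signedSum f x) = signedSum (fun y => φ (f y)) x := by
  simp only [signedSum, map_sum, Units.smul_def, map_zsmul]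

lemma units_pow_smul (R : Type*) [CommRing R] [Module R N] (k : ℕ) (x : N) :
    (-1 : ℤˣ) ^ k • x = (-1 : R) ^ k • x := by
  rcases Nat.even_or_odd k with h' | h' <;> simp [h'.neg_one_pow]

lemma signedSum_comp_perm {n : ℕ} (f : (Fin n → M) → N) (x : Fin n → M) (c : Equiv.Perm (Fin n)) :
    signedSum (fun y => f (y ∘ c)) x = Equiv.Perm.sign c • signedSum f x := by
  rw [signedSum, signedSum, Finset.smul_sum]
  refine Fintype.sum_equiv (Equiv.mulRight c) _ _ fun σ => ?_
  rw [Equiv.coe_mulRight, Equiv.Perm.sign_mul, smul_smul, mul_comm (Equiv.Perm.sign c), mul_assoc,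
    Int.units_mul_self, mul_one]
  rfl

/-- A permutation of `Fin (n + 1)` is given by the image `k` of `0` and a permutation of the rest. -/
def permCons {n : ℕ} (q : Fin (n + 1) × Equiv.Perm (Fin n)) : Equiv.Perm (Fin (n + 1)) :=
  q.1.cycleRange.symm * Equiv.Perm.decomposeFin.symm (0, q.2)

lemma permCons_zero {n : ℕ} (q : Fin (n + 1) × Equiv.Perm (Fin n)) : permCons q 0 = q.1 := by
  simp [permCons]

lemma permCons_succ {n : ℕ} (q : Fin (n + 1) × Equiv.Perm (Fin n)) (j : Fin n) :
    permCons q j.succ = q.1.succAbove (q.2 j) := by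
  simp [permCons]

lemma sign_permCons {n : ℕ} (q : Fin (n + 1) × Equiv.Perm (Fin n)) :
    Equiv.Perm.sign (permCons q) = (-1) ^ (q.1 : ℕ) * Equiv.Perm.sign q.2 := by
  simp [permCons]

lemma permCons_bijective (n : ℕ) : Function.Bijective (permCons (n := n)) := by
  refine (Fintype.bijective_iff_injective_and_card _).mpr ⟨fun q q' h => ?_, ?_⟩
  · have h0 : q.1 = q'.1 := by rw [← permCons_zero q, ← permCons_zero q', h]
    refine Prod.ext h0 (Equiv.ext fun j => ?_)
    have := permCons_succ q j
    rw [h, permCons_succ, h0] at this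
    exact (Fin.succAbove_right_injective this).symm
  · simp [Fintype.card_perm, Nat.factorial_succ]

lemma signedSum_succ {n : ℕ} (f : (Fin (n + 1) → M) → N) (x : Fin (n + 1) → M) :
    signedSum f x = ∑ k : Fin (n + 1), (-1 : ℤˣ) ^ (k : ℕ) •
      signedSum (fun r => f (Fin.cons (x k) r)) (x ∘ k.succAbove) := by
  rw [signedSum, ← Fintype.sum_bijective _ (permCons_bijective n) _ _ fun _ => rfl,
    Fintype.sum_prod_type]
  refine Finset.sum_congr rfl fun k _ => ?_
  rw [signedSum, Finset.smul_sum]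
  refine Finset.sum_congr rfl fun τ _ => ?_
  rw [sign_permCons, smul_smul]
  congr 2
  funext j
  refine Fin.cases ?_ (fun j => ?_) j
  · simp [permCons_zero]
  · simp [permCons_succ]

/-- Expansion of a signed sum with respect to the entry in position `i`. -/
lemma signedSum_insertNth {n : ℕ} (i : Fin (n + 1)) (f : (Fin (n + 1) → M) → N)
    (x : Fin (n + 1) → M) :
    signedSum f x = (-1 : ℤˣ) ^ (i : ℕ) • ∑ k : Fin (n + 1), (-1 : ℤˣ) ^ (k : ℕ) •
      signedSum (fun r => f (i.insertNth (α := fun _ => M) (x k) r)) (x ∘ k.succAbove) := by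
  -- The cycle relating position `i` to the front has sign (-1)^i and reduces the claim to
  -- `signedSum_succ`.
  have h := signedSum_comp_perm f x i.cycleRange
  rw [Fin.sign_cycleRange] at h
  have h2 : signedSum f x = (-1 : ℤˣ) ^ (i : ℕ) • signedSum (fun y => f (y ∘ i.cycleRange)) x := by
    rw [h, smul_smul, ← mul_pow]
    simp
  rw [h2, signedSum_succ]
  simp only [Fin.cons_comp_cycleRange]

/-- Expansion of a signed sum with respect to the position of the first entry. -/
lemma signedSum_cons {n : ℕ} (f : (Fin (n + 1) → M) → N) (y : M) (r : Fin n → M) :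
    signedSum f (Fin.cons y r) = ∑ i : Fin (n + 1), (-1 : ℤˣ) ^ (i : ℕ) •
      signedSum (fun s => f (i.insertNth (α := fun _ => M) y s)) r := by
  -- Inverses are needed because the index is now the position in which the first entry lands, not
  -- the entry found in the first position.
  have hb : Function.Bijective fun q : Fin (n + 1) × Equiv.Perm (Fin n) =>
      (permCons (q.1, q.2⁻¹))⁻¹ :=
    ((Equiv.inv _).bijective.comp (permCons_bijective n)).comp
      ((Equiv.refl _).prodCongr (Equiv.inv _)).bijective
  rw [signedSum, ← Fintype.sum_bijective _ hb _ _ fun _ => rfl, Fintype.sum_prod_type]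
  refine Finset.sum_congr rfl fun i _ => ?_
  rw [signedSum, Finset.smul_sum]
  refine Finset.sum_congr rfl fun τ _ => ?_
  rw [Equiv.Perm.sign_inv, sign_permCons, Equiv.Perm.sign_inv, smul_smul]
  congr 2
  have key : i.insertNth (α := fun _ => M) y (r ∘ τ) ∘ permCons (i, τ⁻¹) = Fin.cons y r := by
    funext j
    refine Fin.cases ?_ (fun j => ?_) j
    · simp [permCons_zero]
    · simp [permCons_succ]
  rw [← key]
  funext j
  simp

/-- Expansion of a signed sum with respect to the entries in two adjacent positions. -/
lemma signedSum_insertNth_insertNth {n : ℕ} (i : Fin (n + 1)) (f : (Fin (n + 2) → M) → N)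
    (x : Fin (n + 2) → M) :
    signedSum f x = ∑ k : Fin (n + 2), ∑ l : Fin (n + 1), (-1 : ℤˣ) ^ ((k : ℕ) + (l : ℕ)) •
      signedSum (fun r => f (i.castSucc.insertNth (α := fun _ => M) (x k)
        (i.insertNth (α := fun _ => M) (x (k.succAbove l)) r)))
        (x ∘ k.succAbove ∘ l.succAbove) := by
  rw [signedSum_insertNth i.castSucc, Finset.smul_sum]
  refine Finset.sum_congr rfl fun k _ => ?_
  rw [signedSum_insertNth i, Finset.smul_sum, Finset.smul_sum, Finset.smul_sum]
  refine Finset.sum_congr rfl fun l _ => ?_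
  rw [pow_add, mul_smul, smul_comm ((-1 : ℤˣ) ^ (k : ℕ)), Fin.val_castSucc, smul_smul, ← mul_pow,
    mul_neg_one, neg_neg, one_pow, one_smul]
  rfl

/-- The left side runs over ordered pairs of distinct indices (k, `k.succAbove l`). On the right, `k
≤ l` stands for the unordered pair `k.castSucc < l.succ`, with its two orders added. -/
lemma sum_sum_succAbove {n : ℕ} (a : Fin (n + 2) → Fin (n + 1) → N) :
    ∑ k, ∑ l, a k l = ∑ k : Fin (n + 1), ∑ l : Fin (n + 1),
      if k ≤ l then a l.succ k + a k.castSucc l else 0 := by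
  have h : ∀ k l, a k l = (if l.castSucc < k then a k l else 0) +
      if k ≤ l.castSucc then a k l else 0 := by
    intro k l
    rcases lt_or_ge l.castSucc k with h | h
    · rw [if_pos h, if_neg (not_le.mpr h), add_zero]
    · rw [if_neg (not_lt.mpr h), if_pos h, zero_add]
  simp_rw [fun k l => show (if k ≤ l then a l.succ k + a k.castSucc l else 0) =
    (if k ≤ l then a l.succ k else 0) + if k ≤ l then a k.castSucc l else 0 by split_ifs <;> simp]
  simp_rw [Finset.sum_add_distrib]
  rw [Finset.sum_congr rfl fun k _ => Finset.sum_congr rfl fun l _ => h k l]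
  simp_rw [Finset.sum_add_distrib]
  congr 1
  · rw [Finset.sum_comm]
    refine Finset.sum_congr rfl fun k _ => ?_
    rw [Fin.sum_univ_succ]
    simp [Fin.castSucc_lt_succ_iff]
  · rw [Fin.sum_univ_castSucc]
    simp [(Fin.castSucc_lt_last _).not_ge]

lemma sum_sum_castSucc_lt {n : ℕ} (a : Fin (n + 2) → Fin (n + 1) → N) :
    (∑ l, ∑ k, if k.castSucc < l then a l k else 0) = ∑ k : Fin (n + 1), ∑ l : Fin (n + 1),
      if k ≤ l then a l.succ k else 0 := by
  rw [Finset.sum_comm]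
  refine Finset.sum_congr rfl fun k _ => ?_
  rw [Fin.sum_univ_succ]
  simp [Fin.castSucc_lt_succ_iff]

lemma castSucc_succAbove_succAbove {n : ℕ} {k l : Fin (n + 1)} (h : k ≤ l) (j : Fin n) :
    k.castSucc.succAbove (l.succAbove j) = l.succ.succAbove (k.succAbove j) := by
  have h' : (k : ℕ) ≤ l := h
  ext
  simp only [Fin.succAbove, Fin.lt_def, Fin.val_castSucc, Fin.val_succ]
  split_ifs <;> simp only [Fin.val_castSucc, Fin.val_succ] at * <;> omega

end Signed

/-! ### Antisymmetrisation and the bar differential -/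

namespace LieCochains

variable (R : Type u) [CommRing R] {L : Type u} [LieRing L] [LieAlgebra R L]

section Antisymm

/-- The tensor `x_1 ⊗ ⋯ ⊗ x_n` of elements of the Lie algebra. -/
def lieTensor (n : ℕ) (x : Fin n → L) : UPow R L n :=
  PiTensorProduct.tprod R fun i => UniversalEnvelopingAlgebra.ι R (x i)

lemma antisymm_ιMulti (n : ℕ) (x : Fin n → L) :
    antisymm R L n (exteriorPower.ιMulti R n x) = signedSum (lieTensor R n) x := by
  rw [antisymm, exteriorPower.alternatingMapLinearEquiv_apply_ιMulti,
    MultilinearMap.alternatization_apply]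
  rfl

lemma counit_ι (x : L) : counit R L (UniversalEnvelopingAlgebra.ι R x) = 0 := by
  simp [counit]

attribute [local instance] LieRing.ofAssociativeRing in
lemma ι_mul_ι (x y : L) : UniversalEnvelopingAlgebra.ι R x * UniversalEnvelopingAlgebra.ι R y =
    UniversalEnvelopingAlgebra.ι R y * UniversalEnvelopingAlgebra.ι R x +
      UniversalEnvelopingAlgebra.ι R ⁅x, y⁆ := by
  rw [(UniversalEnvelopingAlgebra.ι R : L →ₗ⁅R⁆ UniversalEnvelopingAlgebra R L).map_lie x y,
    LieRing.of_associative_ring_bracket]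
  abel

/-- Grouping the permutations by the entry in the first position gives precisely the action part of
the Koszul differential. -/
lemma splitFirst_antisymm (n : ℕ) (x : Fin (n + 1) → L) :
    splitFirst R L n (antisymm R L (n + 1) (exteriorPower.ιMulti R (n + 1) x)) =
      ∑ k : Fin (n + 1), (-1 : R) ^ (k : ℕ) • (UniversalEnvelopingAlgebra.ι R (x k) ⊗ₜ[R]
        antisymm R L n (exteriorPower.ιMulti R n (x ∘ k.succAbove))) := by
  rw [antisymm_ιMulti, signedSum_succ, map_sum]
  refine Finset.sum_congr rfl fun k _ => ?_
  rw [antisymm_ιMulti, units_pow_smul R, map_smul]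
  congr 1
  have h1 := map_signedSum (splitFirst R L n).toAddMonoidHom
    (fun r => lieTensor R (n + 1) (Fin.cons (x k) r)) (x ∘ k.succAbove)
  have h2 := map_signedSum (TensorProduct.mk R (UniversalEnvelopingAlgebra R L) (UPow R L n)
    (UniversalEnvelopingAlgebra.ι R (x k))).toAddMonoidHom (lieTensor R n) (x ∘ k.succAbove)
  refine h1.trans (Eq.trans ?_ h2.symm)
  refine signedSum_congr (fun r => ?_) _
  change splitFirst R L n (PiTensorProduct.tprod R _) = _ ⊗ₜ[R] PiTensorProduct.tprod R _
  rw [splitFirst_tprod]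
  rfl

lemma faceLast_antisymm (n : ℕ) (x : Fin (n + 1) → L) :
    faceLast R L n (antisymm R L (n + 1) (exteriorPower.ιMulti R (n + 1) x)) = 0 := by
  rw [antisymm_ιMulti]
  refine (map_signedSum (faceLast R L n).toAddMonoidHom _ _).trans ?_
  refine signedSum_eq_zero (fun y => ?_) _
  change faceLast R L n (lieTensor R (n + 1) y) = 0
  rw [lieTensor, faceLast_tprod, counit_ι, zero_smul]

variable {R} in
lemma mulNeighbours_insertNth {n : ℕ} (i : Fin (n + 1)) (a b : UniversalEnvelopingAlgebra R L)
    (u : Fin n → UniversalEnvelopingAlgebra R L) :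
    mulNeighbours R L i (i.castSucc.insertNth (α := fun _ => UniversalEnvelopingAlgebra R L) a
      (i.insertNth (α := fun _ => UniversalEnvelopingAlgebra R L) b u)) =
      i.insertNth (α := fun _ => UniversalEnvelopingAlgebra R L) (a * b) u := by
  have h : i.succ = i.castSucc.succAbove i := by simp
  funext j
  refine Fin.succAboveCases i ?_ (fun j => ?_) j
  · rw [mulNeighbours, if_neg (lt_irrefl _), if_pos rfl, h, Fin.insertNth_apply_same,
      Fin.insertNth_apply_succAbove, Fin.insertNth_apply_same, Fin.insertNth_apply_same]
  · rw [mulNeighbours, Fin.insertNth_apply_succAbove]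
    rcases lt_or_ge j.castSucc i with hj | hj
    · rw [if_pos (by rwa [Fin.succAbove_of_castSucc_lt _ _ hj])]
      have : (i.succAbove j).castSucc = i.castSucc.succAbove (i.succAbove j) := by
        rw [Fin.succAbove_of_castSucc_lt _ _ hj, Fin.succAbove_of_castSucc_lt]
        exact hj
      rw [this, Fin.insertNth_apply_succAbove, Fin.insertNth_apply_succAbove]
    · have hlt : i < i.succAbove j := by
        rw [Fin.succAbove_of_le_castSucc _ _ hj]
        exact lt_of_le_of_lt hj j.castSucc_lt_succ
      rw [if_neg hlt.not_gt, if_neg hlt.ne']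
      have : (i.succAbove j).succ = i.castSucc.succAbove (i.succAbove j) :=
        (Fin.succAbove_of_le_castSucc i.castSucc (i.succAbove j) hlt.le).symm
      rw [this, Fin.insertNth_apply_succAbove, Fin.insertNth_apply_succAbove]

variable {R} in
lemma tprod_insertNth_add {n : ℕ} (i : Fin (n + 1)) (a b : UniversalEnvelopingAlgebra R L)
    (u : Fin n → UniversalEnvelopingAlgebra R L) :
    (PiTensorProduct.tprod R (i.insertNth (α := fun _ => UniversalEnvelopingAlgebra R L) (a + b) u) :
      UPow R L (n + 1)) =
    PiTensorProduct.tprod R (i.insertNth (α := fun _ => UniversalEnvelopingAlgebra R L) a u) +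
    PiTensorProduct.tprod R (i.insertNth (α := fun _ => UniversalEnvelopingAlgebra R L) b u) := by
  have := (PiTensorProduct.tprod R (s := fun _ : Fin (n + 1) =>
    UniversalEnvelopingAlgebra R L)).map_update_add (i.insertNth
      (α := fun _ => UniversalEnvelopingAlgebra R L) 0 u) i a b
  simpa only [Fin.update_insertNth] using this

lemma map_insertNth_ι {n : ℕ} (i : Fin (n + 1)) (y : L) (r : Fin n → L) :
    (fun j => UniversalEnvelopingAlgebra.ι R (i.insertNth (α := fun _ => L) y r j)) =
      i.insertNth (α := fun _ => UniversalEnvelopingAlgebra R L) (UniversalEnvelopingAlgebra.ι R y)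
        fun j => UniversalEnvelopingAlgebra.ι R (r j) := by
  funext j
  refine Fin.succAboveCases i ?_ (fun j => ?_) j <;> simp

/-- Inserting the product of two elements in position `i` of a signed sum. -/
def insertProd {n : ℕ} (i : Fin (n + 1)) (u : UniversalEnvelopingAlgebra R L) (r : Fin n → L) :
    UPow R L (n + 1) :=
  signedSum (fun s => PiTensorProduct.tprod R
    (i.insertNth (α := fun _ => UniversalEnvelopingAlgebra R L) u
      fun j => UniversalEnvelopingAlgebra.ι R (s j))) r

lemma insertProd_add {n : ℕ} (i : Fin (n + 1)) (u v : UniversalEnvelopingAlgebra R L)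
    (r : Fin n → L) : insertProd R i (u + v) r = insertProd R i u r + insertProd R i v r := by
  simp only [insertProd, tprod_insertNth_add, signedSum_add]

/-- The permutations are grouped by the ordered pair of entries in the two positions being
multiplied; `l` counts the second entry after removal of the first. -/
lemma faceMul_antisymm (n : ℕ) (i : Fin (n + 1)) (x : Fin (n + 2) → L) :
    faceMul R L (n + 1) i (antisymm R L (n + 2) (exteriorPower.ιMulti R (n + 2) x)) =
      ∑ k : Fin (n + 2), ∑ l : Fin (n + 1), (-1 : R) ^ ((k : ℕ) + (l : ℕ)) •
        insertProd R i (UniversalEnvelopingAlgebra.ι R (x k) *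
          UniversalEnvelopingAlgebra.ι R (x (k.succAbove l)))
          (x ∘ k.succAbove ∘ l.succAbove) := by
  rw [antisymm_ιMulti]
  refine (map_signedSum (faceMul R L (n + 1) i).toAddMonoidHom _ _).trans ?_
  have h : ∀ y, (faceMul R L (n + 1) i).toAddMonoidHom (lieTensor R (n + 2) y) =
      PiTensorProduct.tprod R (mulNeighbours R L i fun j => UniversalEnvelopingAlgebra.ι R (y j)) :=
    fun y => faceMul_tprod R L (n + 1) i _
  rw [signedSum_congr h, signedSum_insertNth_insertNth i]
  refine Finset.sum_congr rfl fun k _ => Finset.sum_congr rfl fun l _ => ?_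
  rw [insertProd, units_pow_smul R]
  congr 1
  refine signedSum_congr (fun r => ?_) _
  rw [map_insertNth_ι, map_insertNth_ι, mulNeighbours_insertNth]

lemma antisymm_cons (n : ℕ) (y : L) (r : Fin n → L) :
    antisymm R L (n + 1) (exteriorPower.ιMulti R (n + 1) (Fin.cons y r)) =
      ∑ i : Fin (n + 1), (-1 : R) ^ (i : ℕ) •
        insertProd R i (UniversalEnvelopingAlgebra.ι R y) r := by
  rw [antisymm_ιMulti, signedSum_cons]
  refine Finset.sum_congr rfl fun i _ => ?_
  rw [units_pow_smul R, insertProd]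
  congr 1
  refine signedSum_congr (fun r => ?_) _
  rw [lieTensor, map_insertNth_ι]

/-- For each pair of entries the two orders of their product occur with opposite signs, leaving
their bracket in position `i`. Summing over `i` with signs antisymmetrises the bracket with the
other entries. The last face vanishes because ε does on the Lie algebra. -/
lemma barRest_antisymm (n : ℕ) (x : Fin (n + 1) → L) :
    barRest R L n (antisymm R L (n + 1) (exteriorPower.ιMulti R (n + 1) x)) =
      antisymm R L n (bracketSum R n x) := by
  rw [barRest, LinearMap.add_apply, LinearMap.smul_apply, faceLast_antisymm, smul_zero, add_zero,
    LinearMap.sum_apply]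
  cases n with
  | zero => simp [bracketSum]
  | succ n =>
    rw [bracketSum, sum_sum_castSucc_lt fun l k => (-1 : R) ^ ((k : ℕ) + (l : ℕ)) •
      exteriorPower.ιMulti R (n + 1) (Fin.cons ⁅x k.castSucc, x l⁆ fun i =>
        x (l.succAbove (k.succAbove i)))]
    simp only [LinearMap.smul_apply, faceMul_antisymm, map_sum, apply_ite (antisymm R L (n + 1)),
      map_zero, map_smul, antisymm_cons]
    simp only [fun i : Fin (n + 1) => sum_sum_succAbove (n := n) fun k l =>
      (-1 : R) ^ ((k : ℕ) + (l : ℕ)) • insertProd R i (UniversalEnvelopingAlgebra.ι R (x k) *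
        UniversalEnvelopingAlgebra.ι R (x (k.succAbove l))) (x ∘ k.succAbove ∘ l.succAbove),
      Finset.smul_sum]
    rw [Finset.sum_comm]
    refine Finset.sum_congr rfl fun k _ => ?_
    rw [Finset.sum_comm]
    refine Finset.sum_congr rfl fun l _ => ?_
    by_cases hkl : k ≤ l
    · simp only [if_pos hkl]
      refine Finset.sum_congr rfl fun i _ => ?_
      have e1 : l.succ.succAbove k = k.castSucc :=
        Fin.succAbove_of_castSucc_lt _ _ (Fin.castSucc_lt_succ_iff.mpr hkl)
      have e2 : k.castSucc.succAbove l = l.succ :=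
        Fin.succAbove_of_le_castSucc _ _ (Fin.castSucc_le_castSucc_iff.mpr hkl)
      have e3 : x ∘ k.castSucc.succAbove ∘ l.succAbove = x ∘ l.succ.succAbove ∘ k.succAbove :=
        funext fun j => congrArg x (castSucc_succAbove_succAbove hkl j)
      have e4 : UniversalEnvelopingAlgebra.ι R (x k.castSucc) *
          UniversalEnvelopingAlgebra.ι R (x l.succ) =
          UniversalEnvelopingAlgebra.ι R (x l.succ) *
            UniversalEnvelopingAlgebra.ι R (x k.castSucc) +
          UniversalEnvelopingAlgebra.ι R ⁅x k.castSucc, x l.succ⁆ := ι_mul_ι R _ _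
      rw [e1, e2, e3, e4, insertProd_add]
      simp only [Fin.val_castSucc, Fin.val_succ]
      change _ = _ • _ • insertProd R i _ (x ∘ l.succ.succAbove ∘ k.succAbove)
      module
    · simp [if_neg hkl]

end Antisymm

end LieCochains

/-! ### The Koszul complex inside the bar complex -/

namespace LieCochains

variable (R : Type u) [CommRing R] {L : Type u} [LieRing L] [LieAlgebra R L]

section KoszulToBar

variable {m : ℕ} (b : Module.Basis (Fin m) R L)

/-- The differential of the Koszul complex as a `U(L)`-linear map. -/
def koszulLin (n : ℕ) : UniversalEnvelopingAlgebra R L ⊗[R] ⋀[R]^(n + 1) L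
    →ₗ[UniversalEnvelopingAlgebra R L] UniversalEnvelopingAlgebra R L ⊗[R] ⋀[R]^n L where
  __ := koszulD R b n
  map_smul' := koszulD_smul R b n

lemma koszulLin_apply (n : ℕ) (x) : koszulLin R b n x = koszulD R b n x := rfl

lemma exteriorPower_basis_eq (n : ℕ) (s : Set.powersetCard (Fin m) n) :
    b.exteriorPower n s = exteriorPower.ιMulti R n (basisTuple R b s) := by
  rw [exteriorPower.basis_apply]
  rfl

lemma bracketMap_basis (n : ℕ) (s : Set.powersetCard (Fin m) (n + 1)) :
    bracketMap R b n (exteriorPower.ιMulti R (n + 1) (basisTuple R b s)) =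
      bracketSum R n (basisTuple R b s) := by
  rw [← exteriorPower_basis_eq, bracketMap, Module.Basis.constr_basis]

lemma actionMap_basis (n : ℕ) (s : Set.powersetCard (Fin m) (n + 1)) :
    actionMap R b n (exteriorPower.ιMulti R (n + 1) (basisTuple R b s)) =
      ∑ j : Fin (n + 1), (-1 : R) ^ (j : ℕ) •
        (UniversalEnvelopingAlgebra.ι R (basisTuple R b s j) ⊗ₜ[R]
          exteriorPower.ιMulti R n fun i => basisTuple R b s (j.succAbove i)) := by
  rw [← exteriorPower_basis_eq, actionMap, Module.Basis.constr_basis]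

variable (L) in
/-- The map `id ⊗ as_n` from the Koszul complex to the bar complex. -/
def koszulToBar (n : ℕ) : UniversalEnvelopingAlgebra R L ⊗[R] ⋀[R]^n L
    →ₗ[UniversalEnvelopingAlgebra R L] UniversalEnvelopingAlgebra R L ⊗[R] UPow R L n :=
  extend (TensorProduct.mk R _ _ 1 ∘ₗ antisymm R L n)

lemma koszulToBar_tmul (n : ℕ) (u : UniversalEnvelopingAlgebra R L) (x : ⋀[R]^n L) :
    koszulToBar R L n (u ⊗ₜ[R] x) = u ⊗ₜ[R] antisymm R L n x := by
  simp [koszulToBar, TensorProduct.smul_tmul']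

/-- By U-linearity it suffices to test `1 ⊗ w` for basis wedges `w`, where the Koszul differential
is given explicitly. Its action part matches `splitFirst_antisymm` and its bracket part
`barRest_antisymm`. -/
lemma koszulToBar_koszulLin (n : ℕ) (y : UniversalEnvelopingAlgebra R L ⊗[R] ⋀[R]^(n + 1) L) :
    koszulToBar R L n (koszulLin R b n y) = barD R L n (koszulToBar R L (n + 1) y) := by
  refine LinearMap.congr_fun (hom_ext_tmul (F := koszulToBar R L n ∘ₗ koszulLin R b n)
    (F' := barD R L n ∘ₗ koszulToBar R L (n + 1)) fun x => ?_) y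
  refine LinearMap.congr_fun (f := (koszulToBar R L n).restrictScalars R ∘ₗ koszulD R b n ∘ₗ
    TensorProduct.mk R _ _ 1) (g := (barD R L n).restrictScalars R ∘ₗ
      (koszulToBar R L (n + 1)).restrictScalars R ∘ₗ TensorProduct.mk R _ _ 1)
      ((b.exteriorPower (n + 1)).ext fun s => ?_) x
  rw [exteriorPower_basis_eq]
  change koszulToBar R L n (koszulD R b n (1 ⊗ₜ[R] _)) =
    barD R L n (koszulToBar R L (n + 1) (1 ⊗ₜ[R] _))
  rw [koszulD_tmul, one_smul, bracketMap_basis, actionMap_basis, koszulToBar_tmul, barD_one_tmul,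
    splitFirst_antisymm, barRest_antisymm, map_add, koszulToBar_tmul, add_comm]
  congr 1
  rw [map_sum]
  refine Finset.sum_congr rfl fun j _ => ?_
  rw [← koszulToBar_tmul]
  exact ((koszulToBar R L n).restrictScalars R).map_smul _ _

lemma nu_eq_pull (n : ℕ) : nu R L n = pull (koszulToBar R L n) := by
  refine LinearMap.ext fun F => Subtype.ext (TensorProduct.ext' fun u x => ?_)
  rw [pull_apply, koszulToBar_tmul]
  rfl

lemma koszulHomD_eq_pull (n : ℕ) : koszulHomD R b n = pull (koszulLin R b n) := rfl

lemma nu_comm (n : ℕ) : nu R L (n + 1) ∘ₗ homD R L n = koszulHomD R b n ∘ₗ nu R L n := by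
  rw [nu_eq_pull, nu_eq_pull, homD_eq_pull, koszulHomD_eq_pull, ← pull_comp, ← pull_comp]
  congr 1
  exact LinearMap.ext fun y => (koszulToBar_koszulLin R b n y).symm

/-- The action part of the differential disappears because the module `R` is trivial, that is,
ε(e_i) = 0. -/
lemma kappa_comm (n : ℕ) : (kappa R L (n + 1)).toLinearMap ∘ₗ koszulHomD R b n =
    ceD R b n ∘ₗ (kappa R L n).toLinearMap := by
  refine LinearMap.ext fun F => ((b.exteriorPower (n + 1)).ext fun s => ?_)
  rw [exteriorPower_basis_eq]
  change F.1 (koszulD R b n (1 ⊗ₜ[R] _)) = F.1 (1 ⊗ₜ[R] bracketMap R b n _)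
  rw [koszulD_tmul, one_smul, map_add, actionMap_basis, map_sum, Finset.sum_eq_zero, add_zero]
  intro j _
  rw [map_smul, equivariantDual_apply, reduce_tmul, counit_ι, zero_smul, TensorProduct.tmul_zero,
    map_zero, smul_zero]

lemma iota_comm (n : ℕ) : (iota R L (n + 1)).toLinearMap ∘ₗ inhomD R L n =
    homD R L n ∘ₗ (iota R L n).toLinearMap := by
  refine LinearMap.ext fun f => ?_
  change _ = iota R L (n + 1) (inhomD R L n ((iota R L n).symm (iota R L n f)))
  rw [LinearEquiv.symm_apply_apply]
  rfl

section Injective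

variable {R b} (lam : UniversalEnvelopingAlgebra R L →ₗ[R] L)
  (hlam : ∀ x, lam (UniversalEnvelopingAlgebra.ι R x) = x)
include hlam

/-- A linear retraction `lam` of `L → U(L)` brings the antisymmetrised tensors back to tensors over
`L`, where the pairing with dual basis vectors is available. -/
lemma map_antisymm (n : ℕ) (x : ⋀[R]^n L) :
    PiTensorProduct.map (fun _ => lam) (antisymm R L n x) = exteriorPower.toTensorPower R L n x := by
  refine LinearMap.congr_fun (f := PiTensorProduct.map (fun _ => lam) ∘ₗ antisymm R L n)
    (g := exteriorPower.toTensorPower R L n) ?_ x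
  refine exteriorPower.linearMap_ext (AlternatingMap.ext fun v => ?_)
  change PiTensorProduct.map (fun _ => lam) (antisymm R L n (exteriorPower.ιMulti R n v)) =
    exteriorPower.toTensorPower R L n (exteriorPower.ιMulti R n v)
  rw [antisymm_ιMulti, exteriorPower.toTensorPower_apply_ιMulti]
  refine (map_signedSum (PiTensorProduct.map fun _ : Fin n => lam).toAddMonoidHom _ _).trans ?_
  refine Finset.sum_congr rfl fun σ _ => congrArg _ ?_
  change PiTensorProduct.map (fun _ => lam) (PiTensorProduct.tprod R _) = _
  rw [PiTensorProduct.map_tprod]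
  simp only [hlam]
  rfl

-- Pairing an antisymmetrised tensor with the dual basis vectors in increasing order gives exactly
-- one coordinate of the wedge. Using only these increasing tuples, n! never has to be inverted.
variable (b) in
include b in
lemma exists_leftInverse_antisymm (n : ℕ) :
    ∃ r : UPow R L n →ₗ[R] ⋀[R]^n L, r ∘ₗ antisymm R L n = LinearMap.id := by
  let c : Set.powersetCard (Fin m) n → UPow R L n →ₗ[R] R := fun s =>
    TensorPower.multilinearMapToDual R L n (b.coord ∘ Set.powersetCard.ofFinEmbEquiv.symm s) ∘ₗ
      PiTensorProduct.map fun _ => lam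
  refine ⟨∑ s, (c s).smulRight (b.exteriorPower n s), LinearMap.ext fun x => ?_⟩
  have hc : ∀ s, c s (antisymm R L n x) = (b.exteriorPower n).repr x s := by
    intro s
    rw [exteriorPower.basis_repr_apply]
    change TensorPower.multilinearMapToDual R L n _ (PiTensorProduct.map (fun _ => lam) _) = _
    rw [map_antisymm lam hlam, exteriorPower.ιMultiDual, exteriorPower.ιMulti_family,
      exteriorPower.pairingDual, exteriorPower.alternatingMapLinearEquiv_apply_ιMulti]
    rfl
  rw [LinearMap.comp_apply, LinearMap.sum_apply]
  simp only [LinearMap.smulRight_apply, hc]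
  exact (b.exteriorPower n).sum_repr x

include b in
lemma koszulToBar_injective (n : ℕ) : Function.Injective (koszulToBar R L n) := by
  obtain ⟨r, hr⟩ := exists_leftInverse_antisymm b lam hlam n
  refine Function.LeftInverse.injective (g := LinearMap.lTensor _ r) fun y => ?_
  refine LinearMap.congr_fun (f := LinearMap.lTensor _ r ∘ₗ (koszulToBar R L n).restrictScalars R)
    (g := LinearMap.id) (TensorProduct.ext' fun u x => ?_) y
  change LinearMap.lTensor _ r (koszulToBar R L n (u ⊗ₜ[R] x)) = u ⊗ₜ[R] x
  rw [koszulToBar_tmul, LinearMap.lTensor_tmul]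
  exact congrArg _ (LinearMap.congr_fun hr x)

/-- The vanishing is inherited from the bar complex through an injective chain map, which avoids a
direct computation with the Jacobi identity. -/
lemma koszulLin_koszulLin (n : ℕ) (y : UniversalEnvelopingAlgebra R L ⊗[R] ⋀[R]^(n + 2) L) :
    koszulLin R b n (koszulLin R b (n + 1) y) = 0 := by
  refine koszulToBar_injective (b := b) lam hlam n ?_
  rw [koszulToBar_koszulLin, koszulToBar_koszulLin, barD_barD, map_zero]

lemma koszulHomD_koszulHomD (n : ℕ) : koszulHomD R b (n + 1) ∘ₗ koszulHomD R b n = 0 := by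
  rw [koszulHomD_eq_pull, koszulHomD_eq_pull, ← pull_comp, ← pull_zero]
  congr 1
  exact LinearMap.ext fun y => koszulLin_koszulLin lam hlam n y

lemma ceD_ceD (n : ℕ) : ceD R b (n + 1) ∘ₗ ceD R b n = 0 := by
  refine LinearMap.ext fun ω => ?_
  obtain ⟨F, rfl⟩ := (kappa R L n).surjective ω
  have h1 := LinearMap.congr_fun (kappa_comm R b n) F
  have h2 := LinearMap.congr_fun (kappa_comm R b (n + 1)) (koszulHomD R b n F)
  have h3 := LinearMap.congr_fun (koszulHomD_koszulHomD (b := b) lam hlam n) F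
  change ceD R b (n + 1) ((ceD R b n ∘ₗ (kappa R L n).toLinearMap) F) = 0
  rw [← h1]
  refine h2.symm.trans ?_
  change kappa R L (n + 2) ((koszulHomD R b (n + 1) ∘ₗ koszulHomD R b n) F) = 0
  rw [h3, LinearMap.zero_apply, map_zero]

end Injective

end KoszulToBar

end LieCochains

/-! ### Exactness of the Koszul complex -/

namespace FormalGroupLaw

variable {R : Type u} [CommRing R] {m : ℕ} (G : FormalGroupLaw R m)

section Koszul

/-- The module `V_n(𝔤) = U(𝔤) ⊗ ⋀^n 𝔤`. -/
abbrev KoszulModule (n : ℕ) : Type u := G.U ⊗[R] ⋀[R]^n G.LieAlg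

/-- The wedge product `e_{x_1} ∧ ⋯ ∧ e_{x_n}`. -/
def wedge {n : ℕ} (x : Fin n → Fin m) : ⋀[R]^n G.LieAlg :=
  exteriorPower.ιMulti R n fun k => G.lieBasis (x k)

/-- The element `e^a ⊗ e_{x_1} ∧ ⋯ ∧ e_{x_n}` of the Koszul complex. -/
def koszulElt {n : ℕ} (a : Fin m →₀ ℕ) (x : Fin n → Fin m) : G.KoszulModule n :=
  G.pbwMonomial a ⊗ₜ[R] G.wedge x

lemma wedge_eq_basis {n : ℕ} (s : Fin n ↪o Fin m) :
    G.wedge s = G.lieBasis.exteriorPower n (Set.powersetCard.ofFinEmbEquiv s) := by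
  rw [LieCochains.exteriorPower_basis_eq]
  change _ = exteriorPower.ιMulti R n fun k => G.lieBasis (Set.powersetCard.ofFinEmbEquiv.symm _ k)
  rw [Equiv.symm_apply_apply]
  rfl

lemma koszulD_elt {n : ℕ} (a : Fin m →₀ ℕ) (x : Fin (n + 1) → Fin m) (hx : StrictMono x) :
    LieCochains.koszulLin R G.lieBasis n (G.koszulElt a x) =
      G.pbwMonomial a ⊗ₜ[R] LieCochains.bracketSum R n (fun k => G.lieBasis (x k)) +
        ∑ j : Fin (n + 1), (-1 : R) ^ (j : ℕ) •
          ((G.pbwMonomial a * G.gen (x j)) ⊗ₜ[R] G.wedge (x ∘ j.succAbove)) := by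
  have hs : (fun k => G.lieBasis (x k)) = LieCochains.basisTuple R G.lieBasis
      (Set.powersetCard.ofFinEmbEquiv (OrderEmbedding.ofStrictMono x hx)) := by
    funext k
    rw [LieCochains.basisTuple, Equiv.symm_apply_apply]
    rfl
  rw [koszulElt, wedge, LieCochains.koszulLin_apply, LieCochains.koszulD_tmul, smul_add,
    TensorProduct.smul_tmul', smul_eq_mul, mul_one, hs, LieCochains.bracketMap_basis,
    LieCochains.actionMap_basis, ← hs, Finset.smul_sum]
  congr 1
  refine Finset.sum_congr rfl fun j _ => ?_
  rw [smul_comm, TensorProduct.smul_tmul', smul_eq_mul]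
  rfl

/-- The span of the elements `e^a ⊗ w` with `|a| < k`. -/
def koszulFilt (n k : ℕ) : Submodule R (G.KoszulModule n) :=
  Submodule.span R {y | ∃ a : Fin m →₀ ℕ, a.degree < k ∧ ∃ w, y = G.pbwMonomial a ⊗ₜ[R] w}

lemma tmul_mem_koszulFilt {n k j : ℕ} (h : j < k) {u : G.U} (hu : u ∈ G.filt j)
    (w : ⋀[R]^n G.LieAlg) : u ⊗ₜ[R] w ∈ G.koszulFilt n k := by
  rw [filt_eq_span] at hu
  induction hu using Submodule.span_induction with
  | mem u hu =>
    obtain ⟨a, ha, rfl⟩ := hu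
    exact Submodule.subset_span ⟨a, lt_of_le_of_lt ha h, w, rfl⟩
  | zero => rw [TensorProduct.zero_tmul]; exact zero_mem _
  | add u v _ _ hu hv => rw [TensorProduct.add_tmul]; exact add_mem hu hv
  | smul r u _ hu => rw [← TensorProduct.smul_tmul']; exact Submodule.smul_mem _ r hu

lemma koszulFilt_zero (n : ℕ) : G.koszulFilt n 0 = ⊥ := by
  rw [koszulFilt, Submodule.span_eq_bot]
  rintro y ⟨a, ha, -⟩
  exact absurd ha (Nat.not_lt_zero _)

lemma koszulFilt_mono {n j k : ℕ} (h : j ≤ k) : G.koszulFilt n j ≤ G.koszulFilt n k :=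
  Submodule.span_mono fun _ ⟨a, ha, w⟩ => ⟨a, lt_of_lt_of_le ha h, w⟩

lemma pbwMonomial_zero : G.pbwMonomial 0 = 1 := by
  rw [pbwMonomial_eq_word, List.eq_nil_of_length_eq_zero ((length_sortedList 0).trans (map_zero _)),
    word_nil]

lemma exists_mem_koszulFilt {n : ℕ} (y : G.KoszulModule n) : ∃ k, y ∈ G.koszulFilt n k := by
  induction y using TensorProduct.induction_on with
  | zero => exact ⟨0, zero_mem _⟩
  | add x y hx hy =>
    obtain ⟨j, hj⟩ := hx
    obtain ⟨k, hk⟩ := hy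
    exact ⟨max j k, add_mem (G.koszulFilt_mono (le_max_left _ _) hj)
      (G.koszulFilt_mono (le_max_right _ _) hk)⟩
  | tmul u w =>
    obtain ⟨j, hj⟩ := G.exists_mem_filt u
    exact ⟨j + 1, G.tmul_mem_koszulFilt (Nat.lt_succ_self j) hj w⟩

/-- To prove a linear statement on `koszulFilt`, it suffices to consider the basis elements. -/
lemma koszulFilt_le {n k : ℕ} (p : Submodule R (G.KoszulModule n))
    (h : ∀ (a : Fin m →₀ ℕ) (x : Fin n → Fin m), a.degree < k → StrictMono x →
      G.koszulElt a x ∈ p) : G.koszulFilt n k ≤ p := by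
  refine Submodule.span_le.mpr ?_
  rintro y ⟨a, ha, w, rfl⟩
  rw [SetLike.mem_coe, ← (G.lieBasis.exteriorPower n).sum_repr w, TensorProduct.tmul_sum]
  refine Submodule.sum_mem _ fun s _ => ?_
  rw [TensorProduct.tmul_smul]
  refine Submodule.smul_mem _ _ ?_
  have := h a (Set.powersetCard.ofFinEmbEquiv.symm s) ha (OrderEmbedding.strictMono _)
  rwa [koszulElt, wedge_eq_basis, Equiv.apply_symm_apply] at this

variable [IsDomain R] [CharZero R]

/-- The basis of the Koszul complex formed by the elements `e^a ⊗ e_{s_1} ∧ ⋯ ∧ e_{s_n}`. -/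
def koszulBasis (n : ℕ) :
    Module.Basis ((Fin m →₀ ℕ) × (Fin n ↪o Fin m)) R (G.KoszulModule n) :=
  (G.pbwBasis.tensorProduct (G.lieBasis.exteriorPower n)).reindex
    ((Equiv.refl _).prodCongr Set.powersetCard.ofFinEmbEquiv.symm)

lemma koszulBasis_apply (n : ℕ) (q : (Fin m →₀ ℕ) × (Fin n ↪o Fin m)) :
    G.koszulBasis n q = G.koszulElt q.1 q.2 := by
  rw [koszulBasis, Module.Basis.reindex_apply, koszulElt, wedge_eq_basis, ← pbwBasis_apply]
  exact Module.Basis.tensorProduct_apply _ _ _ _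

/-- The leading part of the differential of the Koszul complex. -/
def koszulTop (n : ℕ) : G.KoszulModule (n + 1) →ₗ[R] G.KoszulModule n :=
  (G.koszulBasis (n + 1)).constr R fun q => ∑ j : Fin (n + 1), (-1 : R) ^ (j : ℕ) •
    G.koszulElt (q.1 + Finsupp.single (q.2 j) 1) (q.2 ∘ j.succAbove)

lemma koszulTop_elt {n : ℕ} (a : Fin m →₀ ℕ) (x : Fin (n + 1) → Fin m) (hx : StrictMono x) :
    G.koszulTop n (G.koszulElt a x) = ∑ j : Fin (n + 1), (-1 : R) ^ (j : ℕ) •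
      G.koszulElt (a + Finsupp.single (x j) 1) (x ∘ j.succAbove) := by
  have := (G.koszulBasis (n + 1)).constr_basis R (fun q => ∑ j : Fin (n + 1), (-1 : R) ^ (j : ℕ) •
    G.koszulElt (q.1 + Finsupp.single (q.2 j) 1) (q.2 ∘ j.succAbove))
    (a, OrderEmbedding.ofStrictMono x hx)
  rwa [koszulBasis_apply] at this

open Classical in
/-- The contracting homotopy of the leading part of the Koszul complex. -/
def koszulHtpy (n : ℕ) : G.KoszulModule n →ₗ[R] G.KoszulModule (n + 1) :=
  (G.koszulBasis n).constr R fun q =>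
    -- The smallest variable of the monomial moves to the front of the wedge if it is below all
    -- indices there; otherwise the value is zero. Unlike the Euler homotopy, this needs no division
    -- by the degree.
    if h : ∃ i, IsLeast {i | q.1 i ≠ 0} i ∧ ∀ k, i < q.2 k then
      G.koszulElt (q.1 - Finsupp.single h.choose 1) (Fin.cons h.choose q.2 : Fin (n + 1) → Fin m)
    else 0

lemma koszulHtpy_elt {n : ℕ} {a : Fin m →₀ ℕ} {x : Fin n → Fin m} (hx : StrictMono x) {i : Fin m}
    (hi : IsLeast {i | a i ≠ 0} i) (h : ∀ k, i < x k) :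
    G.koszulHtpy n (G.koszulElt a x) =
      G.koszulElt (a - Finsupp.single i 1) (Fin.cons i x : Fin (n + 1) → Fin m) := by
  have key := G.koszulBasis_apply n (a, OrderEmbedding.ofStrictMono x hx)
  change _ = G.koszulElt a x at key
  have hex : ∃ i, IsLeast {i | a i ≠ 0} i ∧ ∀ k, i < (OrderEmbedding.ofStrictMono x hx) k :=
    ⟨i, hi, h⟩
  rw [← key, koszulHtpy, Module.Basis.constr_basis, dif_pos hex,
    hex.choose_spec.1.unique hi]
  rfl

lemma koszulHtpy_elt_eq_zero {n : ℕ} {a : Fin m →₀ ℕ} {x : Fin n → Fin m} (hx : StrictMono x)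
    (h : ∀ i, IsLeast {i | a i ≠ 0} i → ∃ k, x k ≤ i) : G.koszulHtpy n (G.koszulElt a x) = 0 := by
  have key := G.koszulBasis_apply n (a, OrderEmbedding.ofStrictMono x hx)
  change _ = G.koszulElt a x at key
  have hex : ¬ ∃ i, IsLeast {i | a i ≠ 0} i ∧ ∀ k, i < (OrderEmbedding.ofStrictMono x hx) k := by
    rintro ⟨i, hi, hk⟩
    obtain ⟨k, hk'⟩ := h i hi
    exact absurd (hk k) (not_lt.mpr hk')
  rw [← key, koszulHtpy, Module.Basis.constr_basis, dif_neg hex]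

lemma strictMono_finCons {n : ℕ} {i : Fin m} {x : Fin n → Fin m} (hx : StrictMono x)
    (h : ∀ k, i < x k) : StrictMono (Fin.cons i x : Fin (n + 1) → Fin m) := by
  intro k l
  refine Fin.cases (fun h0 => ?_) (fun l hkl => ?_) l
  · exact absurd h0 (Fin.not_lt_zero _)
  · revert hkl
    refine Fin.cases (fun _ => ?_) (fun k hkl => ?_) k
    · simpa using h l
    · simpa using hx (Fin.succ_lt_succ_iff.mp hkl)

lemma isLeast_add_single {a : Fin m →₀ ℕ} {i j : Fin m} (hi : IsLeast {i | a i ≠ 0} i)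
    (h : i ≤ j) : IsLeast {k | (a + Finsupp.single j 1 : Fin m →₀ ℕ) k ≠ 0} i := by
  refine ⟨?_, fun k hk => ?_⟩
  · have : a i ≠ 0 := hi.1
    simp [this]
  · by_cases hkj : k = j
    · rwa [hkj]
    · refine hi.2 ?_
      simpa [Finsupp.single_eq_of_ne hkj] using hk

/-- Let i be the smallest variable of e^a. If i lies below all wedge indices, then differentiating
after moving it returns the element from the term of index 0, and the remaining terms cancel against
the homotopy applied to the differential. Otherwise, or if a = 0, the homotopy vanishes and only the
term of index 0 of the differential survives it, since the first wedge index has then become the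
least variable. -/
lemma koszulHtpy_top_add {n : ℕ} (y : G.KoszulModule (n + 1)) :
    G.koszulHtpy n (G.koszulTop n y) + G.koszulTop (n + 1) (G.koszulHtpy (n + 1) y) = y := by
  refine LinearMap.congr_fun (f := G.koszulHtpy n ∘ₗ G.koszulTop n +
    G.koszulTop (n + 1) ∘ₗ G.koszulHtpy (n + 1)) (g := LinearMap.id)
    ((G.koszulBasis (n + 1)).ext ?_) y
  rintro ⟨a, s⟩
  rw [koszulBasis_apply]
  have hs : StrictMono s := s.strictMono
  generalize (s : Fin (n + 1) → Fin m) = x at *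
  change G.koszulHtpy n (G.koszulTop n (G.koszulElt a x)) +
    G.koszulTop (n + 1) (G.koszulHtpy (n + 1) (G.koszulElt a x)) = G.koszulElt a x
  rw [G.koszulTop_elt a x hs, map_sum]
  by_cases hA : ∃ i, IsLeast {i | a i ≠ 0} i ∧ ∀ k, i < x k
  · obtain ⟨i, hi, hik⟩ := hA
    have hle : Finsupp.single i 1 ≤ a := by
      rw [Finsupp.single_le_iff]
      exact Nat.one_le_iff_ne_zero.mpr hi.1
    rw [G.koszulHtpy_elt hs hi hik, G.koszulTop_elt _ _ (strictMono_finCons hs hik),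
      Fin.sum_univ_succ (n := n + 1)]
    have h0 : (Fin.cons i x : Fin (n + 2) → Fin m) ∘ (0 : Fin (n + 2)).succAbove = x := by
      funext k; simp
    rw [h0, Fin.cons_zero, tsub_add_cancel_of_le hle, Fin.val_zero, pow_zero, one_smul,
      add_left_comm, ← Finset.sum_add_distrib, Finset.sum_eq_zero, add_zero]
    intro j _
    have hj : (Fin.cons i x : Fin (n + 2) → Fin m) ∘ j.succ.succAbove =
        (Fin.cons i (x ∘ j.succAbove) : Fin (n + 1) → Fin m) := by
      funext k
      refine Fin.cases ?_ (fun k => ?_) k <;> simp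
    rw [map_smul, G.koszulHtpy_elt (hs.comp (Fin.strictMono_succAbove j))
      (isLeast_add_single hi (hik j).le) (fun k => hik _), hj, Fin.cons_succ, Fin.val_succ,
      pow_succ, mul_neg_one, tsub_add_eq_add_tsub hle]
    have key : ∀ (r : R) (e : G.KoszulModule (n + 1)), r • e + (-r) • e = 0 := fun r e => by
      rw [← add_smul, add_neg_cancel, zero_smul]
    exact key _ _
  · have hA' : ∀ i, IsLeast {i | a i ≠ 0} i → x 0 ≤ i := by
      intro i hi
      by_contra h
      exact hA ⟨i, hi, fun k => lt_of_lt_of_le (not_le.mp h) (hs.monotone (Fin.zero_le k))⟩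
    have hlow : ∀ j, a j ≠ 0 → x 0 ≤ j := by
      intro j hj
      have hne : (Finset.univ.filter fun i => a i ≠ 0).Nonempty := ⟨j, by simp [hj]⟩
      have hl : IsLeast {i | a i ≠ 0} ((Finset.univ.filter fun i => a i ≠ 0).min' hne) := by
        have := Finset.isLeast_min' _ hne
        simpa using this
      exact (hA' _ hl).trans (hl.2 hj)
    rw [G.koszulHtpy_elt_eq_zero hs fun i hi => ⟨0, hA' i hi⟩, map_zero, add_zero,
      Fin.sum_univ_succ, Finset.sum_eq_zero, add_zero]
    · have hl : IsLeast {k | (a + Finsupp.single (x 0) 1 : Fin m →₀ ℕ) k ≠ 0} (x 0) := by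
        refine ⟨by simp, fun k hk => ?_⟩
        by_cases hk0 : k = x 0
        · rw [hk0]
        · refine hlow k ?_
          simpa [Finsupp.single_eq_of_ne hk0] using hk
      rw [Fin.val_zero, pow_zero, one_smul, G.koszulHtpy_elt
        (hs.comp (Fin.strictMono_succAbove 0)) hl fun k => hs (by
          rw [Fin.succAbove_zero]; exact Fin.succ_pos k), add_tsub_cancel_right]
      congr 1
      funext k
      refine Fin.cases ?_ (fun k => ?_) k <;> simp
    · intro j _
      -- In these terms `x 0` stays in the wedge and is at most every variable of the new monomial,
      -- so the homotopy kills them.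
      rw [map_smul, G.koszulHtpy_elt_eq_zero (hs.comp (Fin.strictMono_succAbove _)), smul_zero]
      intro i hi
      cases n with
      | zero => exact j.elim0
      | succ n =>
        refine ⟨0, ?_⟩
        have hi' : (a + Finsupp.single (x j.succ) 1 : Fin m →₀ ℕ) i ≠ 0 := hi.1
        rw [Function.comp_apply, Fin.succAbove_ne_zero_zero (Fin.succ_ne_zero j)]
        by_cases hij : i = x j.succ
        · rw [hij]
          exact hs.monotone (Fin.zero_le _)
        · refine hlow i ?_
          simpa [Finsupp.single_eq_of_ne hij] using hi'

lemma koszulTop_htpy_zero {a : Fin m →₀ ℕ} (ha : a ≠ 0) (x : Fin 0 → Fin m) :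
    G.koszulTop 0 (G.koszulHtpy 0 (G.koszulElt a x)) = G.koszulElt a x := by
  have hne : (Finset.univ.filter fun i => a i ≠ 0).Nonempty := by
    obtain ⟨i, hi⟩ := Finsupp.ne_iff.mp ha
    exact ⟨i, by simpa using hi⟩
  have hl : IsLeast {i | a i ≠ 0} ((Finset.univ.filter fun i => a i ≠ 0).min' hne) := by
    have := Finset.isLeast_min' _ hne
    simpa using this
  have hx : StrictMono x := fun i => i.elim0
  have hk : ∀ k : Fin 0, (Finset.univ.filter fun i => a i ≠ 0).min' hne < x k := fun k => k.elim0
  have hle : Finsupp.single ((Finset.univ.filter fun i => a i ≠ 0).min' hne) 1 ≤ a := by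
    rw [Finsupp.single_le_iff]
    exact Nat.one_le_iff_ne_zero.mpr hl.1
  rw [G.koszulHtpy_elt hx hl hk, G.koszulTop_elt _ _ (strictMono_finCons hx hk), Fin.sum_univ_one,
    Fin.val_zero, pow_zero, one_smul, Fin.cons_zero, tsub_add_cancel_of_le hle]
  congr 1

lemma koszulHtpy_mem {n k : ℕ} {y : G.KoszulModule n} (hy : y ∈ G.koszulFilt n (k + 1)) :
    G.koszulHtpy n y ∈ G.koszulFilt (n + 1) k := by
  refine G.koszulFilt_le ((G.koszulFilt (n + 1) k).comap (G.koszulHtpy n)) (fun a x ha hx => ?_) hy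
  rw [Submodule.mem_comap]
  by_cases hA : ∃ i, IsLeast {i | a i ≠ 0} i ∧ ∀ k, i < x k
  · obtain ⟨i, hi, hik⟩ := hA
    have hle : Finsupp.single i 1 ≤ a := by
      rw [Finsupp.single_le_iff]
      exact Nat.one_le_iff_ne_zero.mpr hi.1
    rw [G.koszulHtpy_elt hx hi hik]
    refine Submodule.subset_span ⟨_, ?_, _, rfl⟩
    have := congrArg Finsupp.degree (tsub_add_cancel_of_le hle)
    rw [map_add, Finsupp.degree_single] at this
    omega
  · rw [G.koszulHtpy_elt_eq_zero hx]
    · exact zero_mem _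
    · intro i hi
      by_contra! h
      exact hA ⟨i, hi, h⟩

/-- The bracket part does not change the monomial, and sorting e^a e_i costs only terms of degree at
most |a|. So the differential is its leading part, which raises the degree by one, up to terms that
do not raise it. -/
lemma koszulLin_sub_top_mem {n k : ℕ} {y : G.KoszulModule (n + 1)}
    (hy : y ∈ G.koszulFilt (n + 1) k) :
    LieCochains.koszulLin R G.lieBasis n y - G.koszulTop n y ∈ G.koszulFilt n k := by
  refine G.koszulFilt_le ((G.koszulFilt n k).comap
    ((LieCochains.koszulLin R G.lieBasis n).restrictScalars R - G.koszulTop n))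
    (fun a x ha hx => ?_) hy
  rw [Submodule.mem_comap]
  change LieCochains.koszulLin R G.lieBasis n (G.koszulElt a x) -
    G.koszulTop n (G.koszulElt a x) ∈ _
  rw [koszulD_elt _ _ _ hx, koszulTop_elt _ _ _ hx, add_sub_assoc, ← Finset.sum_sub_distrib]
  refine add_mem (G.tmul_mem_koszulFilt ha (G.pbwMonomial_mem_filt a) _)
    (Submodule.sum_mem _ fun j _ => ?_)
  have := smul_sub ((-1 : R) ^ (j : ℕ)) ((G.pbwMonomial a * G.gen (x j)) ⊗ₜ[R]
    G.wedge (x ∘ j.succAbove)) (G.koszulElt (a + Finsupp.single (x j) 1) (x ∘ j.succAbove))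
  rw [← this, koszulElt, ← TensorProduct.sub_tmul]
  exact Submodule.smul_mem _ _ (G.tmul_mem_koszulFilt ha (G.pbwMonomial_mul_gen a _) _)

-- The retraction takes the linear part of α(u), its coefficients at the δ_{e_i}; on the Lie algebra
-- this recovers the coordinates.
omit [IsDomain R] [CharZero R] in
attribute [local instance] LieRing.ofAssociativeRing in
lemma exists_lieProj : ∃ lam : G.U →ₗ[R] G.LieAlg,
    ∀ x, lam (UniversalEnvelopingAlgebra.ι R x) = x := by
  classical
  refine ⟨∑ i, ((G.value (Finsupp.single i 1)) ∘ₗ G.alpha.toLinearMap).smulRight (G.lieBasis i),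
    fun x => ?_⟩
  refine LinearMap.congr_fun (f := (∑ i, ((G.value (Finsupp.single i 1)) ∘ₗ
    G.alpha.toLinearMap).smulRight (G.lieBasis i)) ∘ₗ (UniversalEnvelopingAlgebra.ι R :
      G.LieAlg →ₗ⁅R⁆ G.U).toLinearMap) (g := LinearMap.id) (G.lieBasis.ext fun j => ?_) x
  have h : G.alpha (UniversalEnvelopingAlgebra.ι R (G.lieBasis j)) =
    G.delta (Finsupp.single j 1) := G.alpha_gen j
  have h' : ∀ i, ((G.value (Finsupp.single i 1)) ∘ₗ G.alpha.toLinearMap).smulRight (G.lieBasis i)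
      (UniversalEnvelopingAlgebra.ι R (G.lieBasis j)) =
      (if j = i then (1 : R) else 0) • G.lieBasis i := by
    intro i
    rw [LinearMap.smulRight_apply, LinearMap.comp_apply, AlgHom.toLinearMap_apply, h, value_delta]
    simp only [Finsupp.single_left_inj one_ne_zero]
  rw [LinearMap.comp_apply, LinearMap.sum_apply]
  refine (Finset.sum_congr rfl fun i _ => h' i).trans ?_
  simp

omit [IsDomain R] [CharZero R] in
lemma koszulLin_koszulLin (n : ℕ) (y : G.KoszulModule (n + 2)) :
    LieCochains.koszulLin R G.lieBasis n (LieCochains.koszulLin R G.lieBasis (n + 1) y) = 0 := by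
  obtain ⟨lam, hlam⟩ := G.exists_lieProj
  exact LieCochains.koszulLin_koszulLin lam hlam n y

/-- The Koszul complex is exact in positive degrees. -/
theorem koszulLin_exact (n : ℕ) (y : G.KoszulModule (n + 1))
    (hy : LieCochains.koszulLin R G.lieBasis n y = 0) :
    ∃ z, LieCochains.koszulLin R G.lieBasis (n + 1) z = y := by
  obtain ⟨k, hk⟩ := G.exists_mem_koszulFilt y
  induction k generalizing y with
  | zero =>
    rw [koszulFilt_zero, Submodule.mem_bot] at hk
    exact ⟨0, by rw [map_zero, hk]⟩
  | succ k ih =>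
    have h1 := G.koszulHtpy_mem hk
    have h2 := G.koszulHtpy_mem (G.koszulLin_sub_top_mem hk)
    have h3 := G.koszulLin_sub_top_mem h1
    rw [hy, zero_sub, map_neg] at h2
    -- Write t for the leading part and h for its homotopy. From y = hty + thy and dy = 0 one gets y
    -- - dhy = -h(d - t)y - (d - t)hy, which lies one step lower. The correction is a cycle, so
    -- induction applies.
    obtain ⟨z, hz⟩ := ih (y - LieCochains.koszulLin R G.lieBasis (n + 1) (G.koszulHtpy (n + 1) y))
      (by rw [map_sub, koszulLin_koszulLin, hy, sub_zero]) (by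
        have h4 := neg_mem (add_mem h2 h3)
        convert h4 using 1
        nth_rewrite 1 [← G.koszulHtpy_top_add y]
        abel)
    exact ⟨z + G.koszulHtpy (n + 1) y, by rw [map_add, hz, sub_add_cancel]⟩

/-- The Koszul complex is exact in degree zero. -/
theorem koszulLin_exact_zero (y : G.KoszulModule 0)
    (hy : LieCochains.reduce R G.LieAlg _ y = 0) :
    ∃ z, LieCochains.koszulLin R G.lieBasis 0 z = y := by
  have hr : ∀ z, LieCochains.reduce R G.LieAlg _ (LieCochains.koszulLin R G.lieBasis 0 z) = 0 := by
    intro z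
    obtain ⟨k, hk⟩ := G.exists_mem_koszulFilt z
    refine G.koszulFilt_le (LinearMap.ker (LieCochains.reduce R G.LieAlg _ ∘ₗ
      (LieCochains.koszulLin R G.lieBasis 0).restrictScalars R)) (fun a x _ hx => ?_) hk
    rw [LinearMap.mem_ker]
    change LieCochains.reduce R G.LieAlg _
      (LieCochains.koszulLin R G.lieBasis 0 (G.koszulElt a x)) = 0
    rw [koszulD_elt _ _ _ hx, Fin.sum_univ_one, Fin.val_zero, pow_zero, one_smul, map_add,
      LieCochains.reduce_tmul, LieCochains.reduce_tmul, map_mul, gen, LieCochains.counit_ι,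
      mul_zero, zero_smul, add_zero]
    exact smul_zero _
  -- Modulo boundaries every element becomes `1 ⊗ w`, and `reduce`, which kills boundaries, then
  -- forces `w = 0`. The hypothesis on `y` is dropped because the induction on the filtration
  -- applies to all elements.
  suffices h : ∃ z w, y = LieCochains.koszulLin R G.lieBasis 0 z + 1 ⊗ₜ[R] w by
    obtain ⟨z, w, rfl⟩ := h
    rw [map_add, hr, zero_add, LieCochains.reduce_tmul, map_one, one_smul] at hy
    exact ⟨z, by rw [hy, TensorProduct.tmul_zero, add_zero]⟩
  clear hy hr
  obtain ⟨k, hk⟩ := G.exists_mem_koszulFilt y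
  induction k generalizing y with
  | zero =>
    rw [koszulFilt_zero, Submodule.mem_bot] at hk
    exact ⟨0, 0, by rw [map_zero, hk, TensorProduct.tmul_zero, zero_add]⟩
  | succ k ih =>
    have h1 : ∃ w, y - G.koszulTop 0 (G.koszulHtpy 0 y) = 1 ⊗ₜ[R] w := by
      refine G.koszulFilt_le ((LinearMap.range (TensorProduct.mk R G.U (⋀[R]^0 G.LieAlg) 1)).comap
        (LinearMap.id - G.koszulTop 0 ∘ₗ G.koszulHtpy 0)) (fun a x _ hx => ?_) hk |>.imp
          fun _ h => h.symm
      rw [Submodule.mem_comap]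
      change G.koszulElt a x - G.koszulTop 0 (G.koszulHtpy 0 (G.koszulElt a x)) ∈ _
      by_cases ha : a = 0
      · subst ha
        rw [G.koszulHtpy_elt_eq_zero hx fun i hi => (hi.1 rfl).elim, map_zero, sub_zero]
        exact ⟨G.wedge x, by rw [koszulElt, pbwMonomial_zero]; rfl⟩
      · rw [G.koszulTop_htpy_zero ha, sub_self]
        exact zero_mem _
    obtain ⟨w, hw⟩ := h1
    have h3 := G.koszulLin_sub_top_mem (G.koszulHtpy_mem hk)
    obtain ⟨z, w', hz⟩ := ih _ h3
    refine ⟨G.koszulHtpy 0 y - z, w - w', ?_⟩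
    rw [map_sub, TensorProduct.tmul_sub, ← hw]
    have := hz
    rw [sub_eq_iff_eq_add] at this
    rw [this]
    abel

end Koszul

end FormalGroupLaw

/-! ### Comparison of resolutions by projectives -/

section Comparison

variable {A : Type*} [Ring A] {P Q : ℕ → Type*} [∀ n, AddCommGroup (P n)] [∀ n, Module A (P n)]
  [∀ n, AddCommGroup (Q n)] [∀ n, Module A (Q n)]

lemma exists_comp_eq_of_projective {M N N' : Type*} [AddCommGroup M] [Module A M] [AddCommGroup N]
    [Module A N] [AddCommGroup N'] [Module A N'] [Module.Projective A M] (d : N' →ₗ[A] N)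
    (φ : M →ₗ[A] N) (h : ∀ x, ∃ z, d z = φ x) : ∃ ψ : M →ₗ[A] N', d ∘ₗ ψ = φ := by
  obtain ⟨ψ, hψ⟩ := Module.projective_lifting_property d.rangeRestrict
    (φ.codRestrict (LinearMap.range d) h) d.surjective_rangeRestrict
  refine ⟨ψ, LinearMap.ext fun x => ?_⟩
  exact congrArg Subtype.val (LinearMap.congr_fun hψ x)

open Classical in
/-- A chosen lift of `φ` along `d`, if there is one. -/
def chooseLift {M N N' : Type*} [AddCommGroup M] [Module A M] [AddCommGroup N]
    [Module A N] [AddCommGroup N'] [Module A N'] (d : N' →ₗ[A] N) (φ : M →ₗ[A] N) : M →ₗ[A] N' :=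
  -- The default 0 lets the lifts be defined by plain recursion, with their existence proved
  -- afterwards by induction.
  if h : ∃ ψ : M →ₗ[A] N', d ∘ₗ ψ = φ then h.choose else 0

lemma comp_chooseLift {M N N' : Type*} [AddCommGroup M] [Module A M] [AddCommGroup N]
    [Module A N] [AddCommGroup N'] [Module A N'] [Module.Projective A M] {d : N' →ₗ[A] N}
    {φ : M →ₗ[A] N} (h : ∀ x, ∃ z, d z = φ x) : d ∘ₗ chooseLift d φ = φ := by
  have h' := exists_comp_eq_of_projective d φ h
  rw [chooseLift, dif_pos h']
  exact h'.choose_spec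

/-- A map in degree zero extends to a morphism from a complex of projectives to an exact complex. -/
theorem exists_chainMap [∀ n, Module.Projective A (P n)] (dP : ∀ n, P (n + 1) →ₗ[A] P n)
    (dQ : ∀ n, Q (n + 1) →ₗ[A] Q n) (hP : ∀ n x, dP n (dP (n + 1) x) = 0)
    (hQ : ∀ n y, dQ n y = 0 → ∃ z, dQ (n + 1) z = y) (g : P 0 →ₗ[A] Q 0)
    (hg : ∀ x, ∃ z, dQ 0 z = g (dP 0 x)) :
    ∃ f : ∀ n, P n →ₗ[A] Q n, f 0 = g ∧ ∀ n, dQ n ∘ₗ f (n + 1) = f n ∘ₗ dP n := by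
  refine ⟨fun n => Nat.rec g (fun n f => chooseLift (dQ n) (f ∘ₗ dP n)) n, rfl, fun n => ?_⟩
  refine comp_chooseLift ?_
  induction n with
  | zero => exact hg
  | succ n ih =>
    intro x
    refine hQ n _ ?_
    have := LinearMap.congr_fun (comp_chooseLift ih) (dP (n + 1) x)
    refine this.trans ?_
    rw [LinearMap.comp_apply, hP, map_zero]

/-- A morphism from a complex of projectives to an exact complex which vanishes in degree zero is
null-homotopic. -/
theorem exists_nullHomotopy [∀ n, Module.Projective A (P n)] (dP : ∀ n, P (n + 1) →ₗ[A] P n)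
    (dQ : ∀ n, Q (n + 1) →ₗ[A] Q n) (hP : ∀ n x, dP n (dP (n + 1) x) = 0)
    (hQ : ∀ n y, dQ n y = 0 → ∃ z, dQ (n + 1) z = y) (f : ∀ n, P n →ₗ[A] Q n) (h0 : f 0 = 0)
    (hf : ∀ n, dQ n ∘ₗ f (n + 1) = f n ∘ₗ dP n) :
    ∃ s : ∀ n, P n →ₗ[A] Q (n + 1), s 0 = 0 ∧ ∀ n, f (n + 1) = dQ (n + 1) ∘ₗ s (n + 1) + s n ∘ₗ dP n := by
  refine ⟨fun n => Nat.rec 0 (fun n s => chooseLift (dQ (n + 1)) (f (n + 1) - s ∘ₗ dP n)) n,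
    rfl, fun n => ?_⟩
  refine eq_add_of_sub_eq (Eq.symm (comp_chooseLift ?_))
  induction n with
  | zero =>
    intro x
    refine hQ 0 _ ?_
    have := LinearMap.congr_fun (hf 0) x
    rw [h0] at this
    simpa using this
  | succ n ih =>
    intro x
    refine hQ (n + 1) _ ?_
    -- The previous identity at a boundary reads d s(dx) = f(dx), because dd = 0; hence f(x) - s(dx)
    -- is a cycle and can be lifted.
    have h1 := LinearMap.congr_fun (comp_chooseLift ih) (dP (n + 1) x)
    have h2 := LinearMap.congr_fun (hf (n + 1)) x
    rw [LinearMap.comp_apply, LinearMap.comp_apply] at h2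
    rw [LinearMap.sub_apply, map_sub, h2, sub_eq_zero]
    refine Eq.trans ?_ h1.symm
    rw [LinearMap.sub_apply, LinearMap.comp_apply, hP, map_zero, sub_zero]

end Comparison

/-! ### From sequences of linear maps to complexes -/

section ToComplex

variable {R : Type u} [CommRing R]
  {X Y : ℕ → Type u} [∀ n, AddCommGroup (X n)] [∀ n, Module R (X n)]
  [∀ n, AddCommGroup (Y n)] [∀ n, Module R (Y n)]
  {dX : ∀ n, X n →ₗ[R] X (n + 1)} {dY : ∀ n, Y n →ₗ[R] Y (n + 1)}
  (hX : ∀ n, dX (n + 1) ∘ₗ dX n = 0) (hY : ∀ n, dY (n + 1) ∘ₗ dY n = 0)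

lemma toHom_f (f : ∀ n, X n →ₗ[R] Y n) (hf : ∀ n, f (n + 1) ∘ₗ dX n = dY n ∘ₗ f n) (n : ℕ) :
    (toHom hX hY f hf).f n = ModuleCat.ofHom (f n) := rfl

/-- A homotopy between morphisms of complexes of modules. -/
def homotopyOfMaps (f g : ∀ n, X n →ₗ[R] Y n) (hf : ∀ n, f (n + 1) ∘ₗ dX n = dY n ∘ₗ f n)
    (hg : ∀ n, g (n + 1) ∘ₗ dX n = dY n ∘ₗ g n) (s : ∀ n, X (n + 1) →ₗ[R] Y n)
    (h0 : f 0 = s 0 ∘ₗ dX 0 + g 0)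
    (h : ∀ n, f (n + 1) = s (n + 1) ∘ₗ dX (n + 1) + dY n ∘ₗ s n + g (n + 1)) :
    Homotopy (toHom hX hY f hf) (toHom hX hY g hg) := by
  let S : ∀ i j, (ComplexShape.up ℕ).Rel j i →
      ((toComplex X dX hX).X i ⟶ (toComplex Y dY hY).X j) := fun i j hij =>
    match i, hij with
    | _, rfl => ModuleCat.ofHom (s j)
  -- Degree zero is separate because there is no incoming differential, so only one of the two
  -- homotopy terms is present.
  have key : toHom hX hY f hf - toHom hX hY g hg = Homotopy.nullHomotopicMap' S := by
    ext1 n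
    rw [HomologicalComplex.sub_f_apply]
    refine sub_eq_of_eq_add ?_
    cases n with
    | zero =>
      rw [Homotopy.nullHomotopicMap'_f_of_not_rel_right (k₁ := 0) (k₀ := 1) rfl (by simp),
        toComplex_d]
      change ModuleCat.ofHom (f 0) =
        ModuleCat.ofHom (dX 0) ≫ ModuleCat.ofHom (s 0) + ModuleCat.ofHom (g 0)
      rw [h0]
      rfl
    | succ n =>
      rw [Homotopy.nullHomotopicMap'_f (k₂ := n) (k₁ := n + 1) (k₀ := n + 2) rfl rfl,
        toComplex_d, toComplex_d]
      change ModuleCat.ofHom (f (n + 1)) =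
        ModuleCat.ofHom (dX (n + 1)) ≫ ModuleCat.ofHom (s (n + 1)) +
          ModuleCat.ofHom (s n) ≫ ModuleCat.ofHom (dY n) + ModuleCat.ofHom (g (n + 1))
      rw [h]
      rfl
  exact (Homotopy.equivSubZero.symm) ((Homotopy.ofEq key).trans (Homotopy.nullHomotopy' S))

lemma quasiIso_toHom_of_homotopy (f : ∀ n, X n →ₗ[R] Y n) (g : ∀ n, Y n →ₗ[R] X n)
    (hf : ∀ n, f (n + 1) ∘ₗ dX n = dY n ∘ₗ f n) (hg : ∀ n, g (n + 1) ∘ₗ dY n = dX n ∘ₗ g n)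
    (s : ∀ n, X (n + 1) →ₗ[R] X n) (t : ∀ n, Y (n + 1) →ₗ[R] Y n)
    (hs0 : g 0 ∘ₗ f 0 = s 0 ∘ₗ dX 0 + LinearMap.id)
    (hs : ∀ n, g (n + 1) ∘ₗ f (n + 1) =
      s (n + 1) ∘ₗ dX (n + 1) + dX n ∘ₗ s n + LinearMap.id)
    (ht0 : f 0 ∘ₗ g 0 = t 0 ∘ₗ dY 0 + LinearMap.id)
    (ht : ∀ n, f (n + 1) ∘ₗ g (n + 1) =
      t (n + 1) ∘ₗ dY (n + 1) + dY n ∘ₗ t n + LinearMap.id) :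
    QuasiIso (toHom hX hY f hf) := by
  let e : HomotopyEquiv (toComplex X dX hX) (toComplex Y dY hY) :=
    { hom := toHom hX hY f hf
      inv := toHom hY hX g hg
      homotopyHomInvId := homotopyOfMaps hX hX (fun n => g n ∘ₗ f n) (fun n => LinearMap.id)
        (fun n => by rw [LinearMap.comp_assoc, hf, ← LinearMap.comp_assoc, hg]; rfl)
        (fun n => rfl) s hs0 hs
      homotopyInvHomId := homotopyOfMaps hY hY (fun n => f n ∘ₗ g n) (fun n => LinearMap.id)
        (fun n => by rw [LinearMap.comp_assoc, hg, ← LinearMap.comp_assoc, hf]; rfl)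
        (fun n => rfl) t ht0 ht }
  exact HomotopyEquiv.quasiIso_hom e

lemma isIso_toHom (f : ∀ n, X n →ₗ[R] Y n) (hf : ∀ n, f (n + 1) ∘ₗ dX n = dY n ∘ₗ f n)
    (h : ∀ n, Function.Bijective (f n)) : IsIso (toHom hX hY f hf) := by
  have : ∀ n, IsIso ((toHom hX hY f hf).f n) := fun n => by
    rw [toHom_f]
    exact (LinearEquiv.ofBijective (f n) (h n)).toModuleIso.isIso_hom
  exact HomologicalComplex.Hom.isIso_of_components _

end ToComplex

/-! ### A homotopy inverse of the antisymmetrisation -/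

namespace LieCochains

variable (R : Type u) [CommRing R] (L : Type u) [LieRing L] [LieAlgebra R L]

/-- The inverse of the antisymmetrisation in degree zero. -/
def antisymmZeroInv : UPow R L 0 →ₗ[R] ⋀[R]^0 L :=
  (PiTensorProduct.isEmptyEquiv (Fin 0)).toLinearMap.smulRight (exteriorPower.ιMulti R 0 Fin.elim0)

lemma antisymmZeroInv_tprod (u : Fin 0 → UniversalEnvelopingAlgebra R L) :
    antisymmZeroInv R L (PiTensorProduct.tprod R u) = exteriorPower.ιMulti R 0 Fin.elim0 := by
  simp [antisymmZeroInv]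

lemma antisymm_zero (x : Fin 0 → L) (u : Fin 0 → UniversalEnvelopingAlgebra R L) :
    antisymm R L 0 (exteriorPower.ιMulti R 0 x) = PiTensorProduct.tprod R u := by
  rw [antisymm_ιMulti, signedSum, Fintype.sum_unique, lieTensor]
  have h : Equiv.Perm.sign (default : Equiv.Perm (Fin 0)) = 1 := Equiv.Perm.sign_one
  rw [h, one_smul]
  exact congrArg _ (Subsingleton.elim _ _)

lemma antisymm_antisymmZeroInv (w : UPow R L 0) : antisymm R L 0 (antisymmZeroInv R L w) = w := by
  refine LinearMap.congr_fun (f := antisymm R L 0 ∘ₗ antisymmZeroInv R L) (g := LinearMap.id)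
    (PiTensorProduct.ext (MultilinearMap.ext fun u => ?_)) w
  change antisymm R L 0 (antisymmZeroInv R L (PiTensorProduct.tprod R u)) =
    PiTensorProduct.tprod R u
  rw [antisymmZeroInv_tprod, antisymm_zero]

lemma antisymmZeroInv_antisymm (x : ⋀[R]^0 L) : antisymmZeroInv R L (antisymm R L 0 x) = x := by
  refine LinearMap.congr_fun (f := antisymmZeroInv R L ∘ₗ antisymm R L 0) (g := LinearMap.id)
    (exteriorPower.linearMap_ext (AlternatingMap.ext fun v => ?_)) x
  change antisymmZeroInv R L (antisymm R L 0 (exteriorPower.ιMulti R 0 v)) =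
    exteriorPower.ιMulti R 0 v
  rw [antisymm_zero R L v 0, antisymmZeroInv_tprod]
  exact congrArg _ (Subsingleton.elim _ _)

/-- The inverse in degree zero of the morphism from the Koszul complex to the bar complex. -/
def barToKoszulZero : UniversalEnvelopingAlgebra R L ⊗[R] UPow R L 0
    →ₗ[UniversalEnvelopingAlgebra R L] UniversalEnvelopingAlgebra R L ⊗[R] ⋀[R]^0 L :=
  extend (TensorProduct.mk R _ _ 1 ∘ₗ antisymmZeroInv R L)

lemma barToKoszulZero_tmul (u : UniversalEnvelopingAlgebra R L) (w : UPow R L 0) :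
    barToKoszulZero R L (u ⊗ₜ[R] w) = u ⊗ₜ[R] antisymmZeroInv R L w := by
  simp [barToKoszulZero, TensorProduct.smul_tmul']

/-- An honest inverse in degree zero is wanted, since `exists_nullHomotopy` starts from maps
vanishing there. -/
lemma koszulToBar_comp_zero : koszulToBar R L 0 ∘ₗ barToKoszulZero R L = LinearMap.id := by
  refine hom_ext_tmul fun w => ?_
  rw [LinearMap.comp_apply, barToKoszulZero_tmul, koszulToBar_tmul, antisymm_antisymmZeroInv]
  rfl

lemma comp_koszulToBar_zero : barToKoszulZero R L ∘ₗ koszulToBar R L 0 = LinearMap.id := by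
  refine hom_ext_tmul fun w => ?_
  rw [LinearMap.comp_apply, koszulToBar_tmul, barToKoszulZero_tmul, antisymmZeroInv_antisymm]
  rfl

lemma reduce_barToKoszulZero (y : UniversalEnvelopingAlgebra R L ⊗[R] UPow R L 0) :
    reduce R L _ (barToKoszulZero R L y) = antisymmZeroInv R L (reduce R L _ y) := by
  refine LinearMap.congr_fun (f := reduce R L _ ∘ₗ (barToKoszulZero R L).restrictScalars R)
    (g := antisymmZeroInv R L ∘ₗ reduce R L _) (TensorProduct.ext' fun u w => ?_) y
  change reduce R L _ (barToKoszulZero R L (u ⊗ₜ[R] w)) = antisymmZeroInv R L _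
  rw [barToKoszulZero_tmul, reduce_tmul, reduce_tmul, map_smul]

lemma barD_exact (n : ℕ) (y : UniversalEnvelopingAlgebra R L ⊗[R] UPow R L (n + 1))
    (h : barD R L n y = 0) : ∃ z, barD R L (n + 1) z = y :=
  ⟨barHtpy R L (n + 1) y, by rw [barD_barHtpy, h, map_zero, sub_zero]⟩

end LieCochains

namespace FormalGroupLaw

open LieCochains

variable {R : Type u} [CommRing R] {m : ℕ} (G : FormalGroupLaw R m) [IsDomain R] [CharZero R]

/-- By the Poincaré–Birkhoff–Witt basis the tensor powers of `U` are free over `R`, so extending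
scalars gives free U-modules. -/
lemma projective_bar (n : ℕ) : Module.Projective G.U (G.U ⊗[R] UPow R G.LieAlg n) := by
  have : Module.Free R (UPow R G.LieAlg n) :=
    Module.Free.of_basis (Basis.piTensorProduct fun _ => G.pbwBasis)
  infer_instance

omit [IsDomain R] [CharZero R] in
lemma projective_koszul (n : ℕ) : Module.Projective G.U (G.KoszulModule n) := by
  have : Module.Free R (⋀[R]^n G.LieAlg) := Module.Free.of_basis (G.lieBasis.exteriorPower n)
  infer_instance

/-- There is a morphism from the bar complex to the Koszul complex which is inverse to the
antisymmetrisation up to homotopy. -/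
lemma exists_homotopyInverse :
    ∃ (g : ∀ n, G.U ⊗[R] UPow R G.LieAlg n →ₗ[G.U] G.KoszulModule n)
      (s : ∀ n, G.KoszulModule n →ₗ[G.U] G.KoszulModule (n + 1))
      (t : ∀ n, G.U ⊗[R] UPow R G.LieAlg n →ₗ[G.U] G.U ⊗[R] UPow R G.LieAlg (n + 1)),
      (∀ n, koszulLin R G.lieBasis n ∘ₗ g (n + 1) = g n ∘ₗ barD R G.LieAlg n) ∧
      (s 0 = 0 ∧ ∀ y, g 0 (koszulToBar R G.LieAlg 0 y) = y) ∧
      (t 0 = 0 ∧ ∀ y, koszulToBar R G.LieAlg 0 (g 0 y) = y) ∧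
      (∀ n y, g (n + 1) (koszulToBar R G.LieAlg (n + 1) y) =
        koszulLin R G.lieBasis (n + 1) (s (n + 1) y) + s n (koszulLin R G.lieBasis n y) + y) ∧
      (∀ n y, koszulToBar R G.LieAlg (n + 1) (g (n + 1) y) =
        barD R G.LieAlg (n + 1) (t (n + 1) y) + t n (barD R G.LieAlg n y) + y) := by
  have := G.projective_bar
  have := G.projective_koszul
  -- The lift starts with the inverse in degree zero, which respects augmentations; a boundary of
  -- the bar complex therefore goes to an element of augmentation zero, and this is a Koszul
  -- boundary.
  obtain ⟨g, hg0, hg⟩ := exists_chainMap (A := G.U) (P := fun n => G.U ⊗[R] UPow R G.LieAlg n)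
    (Q := G.KoszulModule) (barD R G.LieAlg) (koszulLin R G.lieBasis) (barD_barD R G.LieAlg)
    G.koszulLin_exact (barToKoszulZero R G.LieAlg) fun x => G.koszulLin_exact_zero _ (by
      rw [reduce_barToKoszulZero, reduce_barD_zero, map_zero])
  have h1 : g 0 ∘ₗ koszulToBar R G.LieAlg 0 = LinearMap.id := by rw [hg0, comp_koszulToBar_zero]
  have h2 : koszulToBar R G.LieAlg 0 ∘ₗ g 0 = LinearMap.id := by rw [hg0, koszulToBar_comp_zero]
  have has : ∀ n, koszulToBar R G.LieAlg n ∘ₗ koszulLin R G.lieBasis n =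
      barD R G.LieAlg n ∘ₗ koszulToBar R G.LieAlg (n + 1) := fun n =>
    LinearMap.ext fun y => koszulToBar_koszulLin R G.lieBasis n y
  obtain ⟨s, hs0, hs⟩ := exists_nullHomotopy (A := G.U) (P := G.KoszulModule)
    (Q := G.KoszulModule) (koszulLin R G.lieBasis) (koszulLin R G.lieBasis) G.koszulLin_koszulLin
    G.koszulLin_exact (fun n => g n ∘ₗ koszulToBar R G.LieAlg n - LinearMap.id)
    (LinearMap.ext fun y => sub_eq_zero.mpr (LinearMap.congr_fun h1 y)) fun n => by
      rw [LinearMap.comp_sub, LinearMap.sub_comp, LinearMap.comp_assoc, has,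
        ← LinearMap.comp_assoc, ← LinearMap.comp_assoc, hg, LinearMap.comp_id, LinearMap.id_comp]
  obtain ⟨t, ht0, ht⟩ := exists_nullHomotopy (A := G.U) (P := fun n => G.U ⊗[R] UPow R G.LieAlg n)
    (Q := fun n => G.U ⊗[R] UPow R G.LieAlg n) (barD R G.LieAlg) (barD R G.LieAlg)
    (barD_barD R G.LieAlg) (barD_exact R G.LieAlg)
    (fun n => koszulToBar R G.LieAlg n ∘ₗ g n - LinearMap.id)
    (LinearMap.ext fun y => sub_eq_zero.mpr (LinearMap.congr_fun h2 y)) fun n => by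
      rw [LinearMap.comp_sub, LinearMap.sub_comp, LinearMap.comp_assoc, ← hg,
        ← LinearMap.comp_assoc, ← LinearMap.comp_assoc, has, LinearMap.comp_id, LinearMap.id_comp]
  exact ⟨g, s, t, hg, ⟨hs0, LinearMap.congr_fun h1⟩, ⟨ht0, LinearMap.congr_fun h2⟩,
    fun n y => sub_eq_iff_eq_add.mp (LinearMap.congr_fun (hs n) y),
    fun n y => sub_eq_iff_eq_add.mp (LinearMap.congr_fun (ht n) y)⟩

/-- `ν` is a quasi-isomorphism. -/
theorem quasiIso_nuHom (hUh : ∀ n, G.homD (n + 1) ∘ₗ G.homD n = 0)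
    (hV : ∀ n, G.koszulD (n + 1) ∘ₗ G.koszulD n = 0)
    (c : ∀ n, G.nu (n + 1) ∘ₗ G.homD n = G.koszulD n ∘ₗ G.nu n) : QuasiIso (G.nuHom hUh hV c) := by
  obtain ⟨g, s, t, hg, ⟨hs0, h1⟩, ⟨ht0, h2⟩, hs, ht⟩ := G.exists_homotopyInverse
  have hB : ∀ n, G.homD n = pull (barD R G.LieAlg n) := homD_eq_pull R G.LieAlg
  have hN : ∀ n, G.nu n = pull (koszulToBar R G.LieAlg n) := nu_eq_pull R
  have hK : ∀ n, G.koszulD n = pull (koszulLin R G.lieBasis n) := koszulHomD_eq_pull R G.lieBasis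
  -- Exactness need not survive passage to U-linear functionals, but homotopies do. As `pull` is
  -- contravariant, the homotopy `t` on the bar complex serves the source of ν and `s` its target.
  refine quasiIso_toHom_of_homotopy (X := G.HomCochain) (Y := G.KoszulCochain) hUh hV G.nu
    (fun n => pull (g n)) c (fun n => ?_) (fun n => pull (t n)) (fun n => pull (s n)) ?_ ?_ ?_ ?_
  · rw [hB, hK, ← pull_comp, ← pull_comp, hg]
  · rw [ht0, pull_zero, LinearMap.zero_comp, zero_add, hN]
    refine LinearMap.ext fun F => Subtype.ext (LinearMap.ext fun y => ?_)
    exact congrArg F.1 (h2 y)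
  · intro n
    rw [hN, hB (n + 1), hB n]
    refine LinearMap.ext fun F => Subtype.ext (LinearMap.ext fun y => ?_)
    have h := LinearMap.congr_arg (f := F.1) (ht n y)
    rw [map_add, map_add] at h
    exact h
  · rw [hs0, pull_zero, LinearMap.zero_comp, zero_add, hN]
    refine LinearMap.ext fun F => Subtype.ext (LinearMap.ext fun y => ?_)
    exact congrArg F.1 (h1 y)
  · intro n
    rw [hN]
    refine LinearMap.ext fun F => Subtype.ext (LinearMap.ext fun y => ?_)
    have h := LinearMap.congr_arg (f := F.1) (hs n y)
    rw [map_add, map_add] at h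
    exact h

end FormalGroupLaw

/-! ### Translations and the multiplication of series -/

namespace LieCochains

variable {R L : Type u} [CommRing R] [LieRing L] [LieAlgebra R L]

lemma comul_ι (x : L) : comul R L (UniversalEnvelopingAlgebra.ι R x) =
    UniversalEnvelopingAlgebra.ι R x ⊗ₜ[R] 1 + 1 ⊗ₜ[R] UniversalEnvelopingAlgebra.ι R x := by
  simp [comul]

end LieCochains

namespace FormalGroupLaw

open MvPowerSeries

variable {R : Type u} [CommRing R] {m : ℕ} (G : FormalGroupLaw R m)
  (A : Type u) [CommRing A] [Algebra R A]

section Slice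

variable {A}

/-- The coefficient of `X^x` in a power series in `(X, Y)`, a power series in `Y`. -/
def slice (x : Fin m →₀ ℕ) (P : MvPowerSeries (Fin 2 × Fin m) A) : MvPowerSeries (Fin m) A :=
  fun d => coeff (joinExp ![x, d]) P

lemma coeff_slice (x d : Fin m →₀ ℕ) (P : MvPowerSeries (Fin 2 × Fin m) A) :
    coeff d (slice x P) = coeff (joinExp ![x, d]) P := rfl

lemma joinExp_two_add (x y x' y' : Fin m →₀ ℕ) :
    joinExp ![x, y] + joinExp ![x', y'] = joinExp ![x + x', y + y'] := by
  ext ⟨b, k⟩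
  fin_cases b <;> simp [joinExp_apply]

lemma exists_joinExp_two (e : Fin 2 × Fin m →₀ ℕ) : ∃ x y, e = joinExp ![x, y] := by
  obtain ⟨p, rfl⟩ := joinExp_surjective e
  refine ⟨p 0, p 1, congrArg joinExp ?_⟩
  funext b; fin_cases b <;> rfl

lemma joinExp_two_inj {x y x' y' : Fin m →₀ ℕ} (h : joinExp ![x, y] = joinExp ![x', y']) :
    x = x' ∧ y = y' := by
  have := joinExp_injective h
  exact ⟨congrFun this 0, congrFun this 1⟩

lemma sum_antidiagonal_joinExp [DecidableEq (Fin 2 × Fin m)] [DecidableEq (Fin m)]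
    {N : Type*} [AddCommMonoid N] (x d : Fin m →₀ ℕ)
    (φ : (Fin 2 × Fin m →₀ ℕ) → (Fin 2 × Fin m →₀ ℕ) → N) :
    ∑ p ∈ Finset.HasAntidiagonal.antidiagonal (joinExp ![x, d]), φ p.1 p.2 =
      ∑ p ∈ Finset.HasAntidiagonal.antidiagonal x, ∑ q ∈ Finset.HasAntidiagonal.antidiagonal d,
        φ (joinExp ![p.1, q.1]) (joinExp ![p.2, q.2]) := by
  rw [← Finset.sum_product']
  symm
  refine Finset.sum_bij (fun r _ => (joinExp ![r.1.1, r.2.1], joinExp ![r.1.2, r.2.2])) ?_ ?_ ?_ ?_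
  · rintro ⟨⟨p, p'⟩, q, q'⟩ h
    simp only [Finset.mem_product, Finset.HasAntidiagonal.mem_antidiagonal] at h ⊢
    rw [joinExp_two_add, h.1, h.2]
  · rintro ⟨⟨p, p'⟩, q, q'⟩ _ ⟨⟨r, r'⟩, s, s'⟩ _ h
    simp only [Prod.mk.injEq] at h ⊢
    exact ⟨⟨(joinExp_two_inj h.1).1, (joinExp_two_inj h.2).1⟩, (joinExp_two_inj h.1).2,
      (joinExp_two_inj h.2).2⟩
  · rintro ⟨e, e'⟩ h
    obtain ⟨p, q, rfl⟩ := exists_joinExp_two e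
    obtain ⟨p', q', rfl⟩ := exists_joinExp_two e'
    rw [Finset.HasAntidiagonal.mem_antidiagonal, joinExp_two_add] at h
    obtain ⟨h1, h2⟩ := joinExp_two_inj h
    exact ⟨((p, p'), q, q'), by simp [h1, h2], rfl⟩
  · intros; rfl

/-- The exponent e_j splits in two ways only, so extracting the terms linear in X_j obeys the
Leibniz rule. -/
lemma slice_single_mul (j : Fin m) (P Q : MvPowerSeries (Fin 2 × Fin m) A) :
    slice (Finsupp.single j 1) (P * Q) =
      slice (Finsupp.single j 1) P * slice 0 Q + slice 0 P * slice (Finsupp.single j 1) Q := by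
  classical
  ext d
  rw [coeff_slice, coeff_mul, map_add, coeff_mul, coeff_mul, sum_antidiagonal_joinExp _ _
    fun e e' => coeff e P * coeff e' Q, Finsupp.antidiagonal_single, add_comm]
  simp [coeff_slice, Finset.Nat.antidiagonal_succ]

end Slice

/-- The pairing of the first block of variables with a distribution. -/
def leftPart : MvPowerSeries (Fin 2 × Fin m) A →ₗ[R] G.Distr →ₗ[R] MvPowerSeries (Fin m) A :=
  (G.deltaBasis.constr R).toLinearMap ∘ₗ LinearMap.pi fun x =>
    { toFun := slice x
      map_add' := fun _ _ => rfl
      map_smul' := fun _ _ => rfl }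

lemma leftPart_delta (P : MvPowerSeries (Fin 2 × Fin m) A) (x : Fin m →₀ ℕ) :
    G.leftPart A P (G.delta x) = slice x P := by
  simp only [leftPart, LinearMap.comp_apply, LinearEquiv.coe_coe, delta,
    Module.Basis.constr_basis]
  rfl

/-- The translate of a power series by a distribution, `f ↦ (φ ⊗ id)(f(G(X, Y)))`. -/
def translate (a : G.Distr) (f : MvPowerSeries (Fin m) A) : MvPowerSeries (Fin m) A :=
  G.leftPart A (subst (G.seriesOver A) f) a

/-- Translation is the transpose of left multiplication in `G.Distr`. Testing against all
distributions, the unit and associativity laws of translations follow from those of the product. -/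
lemma pairingOne_translate (a b : G.Distr) (f : MvPowerSeries (Fin m) A) :
    G.pairingOne A (G.translate A a f) b = G.pairingOne A f (a * b) := by
  refine LinearMap.congr_fun₂ (f := G.pairingOne A ∘ₗ G.leftPart A (subst (G.seriesOver A) f))
    (g := G.mulLin.compr₂ (G.pairingOne A f)) (G.deltaBasis.ext fun x => G.deltaBasis.ext fun y => ?_)
    a b
  change G.pairingOne A (G.leftPart A _ (G.delta x)) (G.delta y) =
    G.pairingOne A f (G.delta x * G.delta y)
  rw [leftPart_delta, pairingOne_delta, ← pairing_two_subst, coeff_slice]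
  have := G.pairing_tprod_delta A 2 (subst (G.seriesOver A) f) ![x, y]
  rw [← this]
  congr 2
  funext b
  fin_cases b <;> rfl

variable {A} in
lemma ext_pairingOne {f g : MvPowerSeries (Fin m) A}
    (h : ∀ b, G.pairingOne A f b = G.pairingOne A g b) : f = g := by
  ext d
  rw [← G.pairingOne_delta A, h, G.pairingOne_delta A]

lemma translate_one (f : MvPowerSeries (Fin m) A) : G.translate A 1 f = f :=
  G.ext_pairingOne fun b => by rw [pairingOne_translate, one_mul]

lemma translate_mul (a b : G.Distr) (f : MvPowerSeries (Fin m) A) :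
    G.translate A (a * b) f = G.translate A b (G.translate A a f) :=
  G.ext_pairingOne fun c => by
    rw [pairingOne_translate, pairingOne_translate, pairingOne_translate, mul_assoc]

/-- This is f(G(0, Y)) = f(Y); it holds because δ_0 is the unit of the algebra of distributions. -/
lemma slice_zero_subst (f : MvPowerSeries (Fin m) A) : slice 0 (subst (G.seriesOver A) f) = f := by
  rw [← G.leftPart_delta A]
  exact G.translate_one A f

lemma hasSubst_seriesOver : HasSubst (G.seriesOver A) :=
  hasSubst_of_constantCoeff_zero (G.constantCoeff_seriesOver A)

/-- Elements of the Lie algebra act as derivations: one takes the part of f(G(X,Y)) g(G(X,Y)) linear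
in X and uses that the part without X is f(Y) g(Y). -/
lemma translate_tangent_mul (x : G.LieAlg) (f g : MvPowerSeries (Fin m) A) :
    G.translate A (G.tangent x) (f * g) =
      G.translate A (G.tangent x) f * g + f * G.translate A (G.tangent x) g := by
  let T : MvPowerSeries (Fin m) A → G.LieAlg →ₗ[R] MvPowerSeries (Fin m) A := fun f =>
    G.leftPart A (subst (G.seriesOver A) f) ∘ₗ G.tangent
  refine LinearMap.congr_fun (f := T (f * g)) (g := LinearMap.mulRight R g ∘ₗ T f +
    LinearMap.mulLeft R f ∘ₗ T g) (G.lieBasis.ext fun j => ?_) x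
  have hj : G.tangent (G.lieBasis j) = G.delta (Finsupp.single j 1) := by
    rw [tangent, Module.Basis.constr_basis]
  change G.leftPart A _ (G.tangent (G.lieBasis j)) =
    G.leftPart A _ (G.tangent (G.lieBasis j)) * g + f * G.leftPart A _ (G.tangent (G.lieBasis j))
  rw [hj, leftPart_delta, leftPart_delta, leftPart_delta, subst_mul (G.hasSubst_seriesOver A),
    slice_single_mul, slice_zero_subst, slice_zero_subst]

/-- The functional `u ⊗ v ↦ ⟨f, u⟩ ⟨g, v⟩`. -/
def pairingTwo (f g : MvPowerSeries (Fin m) A) : G.U ⊗[R] G.U →ₗ[R] A :=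
  LinearMap.mul' R A ∘ₗ TensorProduct.map (G.dualAlphaOne A f) (G.dualAlphaOne A g)

lemma pairingTwo_tmul (f g : MvPowerSeries (Fin m) A) (u v : G.U) :
    G.pairingTwo A f g (u ⊗ₜ[R] v) = G.dualAlphaOne A f u * G.dualAlphaOne A g v := rfl

lemma dualAlphaOne_ι_mul (f : MvPowerSeries (Fin m) A) (x : G.LieAlg) (v : G.U) :
    G.dualAlphaOne A f (UniversalEnvelopingAlgebra.ι R x * v) =
      G.dualAlphaOne A (G.translate A (G.tangent x) f) v := by
  rw [dualAlphaOne_apply, dualAlphaOne_apply, map_mul, alpha_ι, pairingOne_translate]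

lemma pairingTwo_ι_mul_left (f g : MvPowerSeries (Fin m) A) (x : G.LieAlg) (w : G.U ⊗[R] G.U) :
    G.pairingTwo A f g (UniversalEnvelopingAlgebra.ι R x ⊗ₜ[R] 1 * w) =
      G.pairingTwo A (G.translate A (G.tangent x) f) g w := by
  induction w using TensorProduct.induction_on with
  | zero => simp
  | add w w' hw hw' => rw [mul_add, map_add, map_add, hw, hw']
  | tmul u v => rw [Algebra.TensorProduct.tmul_mul_tmul, pairingTwo_tmul, pairingTwo_tmul,
      dualAlphaOne_ι_mul, one_mul]

lemma pairingTwo_ι_mul_right (f g : MvPowerSeries (Fin m) A) (x : G.LieAlg) (w : G.U ⊗[R] G.U) :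
    G.pairingTwo A f g (1 ⊗ₜ[R] UniversalEnvelopingAlgebra.ι R x * w) =
      G.pairingTwo A f (G.translate A (G.tangent x) g) w := by
  induction w using TensorProduct.induction_on with
  | zero => simp
  | add w w' hw hw' => rw [mul_add, map_add, map_add, hw, hw']
  | tmul u v => rw [Algebra.TensorProduct.tmul_mul_tmul, pairingTwo_tmul, pairingTwo_tmul,
      dualAlphaOne_ι_mul, one_mul]

lemma dualAlphaOne_one (f : MvPowerSeries (Fin m) A) :
    G.dualAlphaOne A f 1 = constantCoeff f := by
  rw [dualAlphaOne_apply, map_one]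
  exact G.pairingOne_delta A f 0

/-- The pairing with a product of power series is given by the comultiplication of `U(𝔤)`. -/
theorem dualAlphaOne_mul (f g : MvPowerSeries (Fin m) A) (u : G.U) :
    G.dualAlphaOne A (f * g) u = G.pairingTwo A f g (LieCochains.comul R G.LieAlg u) := by
  -- The series `f` and `g` are quantified inside `p`, because multiplying `u` on the left by a Lie
  -- algebra element replaces them by translates.
  let p : Submodule R G.U :=
    { carrier := {u | ∀ f g, G.dualAlphaOne A (f * g) u =
        G.pairingTwo A f g (LieCochains.comul R G.LieAlg u)}
      add_mem' := fun {u v} hu hv f g => by rw [map_add, map_add, map_add, hu, hv]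
      zero_mem' := fun f g => by rw [map_zero, map_zero, map_zero]
      smul_mem' := fun r u hu f g => by rw [map_smul, map_smul, map_smul, hu] }
  refine UniversalEnvelopingAlgebra.mem_of_stable p (fun f g => ?_) (fun x v hv f g => ?_) u f g
  · rw [map_one (LieCochains.comul R G.LieAlg), Algebra.TensorProduct.one_def, pairingTwo_tmul, dualAlphaOne_one,
      dualAlphaOne_one, dualAlphaOne_one, map_mul]
  · rw [map_mul (LieCochains.comul R G.LieAlg), LieCochains.comul_ι, add_mul, map_add, pairingTwo_ι_mul_left, pairingTwo_ι_mul_right,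
      dualAlphaOne_ι_mul, translate_tangent_mul, ← hv, ← hv, map_add, LinearMap.add_apply]

lemma dualAlphaOne_C (c : A) (u : G.U) :
    G.dualAlphaOne A (C c) u = LieCochains.counit R G.LieAlg u • c := by
  rw [dualAlphaOne_apply, linearMap_eq_finsum, finsum_eq_single _ 0, pairingOne_delta,
    value_zero_alpha, coeff_zero_C]
  intro d hd
  rw [pairingOne_delta, coeff_C, if_neg hd, smul_zero]

variable [IsDomain R] [CharZero R]

theorem alphaTildeOne_mul (f g : G.OTilde) (u : G.U) : G.alphaTildeOne (f * g) u =
    LinearMap.mul' R R (TensorProduct.map (G.alphaTildeOne f) (G.alphaTildeOne g)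
      (LieCochains.comul R G.LieAlg u)) := by
  apply algebraMap_inj
  have h : ∀ w : G.U ⊗[R] G.U, algebraMap R (FractionRing R) (LinearMap.mul' R R
      (TensorProduct.map (G.alphaTildeOne f) (G.alphaTildeOne g) w)) =
      G.pairingTwo (FractionRing R) f.1 g.1 w := by
    intro w
    induction w using TensorProduct.induction_on with
    | zero => simp
    | add w w' hw hw' => rw [map_add, map_add, map_add, map_add, hw, hw']
    | tmul u v => rw [TensorProduct.map_tmul, LinearMap.mul'_apply, map_mul,
        algebraMap_alphaTildeOne, algebraMap_alphaTildeOne, pairingTwo_tmul, dualAlphaOne_apply,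
        dualAlphaOne_apply]
  rw [algebraMap_alphaTildeOne, h]
  exact G.dualAlphaOne_mul (FractionRing R) f.1 g.1 u

theorem alphaTildeOne_one : G.alphaTildeOne 1 = (LieCochains.counit R G.LieAlg).toLinearMap := by
  refine LinearMap.ext fun u => algebraMap_inj ?_
  rw [algebraMap_alphaTildeOne]
  have := G.dualAlphaOne_C (FractionRing R) 1 u
  rw [map_one, dualAlphaOne_apply] at this
  refine this.trans ?_
  rw [Algebra.smul_def, mul_one]
  rfl

theorem alphaTildeOne_apply_one (f : G.OTilde) :
    algebraMap R (FractionRing R) (G.alphaTildeOne f 1) = constantCoeff f.1 := by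
  rw [algebraMap_alphaTildeOne]
  exact G.dualAlphaOne_one (FractionRing R) f.1

theorem alphaTildeOne_ι (f : G.OTilde) (x : G.LieAlg) :
    algebraMap R (FractionRing R) (G.alphaTildeOne f (UniversalEnvelopingAlgebra.ι R x)) =
      ∑ j, algebraMap R (FractionRing R) (G.lieBasis.repr x j) *
        coeff (Finsupp.single j 1) f.1 := by
  have h : G.tangent x = ∑ j, G.lieBasis.repr x j • G.delta (Finsupp.single j 1) := by
    conv_lhs => rw [← G.lieBasis.sum_repr x]
    rw [map_sum]
    refine Finset.sum_congr rfl fun j _ => ?_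
    rw [map_smul, tangent, Module.Basis.constr_basis]
  rw [algebraMap_alphaTildeOne, alpha_ι, h, map_sum]
  refine Finset.sum_congr rfl fun j _ => ?_
  rw [map_smul, pairingOne_delta, Algebra.smul_def]

end FormalGroupLaw

/-! ### The order filtration and the inverse series -/

namespace MvPowerSeries

variable {σ τ A : Type*} [CommRing A]

variable (τ A) in
/-- The ideal of power series without terms of degree less than `k`. -/
def orderIdeal (k : ℕ) : Ideal (MvPowerSeries τ A) where
  carrier := {f | (k : ℕ∞) ≤ f.order}
  add_mem' hf hg := (le_min hf hg).trans min_order_le_add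
  zero_mem' := by simp
  smul_mem' f g hg := (hg.trans le_add_self).trans le_order_mul

lemma mem_orderIdeal {k : ℕ} {f : MvPowerSeries τ A} :
    f ∈ orderIdeal τ A k ↔ ∀ d : τ →₀ ℕ, d.degree < k → coeff d f = 0 := by
  constructor
  · intro h d hd
    exact coeff_of_lt_order (lt_of_lt_of_le (by exact_mod_cast hd) h)
  · intro h
    exact le_order fun d hd => h d (by exact_mod_cast hd)

lemma orderIdeal_mono {k l : ℕ} (h : k ≤ l) : orderIdeal τ A l ≤ orderIdeal τ A k :=
  fun f (hf : (l : ℕ∞) ≤ f.order) => le_trans (Nat.cast_le.mpr h) hf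

lemma mul_mem_orderIdeal {k l : ℕ} {f g : MvPowerSeries τ A} (hf : f ∈ orderIdeal τ A k)
    (hg : g ∈ orderIdeal τ A l) : f * g ∈ orderIdeal τ A (k + l) := by
  refine le_trans ?_ le_order_mul
  push_cast
  exact add_le_add hf hg

lemma mem_orderIdeal_one {f : MvPowerSeries τ A} :
    f ∈ orderIdeal τ A 1 ↔ constantCoeff f = 0 := by
  rw [← one_le_order_iff_constCoeff_eq_zero]
  exact Iff.of_eq (congrArg (· ≤ f.order) Nat.cast_one)

lemma exists_eq_single_add (d : σ →₀ ℕ) (n : ℕ) (h : d.degree = n + 1) :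
    ∃ j d', d = Finsupp.single j 1 + d' ∧ d'.degree = n := by
  have h0 : d ≠ 0 := by rintro rfl; simp at h
  obtain ⟨j, hj⟩ := Finsupp.ne_iff.mp h0
  have hle : Finsupp.single j 1 ≤ d := by
    rw [Finsupp.single_le_iff]
    have : d j ≠ 0 := hj
    omega
  refine ⟨j, d - Finsupp.single j 1, (add_tsub_cancel_of_le hle).symm, ?_⟩
  have h2 := congrArg Finsupp.degree (add_tsub_cancel_of_le hle)
  rw [map_add, Finsupp.degree_single] at h2
  omega

lemma prod_single_add (a : σ → MvPowerSeries τ A) (j : σ) (d : σ →₀ ℕ) :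
    (Finsupp.single j 1 + d).prod (fun s n => a s ^ n) = a j * d.prod fun s n => a s ^ n := by
  classical
  rw [Finsupp.prod_add_index' (fun _ => pow_zero _) fun _ _ _ => pow_add _ _ _]
  congr 1
  exact (Finsupp.prod_single_index (h := fun s n => a s ^ n) (pow_zero _)).trans (pow_one _)

lemma prod_mem_orderIdeal {a : σ → MvPowerSeries τ A} (ha : ∀ s, a s ∈ orderIdeal τ A 1)
    (d : σ →₀ ℕ) : d.prod (fun s n => a s ^ n) ∈ orderIdeal τ A d.degree := by
  induction hn : d.degree generalizing d with
  | zero => exact mem_orderIdeal.mpr fun e he => absurd he (Nat.not_lt_zero _)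
  | succ n ih =>
    obtain ⟨j, d', rfl, hd'⟩ := exists_eq_single_add d n hn
    rw [prod_single_add, add_comm n]
    exact mul_mem_orderIdeal (ha j) (ih d' hd')

/-- The n + 1 factors are exchanged one at a time; each resulting term has one difference of order k
and n further factors of order one. -/
lemma prod_sub_prod_mem_orderIdeal {a b : σ → MvPowerSeries τ A}
    (ha : ∀ s, a s ∈ orderIdeal τ A 1) (hb : ∀ s, b s ∈ orderIdeal τ A 1) {k : ℕ}
    (hab : ∀ s, a s - b s ∈ orderIdeal τ A k) (n : ℕ) (d : σ →₀ ℕ) (hd : d.degree = n + 1) :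
    d.prod (fun s n => a s ^ n) - d.prod (fun s n => b s ^ n) ∈ orderIdeal τ A (k + n) := by
  induction n generalizing d with
  | zero =>
    obtain ⟨j, d', rfl, hd'⟩ := exists_eq_single_add d 0 hd
    obtain rfl := (Finsupp.degree_eq_zero_iff d').mp hd'
    rw [prod_single_add, prod_single_add, Finsupp.prod_zero_index, Finsupp.prod_zero_index,
      mul_one, mul_one]
    exact hab j
  | succ n ih =>
    obtain ⟨j, d', rfl, hd'⟩ := exists_eq_single_add d _ hd
    rw [prod_single_add, prod_single_add]
    have h : ∀ x y z w : MvPowerSeries τ A, x * y - z * w = (x - z) * y + z * (y - w) := by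
      intros; ring
    rw [h]
    refine Ideal.add_mem _ ?_ ?_
    · rw [← hd']
      exact mul_mem_orderIdeal (hab j) (prod_mem_orderIdeal ha d')
    · rw [show k + (n + 1) = 1 + (k + n) by omega]
      exact mul_mem_orderIdeal (hb j) (ih d' hd')

lemma subst_sub_subst_mem_orderIdeal [Finite σ] {a b : σ → MvPowerSeries τ A}
    (ha : ∀ s, a s ∈ orderIdeal τ A 1) (hb : ∀ s, b s ∈ orderIdeal τ A 1) {k : ℕ}
    (hab : ∀ s, a s - b s ∈ orderIdeal τ A k) {n : ℕ} {f : MvPowerSeries σ A}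
    (hf : f ∈ orderIdeal σ A (n + 1)) :
    subst a f - subst b f ∈ orderIdeal τ A (k + n) := by
  rw [mem_orderIdeal]
  intro e he
  rw [map_sub, sub_eq_zero,
    coeff_subst (hasSubst_of_constantCoeff_zero fun s => mem_orderIdeal_one.mp (ha s)),
    coeff_subst (hasSubst_of_constantCoeff_zero fun s => mem_orderIdeal_one.mp (hb s))]
  refine finsum_congr fun d => ?_
  by_cases hd : d.degree < n + 1
  · rw [mem_orderIdeal.mp hf d hd, zero_smul, zero_smul]
  · obtain ⟨l, hl⟩ : ∃ l, d.degree = l + 1 := ⟨d.degree - 1, by omega⟩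
    have := mem_orderIdeal.mp (prod_sub_prod_mem_orderIdeal ha hb hab l d hl) e (by omega)
    rw [map_sub, sub_eq_zero] at this
    rw [this]

end MvPowerSeries

namespace FormalGroupLaw

open MvPowerSeries

variable {R : Type u} [CommRing R] {m : ℕ} (G : FormalGroupLaw R m)

/-- The terms of degree at least two in `G(t, s)`. -/
def higherTerms (s : Fin m → MvPowerSeries (Fin m) R) (j : Fin m) : MvPowerSeries (Fin m) R :=
  subst (pairBlocks X s) (G.series j - (X (0, j) + X (1, j)))

lemma pairBlocks_mem {s : Fin m → MvPowerSeries (Fin m) R} (hs : ∀ j, s j ∈ orderIdeal _ R 1)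
    (q : Fin 2 × Fin m) : pairBlocks X s q ∈ orderIdeal (Fin m) R 1 := by
  obtain ⟨b, k⟩ := q
  fin_cases b
  · exact mem_orderIdeal_one.mpr (constantCoeff_X k)
  · exact hs k

lemma eval_eq_higherTerms {s : Fin m → MvPowerSeries (Fin m) R}
    (hs : ∀ j, s j ∈ orderIdeal _ R 1) (j : Fin m) :
    G.eval R (fun i => X i) s j = X j + s j + G.higherTerms s j := by
  have h : HasSubst (pairBlocks X s : Fin 2 × Fin m → MvPowerSeries (Fin m) R) :=
    hasSubst_of_constantCoeff_zero fun q => mem_orderIdeal_one.mp (pairBlocks_mem hs q)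
  have h1 : G.seriesOver R j = G.series j := by
    rw [seriesOver, Algebra.algebraMap_self, map_id, RingHom.id_apply]
  rw [eval, h1, higherTerms, subst_sub h, subst_add h, subst_X h, subst_X h]
  simp [pairBlocks]

/-- Since G - X - Y has order at least two, agreement of the arguments improves by one degree. Hence
s ↦ -t - `higherTerms` s is a contraction, whose fixed point is the inverse series. -/
lemma higherTerms_sub_mem {s s' : Fin m → MvPowerSeries (Fin m) R}
    (hs : ∀ j, s j ∈ orderIdeal _ R 1) (hs' : ∀ j, s' j ∈ orderIdeal _ R 1) {k : ℕ}
    (h : ∀ j, s j - s' j ∈ orderIdeal _ R k) (j : Fin m) :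
    G.higherTerms s j - G.higherTerms s' j ∈ orderIdeal _ R (k + 1) := by
  refine subst_sub_subst_mem_orderIdeal (pairBlocks_mem hs) (pairBlocks_mem hs') ?_
    (G.two_le_order j)
  rintro ⟨b, i⟩
  fin_cases b
  · simp [pairBlocks]
  · exact h i

/-- The approximations of the inverse series. -/
def inverseApprox : ℕ → Fin m → MvPowerSeries (Fin m) R
  | 0, _ => 0
  | k + 1, j => -X j - G.higherTerms (inverseApprox k) j

lemma inverseApprox_mem (k : ℕ) (j : Fin m) : G.inverseApprox k j ∈ orderIdeal _ R 1 := by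
  induction k generalizing j with
  | zero => exact Ideal.zero_mem _
  | succ k ih =>
    refine Ideal.sub_mem _ (neg_mem (mem_orderIdeal_one.mpr (constantCoeff_X j))) ?_
    rw [mem_orderIdeal_one]
    refine constantCoeff_subst_eq_zero (hasSubst_of_constantCoeff_zero fun q =>
      mem_orderIdeal_one.mp (pairBlocks_mem ih q)) (fun q =>
      mem_orderIdeal_one.mp (pairBlocks_mem ih q)) ?_
    rw [← mem_orderIdeal_one]
    exact orderIdeal_mono (by norm_num) (G.two_le_order j)

lemma inverseApprox_succ_sub_mem (k : ℕ) (j : Fin m) :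
    G.inverseApprox (k + 1) j - G.inverseApprox k j ∈ orderIdeal _ R (k + 1) := by
  induction k generalizing j with
  | zero => exact Ideal.sub_mem _ (G.inverseApprox_mem 1 j) (G.inverseApprox_mem 0 j)
  | succ k ih =>
    have h := G.higherTerms_sub_mem (G.inverseApprox_mem (k + 1)) (G.inverseApprox_mem k) ih j
    have h2 : G.inverseApprox (k + 1 + 1) j - G.inverseApprox (k + 1) j =
        -(G.higherTerms (G.inverseApprox (k + 1)) j - G.higherTerms (G.inverseApprox k) j) := by
      rw [inverseApprox, inverseApprox]; ring
    rw [h2]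
    exact neg_mem h

lemma coeff_inverseApprox {k l : ℕ} (h : k ≤ l) (j : Fin m) (d : Fin m →₀ ℕ) (hd : d.degree ≤ k) :
    coeff d (G.inverseApprox l j) = coeff d (G.inverseApprox k j) := by
  induction l, h using Nat.le_induction with
  | base => rfl
  | succ l hl ih =>
    rw [← ih, ← sub_eq_zero, ← map_sub]
    exact mem_orderIdeal.mp (G.inverseApprox_succ_sub_mem l j) d (by omega)

/-- The inverse series of a formal group law. -/
def inverseSeries (j : Fin m) : MvPowerSeries (Fin m) R :=
  fun d => coeff d (G.inverseApprox d.degree j)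

lemma coeff_inverseSeries {k : ℕ} (j : Fin m) (d : Fin m →₀ ℕ) (hd : d.degree ≤ k) :
    coeff d (G.inverseSeries j) = coeff d (G.inverseApprox k j) :=
  (G.coeff_inverseApprox hd j d le_rfl).symm

theorem isInverseSeries_inverseSeries [IsDomain R] [CharZero R] :
    G.IsInverseSeries G.inverseSeries := by
  have h0 : ∀ j, G.inverseSeries j ∈ orderIdeal _ R 1 := fun j => by
    rw [mem_orderIdeal]
    intro d hd
    rw [G.coeff_inverseSeries (k := 0) j d (by omega)]
    exact mem_orderIdeal.mp (G.inverseApprox_mem 0 j) d hd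
  refine ⟨fun j => mem_orderIdeal_one.mp (h0 j), fun j => ?_⟩
  rw [G.eval_eq_higherTerms h0]
  ext d
  -- The limit agrees with the approximation number |d| up to degree |d|, so their higher terms have
  -- the same coefficient at `d`. Reading that coefficient of the limit from the next approximation,
  -- -t minus these higher terms, gives the required cancellation.
  have h1 := mem_orderIdeal.mp (G.higherTerms_sub_mem h0 (G.inverseApprox_mem d.degree)
    (k := d.degree + 1) (fun i => mem_orderIdeal.mpr fun e he => by
      rw [map_sub, sub_eq_zero]
      exact G.coeff_inverseSeries i e (by omega)) j) d (by omega)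
  rw [map_sub, sub_eq_zero] at h1
  rw [map_add, map_add, h1, G.coeff_inverseSeries j d (Nat.le_succ _), inverseApprox, map_sub,
    map_neg, map_zero]
  ring

end FormalGroupLaw

namespace MvPowerSeries

variable {σ τ A : Type*} [CommRing A]

lemma subst_mem_orderIdeal [Finite σ] {a : σ → MvPowerSeries τ A}
    (ha : ∀ s, a s ∈ orderIdeal τ A 1) {k : ℕ} {f : MvPowerSeries σ A}
    (hf : f ∈ orderIdeal σ A k) : subst a f ∈ orderIdeal τ A k := by
  rw [mem_orderIdeal]
  intro e he
  rw [coeff_subst (hasSubst_of_constantCoeff_zero fun s => mem_orderIdeal_one.mp (ha s))]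
  refine finsum_eq_zero_of_forall_eq_zero fun d => ?_
  by_cases hd : d.degree < k
  · rw [mem_orderIdeal.mp hf d hd, zero_smul]
  · rw [mem_orderIdeal.mp (prod_mem_orderIdeal ha d) e (by omega), smul_zero]

/-- A property of power series that is additive, holds for monomials and holds in high degree,
holds for all power series. -/
lemma mem_of_monomial_mem [Finite σ] (p : AddSubgroup (MvPowerSeries σ A))
    (h : ∀ d c, monomial d c ∈ p) {N : ℕ} (hN : ∀ f ∈ orderIdeal σ A N, f ∈ p)
    (f : MvPowerSeries σ A) : f ∈ p := by
  classical
  have hfin := Finsupp.finite_of_degree_le (σ := σ) N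
  have h1 : f - ∑ d ∈ hfin.toFinset, monomial d (coeff d f) ∈ orderIdeal σ A N := by
    rw [mem_orderIdeal]
    intro e he
    rw [map_sub, map_sum, Finset.sum_eq_single e]
    · rw [coeff_monomial_same, sub_self]
    · intro d _ hd
      rw [coeff_monomial, if_neg hd.symm]
    · intro he'
      exact absurd (hfin.mem_toFinset.mpr he.le) he'
  rw [← sub_add_cancel f (∑ d ∈ hfin.toFinset, monomial d (coeff d f))]
  exact p.add_mem (hN _ h1) (p.sum_mem fun d _ => h _ _)

end MvPowerSeries

/-! ### The antipode -/

namespace LieCochains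

variable {R L : Type u} [CommRing R] [LieRing L] [LieAlgebra R L]

lemma counit_ι_mul (x : L) (u : UniversalEnvelopingAlgebra R L) :
    counit R L (UniversalEnvelopingAlgebra.ι R x * u) = 0 := by
  rw [map_mul, counit_ι, zero_mul]

lemma antipode_one : antipode R L 1 = 1 := by
  rw [antipode, map_one, MulOpposite.unop_one]

lemma antipode_ι_mul (x : L) (u : UniversalEnvelopingAlgebra R L) :
    antipode R L (UniversalEnvelopingAlgebra.ι R x * u) =
      -(antipode R L u * UniversalEnvelopingAlgebra.ι R x) := by
  have h : antipodeOp R L (UniversalEnvelopingAlgebra.ι R x) =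
      MulOpposite.op (-UniversalEnvelopingAlgebra.ι R x) :=
    UniversalEnvelopingAlgebra.lift_ι_apply R _ x
  rw [antipode, map_mul, h, MulOpposite.unop_mul, MulOpposite.unop_op, mul_neg]
  rfl

variable (R L) in
/-- The map `a ⊗ b ↦ (a ⊗ 1) Δ(b)`. -/
def leftComul : UniversalEnvelopingAlgebra R L ⊗[R] UniversalEnvelopingAlgebra R L →ₗ[R]
    UniversalEnvelopingAlgebra R L ⊗[R] UniversalEnvelopingAlgebra R L :=
  LinearMap.mul' R _ ∘ₗ TensorProduct.map
    (Algebra.TensorProduct.includeLeft (S := R)).toLinearMap (comul R L).toLinearMap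

lemma leftComul_tmul (a b : UniversalEnvelopingAlgebra R L) :
    leftComul R L (a ⊗ₜ b) = a ⊗ₜ 1 * comul R L b := rfl

variable (R L) in
/-- The map `a ⊗ b ↦ ε(b) a`. -/
def counitRight : UniversalEnvelopingAlgebra R L ⊗[R] UniversalEnvelopingAlgebra R L →ₗ[R]
    UniversalEnvelopingAlgebra R L :=
  (TensorProduct.rid R _).toLinearMap ∘ₗ TensorProduct.map LinearMap.id (counit R L).toLinearMap

lemma counitRight_tmul (a b : UniversalEnvelopingAlgebra R L) :
    counitRight R L (a ⊗ₜ b) = counit R L b • a := by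
  simp [counitRight]

/-- The map `a ⊗ b ↦ a ⊗ x b - a x ⊗ b`. -/
def shift (x : L) : UniversalEnvelopingAlgebra R L ⊗[R] UniversalEnvelopingAlgebra R L →ₗ[R]
    UniversalEnvelopingAlgebra R L ⊗[R] UniversalEnvelopingAlgebra R L :=
  TensorProduct.map LinearMap.id (LinearMap.mulLeft R (UniversalEnvelopingAlgebra.ι R x)) -
    TensorProduct.map (LinearMap.mulRight R (UniversalEnvelopingAlgebra.ι R x)) LinearMap.id

lemma shift_tmul (x : L) (a b : UniversalEnvelopingAlgebra R L) :
    shift x (a ⊗ₜ[R] b) = a ⊗ₜ (UniversalEnvelopingAlgebra.ι R x * b) -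
      (a * UniversalEnvelopingAlgebra.ι R x) ⊗ₜ b := rfl

/-- In (a ⊗ 1) Δ(xb) the summand x ⊗ 1 of Δ(x) gives (ax ⊗ 1) Δ(b), which `shift` subtracts, so only
the summand 1 ⊗ x remains. -/
lemma leftComul_shift (x : L)
    (w : UniversalEnvelopingAlgebra R L ⊗[R] UniversalEnvelopingAlgebra R L) :
    leftComul R L (shift x w) = 1 ⊗ₜ UniversalEnvelopingAlgebra.ι R x * leftComul R L w := by
  induction w using TensorProduct.induction_on with
  | zero => simp
  | add w w' hw hw' => rw [map_add, map_add, map_add, hw, hw', mul_add]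
  | tmul a b =>
    rw [shift_tmul, map_sub, leftComul_tmul, leftComul_tmul, leftComul_tmul, map_mul, comul_ι,
      ← mul_assoc, ← mul_assoc, mul_add, Algebra.TensorProduct.tmul_mul_tmul,
      Algebra.TensorProduct.tmul_mul_tmul, Algebra.TensorProduct.tmul_mul_tmul, add_mul, one_mul,
      mul_one, one_mul, mul_one, one_mul, add_sub_cancel_left]

lemma counitRight_shift (x : L)
    (w : UniversalEnvelopingAlgebra R L ⊗[R] UniversalEnvelopingAlgebra R L) :
    counitRight R L (shift x w) = -(counitRight R L w * UniversalEnvelopingAlgebra.ι R x) := by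
  induction w using TensorProduct.induction_on with
  | zero => simp
  | add w w' hw hw' => rw [map_add, map_add, map_add, hw, hw', add_mul, neg_add]
  | tmul a b =>
    rw [shift_tmul, map_sub, counitRight_tmul, counitRight_tmul, counitRight_tmul, counit_ι_mul,
      zero_smul, zero_sub, smul_mul_assoc]

/-- The tensor `w` plays the role of the sum of S(u') ⊗ u''. Building it one letter at a time with
`shift` makes separate proofs of coassociativity and of the antipode axiom unnecessary. -/
theorem exists_leftComul_eq (u : UniversalEnvelopingAlgebra R L) :
    ∃ w, leftComul R L w = 1 ⊗ₜ u ∧ counitRight R L w = antipode R L u := by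
  let p : Submodule R (UniversalEnvelopingAlgebra R L) :=
    { carrier := {u | ∃ w, leftComul R L w = 1 ⊗ₜ u ∧ counitRight R L w = antipode R L u}
      add_mem' := by
        rintro u v ⟨w, h1, h2⟩ ⟨w', h1', h2'⟩
        refine ⟨w + w', by rw [map_add, h1, h1', TensorProduct.tmul_add], ?_⟩
        rw [map_add, h2, h2', antipode, antipode, antipode, map_add, MulOpposite.unop_add]
      zero_mem' := ⟨0, by rw [map_zero, TensorProduct.tmul_zero], by
        rw [map_zero, antipode, map_zero, MulOpposite.unop_zero]⟩
      smul_mem' := by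
        rintro r u ⟨w, h1, h2⟩
        refine ⟨r • w, by rw [map_smul, h1, TensorProduct.tmul_smul], ?_⟩
        rw [map_smul, h2, antipode, antipode, map_smul, MulOpposite.unop_smul] }
  refine UniversalEnvelopingAlgebra.mem_of_stable p ⟨1 ⊗ₜ 1, ?_, ?_⟩ ?_ u
  · rw [leftComul_tmul, map_one, mul_one]
  · rw [counitRight_tmul, map_one, one_smul, antipode_one]
  · rintro x v ⟨w, h1, h2⟩
    refine ⟨shift x w, ?_, ?_⟩
    · rw [leftComul_shift, h1, Algebra.TensorProduct.tmul_mul_tmul, one_mul]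
    · rw [counitRight_shift, h2, antipode_ι_mul]

end LieCochains

/-! ### Composition with the inverse series -/

namespace FormalGroupLaw

open MvPowerSeries

variable {R : Type u} [CommRing R] {m : ℕ} (G : FormalGroupLaw R m)
  {A : Type u} [CommRing A] [Algebra R A]

/-- This is the continuity of distributions: `a` is a finite combination of the δ_d. The bound is
uniform in the target and the map, as needed for the twisted pairing. -/
lemma exists_degree_bound (a : G.Distr) : ∃ N : ℕ, ∀ {M : Type u} [AddCommGroup M] [Module R M]
    (F : G.Distr →ₗ[R] M), (∀ d : Fin m →₀ ℕ, d.degree < N → F (G.delta d) = 0) → F a = 0 := by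
  refine ⟨(G.deltaBasis.repr a).support.sup Finsupp.degree + 1, fun F h => ?_⟩
  rw [linearMap_eq_finsum]
  refine finsum_eq_zero_of_forall_eq_zero fun d => ?_
  by_cases hd : d ∈ (G.deltaBasis.repr a).support
  · rw [h d (Nat.lt_succ_of_le (Finset.le_sup hd)), smul_zero]
  · rw [show G.value d a = 0 from Finsupp.notMem_support_iff.mp hd, zero_smul]

lemma exists_dualAlphaOne_eq_zero (u : G.U) :
    ∃ N : ℕ, ∀ f ∈ orderIdeal (Fin m) A N, G.dualAlphaOne A f u = 0 := by
  obtain ⟨N, hN⟩ := G.exists_degree_bound (G.alpha u)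
  refine ⟨N, fun f hf => hN (G.pairingOne A f) fun d hd => ?_⟩
  rw [pairingOne_delta]
  exact mem_orderIdeal.mp hf d hd

section Twist

variable {s : Fin m → MvPowerSeries (Fin m) A} (hs : HasSubst s)

/-- The functional `a ⊗ b ↦ (a ⊗ b)(P(X, s(Y)))` for a power series `P` in `(X, Y)`. -/
def twist (P : MvPowerSeries (Fin 2 × Fin m) A) : G.U ⊗[R] G.U →ₗ[R] A :=
  TensorProduct.lift (G.dualAlphaOne A ∘ₗ (substAlgHom hs).toLinearMap.restrictScalars R ∘ₗ
    G.leftPart A P ∘ₗ G.alpha.toLinearMap)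

lemma twist_tmul (P : MvPowerSeries (Fin 2 × Fin m) A) (a b : G.U) :
    G.twist hs P (a ⊗ₜ b) = G.dualAlphaOne A (subst s (G.leftPart A P (G.alpha a))) b := by
  rw [← coe_substAlgHom hs]
  rfl

lemma twist_add (P Q : MvPowerSeries (Fin 2 × Fin m) A) (w : G.U ⊗[R] G.U) :
    G.twist hs (P + Q) w = G.twist hs P w + G.twist hs Q w := by
  induction w using TensorProduct.induction_on with
  | zero => simp
  | add w w' hw hw' => rw [map_add, map_add, map_add, hw, hw']; abel
  | tmul a b => rw [twist_tmul, twist_tmul, twist_tmul, map_add, LinearMap.add_apply,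
      subst_add hs, map_add, LinearMap.add_apply]

variable (hs0 : ∀ j, constantCoeff (s j) = 0)

include hs0 in
lemma exists_twist_eq_zero (w : G.U ⊗[R] G.U) :
    ∃ N : ℕ, ∀ P ∈ orderIdeal (Fin 2 × Fin m) A N, G.twist hs P w = 0 := by
  induction w using TensorProduct.induction_on with
  | zero => exact ⟨0, fun P _ => map_zero _⟩
  | add w w' hw hw' =>
    obtain ⟨N, hN⟩ := hw
    obtain ⟨N', hN'⟩ := hw'
    refine ⟨max N N', fun P hP => ?_⟩
    rw [map_add, hN P (orderIdeal_mono (le_max_left _ _) hP),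
      hN' P (orderIdeal_mono (le_max_right _ _) hP), add_zero]
  | tmul a b =>
    obtain ⟨N, hN⟩ := G.exists_degree_bound (G.alpha a)
    obtain ⟨N', hN'⟩ := G.exists_dualAlphaOne_eq_zero (A := A) b
    refine ⟨N + N', fun P hP => hN ((G.dualAlphaOne A).flip b ∘ₗ
      (substAlgHom hs).toLinearMap.restrictScalars R ∘ₗ G.leftPart A P) fun d hd => ?_⟩
    change G.dualAlphaOne A (substAlgHom hs (G.leftPart A P (G.delta d))) b = 0
    rw [coe_substAlgHom, leftPart_delta]
    refine hN' _ (subst_mem_orderIdeal (fun j => mem_orderIdeal_one.mpr (hs0 j))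
      (mem_orderIdeal.mpr fun e he => ?_))
    rw [coeff_slice]
    exact mem_orderIdeal.mp hP _ (by rw [degree_joinExp_two]; omega)

lemma slice_monomial (x y z : Fin m →₀ ℕ) (c : A) :
    slice z (monomial (joinExp ![x, y]) c) = open Classical in if z = x then monomial y c else 0 := by
  classical
  ext d
  rw [coeff_slice, coeff_monomial]
  by_cases hz : z = x
  · subst hz
    rw [if_pos rfl, coeff_monomial]
    exact if_congr ⟨fun h => (joinExp_two_inj h).2, fun h => by rw [h]⟩ rfl rfl
  · rw [if_neg hz, if_neg fun h => hz (joinExp_two_inj h).1, map_zero]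

lemma twist_monomial (x y : Fin m →₀ ℕ) (c : A) (w : G.U ⊗[R] G.U) :
    G.twist hs (monomial (joinExp ![x, y]) c) w =
      G.pairingTwo A (monomial x 1) (subst s (monomial y c)) w := by
  classical
  induction w using TensorProduct.induction_on with
  | zero => simp
  | add w w' hw hw' => rw [map_add, map_add, hw, hw']
  | tmul a b =>
    have h : ∀ d, G.leftPart A (monomial (joinExp ![x, y]) c) d =
        G.pairingOne A (monomial x 1) d • monomial y c := by
      intro d
      refine LinearMap.congr_fun (g := (G.pairingOne A (monomial x 1)).smulRight (monomial y c))
        (G.deltaBasis.ext fun z => ?_) d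
      rw [LinearMap.smulRight_apply]
      refine (G.leftPart_delta A _ z).trans ?_
      have := G.pairingOne_delta A (monomial x 1) z
      rw [delta] at this
      rw [this, slice_monomial, coeff_monomial]
      split_ifs <;> simp
    rw [twist_tmul, h, subst_smul hs, pairingTwo_tmul, dualAlphaOne_apply, dualAlphaOne_apply,
      dualAlphaOne_apply]
    refine LinearMap.congr_fun (g := LinearMap.mulLeft R _ ∘ₗ G.pairingOne A _)
      (f := G.pairingOne A _) (G.deltaBasis.ext fun z => ?_) _
    refine (G.pairingOne_delta A _ z).trans ?_
    rw [coeff_smul]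
    exact congrArg _ (G.pairingOne_delta A _ z).symm

lemma hasSubst_pairBlocks_X (hs0 : ∀ j, constantCoeff (s j) = 0) :
    HasSubst (pairBlocks X s : Fin 2 × Fin m → MvPowerSeries (Fin m) A) := by
  refine hasSubst_of_constantCoeff_zero ?_
  rintro ⟨b, k⟩
  fin_cases b
  · exact constantCoeff_X k
  · exact hs0 k

include hs0 in
/-- Pairing `P(X, s(Y))` with `Δ(u)` amounts to pairing `P(t, s(t))` with `u`. -/
theorem twist_comul (P : MvPowerSeries (Fin 2 × Fin m) A) (u : G.U) :
    G.twist hs P (LieCochains.comul R G.LieAlg u) =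
      G.dualAlphaOne A (subst (pairBlocks X s) P) u := by
  have hp := hasSubst_pairBlocks_X hs0
  obtain ⟨N, hN⟩ := G.exists_twist_eq_zero hs hs0 (LieCochains.comul R G.LieAlg u)
  obtain ⟨N', hN'⟩ := G.exists_dualAlphaOne_eq_zero (A := A) u
  let F : MvPowerSeries (Fin 2 × Fin m) A →+ A :=
    { toFun := fun P => G.twist hs P (LieCochains.comul R G.LieAlg u)
      map_zero' := hN 0 (Ideal.zero_mem _)
      map_add' := fun P Q => G.twist_add hs P Q _ }
  let F' : MvPowerSeries (Fin 2 × Fin m) A →+ A :=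
    { toFun := fun P => G.dualAlphaOne A (subst (pairBlocks X s) P) u
      map_zero' := by rw [← coe_substAlgHom hp, map_zero, map_zero, LinearMap.zero_apply]
      map_add' := fun P Q => by rw [subst_add hp, map_add, LinearMap.add_apply] }
  -- Both sides are additive and vanish in high order, so monomials X^x Y^y suffice; for these the
  -- claim is `dualAlphaOne_mul` applied to t^x and a multiple of s^y.
  refine mem_of_monomial_mem (F.eqLocus F') ?_ (N := max N N') ?_ P
  · intro e c
    obtain ⟨x, y, rfl⟩ := exists_joinExp_two e
    change G.twist hs _ _ = G.dualAlphaOne A _ u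
    rw [twist_monomial, ← dualAlphaOne_mul, subst_monomial hs, subst_monomial hp]
    congr 2
    rw [Finsupp.prod_fintype _ _ (by simp), Finsupp.prod_fintype _ _ (by simp),
      Fintype.prod_prod_type, Fin.prod_univ_two]
    have h1 : (monomial x 1 : MvPowerSeries (Fin m) A) = ∏ i, X i ^ x i := by
      simp only [X_pow_eq]
      rw [prod_monomial, Finsupp.univ_sum_single, Finset.prod_const_one]
    rw [h1]
    simp only [joinExp_apply, pairBlocks, Matrix.cons_val_zero, Matrix.cons_val_one]
    ring
  · intro Q hQ
    change G.twist hs Q _ = G.dualAlphaOne A _ u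
    rw [hN Q (orderIdeal_mono (le_max_left _ _) hQ), hN' _ (orderIdeal_mono (le_max_right _ _)
      (subst_mem_orderIdeal (fun q => ?_) hQ))]
    rw [mem_orderIdeal_one]
    obtain ⟨b, k⟩ := q
    fin_cases b
    · exact constantCoeff_X k
    · exact hs0 k

lemma twist_mul_left (f : MvPowerSeries (Fin m) A) (a : G.U) (w : G.U ⊗[R] G.U) :
    G.twist hs (subst (G.seriesOver A) f) (a ⊗ₜ 1 * w) =
      G.twist hs (subst (G.seriesOver A) (G.translate A (G.alpha a) f)) w := by
  induction w using TensorProduct.induction_on with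
  | zero => simp
  | add w w' hw hw' => rw [mul_add, map_add, map_add, hw, hw']
  | tmul c b =>
    rw [Algebra.TensorProduct.tmul_mul_tmul, twist_tmul, twist_tmul, one_mul, map_mul]
    congr 3
    exact G.translate_mul A _ _ f

include hs0 in
/-- Composition with the inverse series is dual to the antipode of `U(𝔤)`. -/
theorem dualAlphaOne_subst_inverse (hinv : ∀ j, G.eval A (fun i => X i) s j = 0)
    (f : MvPowerSeries (Fin m) A) (u : G.U) :
    G.dualAlphaOne A (subst s f) u = G.dualAlphaOne A f (LieCochains.antipode R G.LieAlg u) := by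
  have hs : HasSubst s := hasSubst_of_constantCoeff_zero hs0
  have hp := hasSubst_pairBlocks_X hs0
  -- This is f(G(t, s(t))) = f(0).
  have h0 : ∀ f : MvPowerSeries (Fin m) A,
      subst (pairBlocks X s) (subst (G.seriesOver A) f) = C (constantCoeff f) := by
    intro f
    rw [subst_comp_subst_apply (G.hasSubst_seriesOver A) hp]
    have h1 : (fun j => subst (pairBlocks X s) (G.seriesOver A j)) =
        (0 : Fin m → MvPowerSeries (Fin m) A) := funext hinv
    rw [h1]
    ext d
    rw [coeff_subst (hasSubst_of_constantCoeff_zero (a := (0 : Fin m → MvPowerSeries (Fin m) A))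
      fun _ => map_zero _), finsum_eq_single _ 0]
    · rw [Finsupp.prod_zero_index, coeff_one, coeff_C]
      simp
    · intro e he
      obtain ⟨j, hj⟩ := Finsupp.ne_iff.mp he
      rw [Finsupp.prod_fintype _ _ (by simp), Finset.prod_eq_zero (Finset.mem_univ j), map_zero,
        smul_zero]
      exact zero_pow hj
  -- On (a ⊗ 1) Δ(b) the factor `a` translates f and Δ(b) restricts to the diagonal, where only the
  -- constant term is left. This gives ε(b) times the pairing of f with a.
  have hZ : ∀ w : G.U ⊗[R] G.U,
      G.twist hs (subst (G.seriesOver A) f) (LieCochains.leftComul R G.LieAlg w) =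
        G.dualAlphaOne A f (LieCochains.counitRight R G.LieAlg w) := by
    intro w
    induction w using TensorProduct.induction_on with
    | zero => simp
    | add w w' hw hw' => rw [map_add, map_add, map_add, map_add, hw, hw']
    | tmul a b =>
      rw [LieCochains.leftComul_tmul, twist_mul_left, twist_comul _ _ hs0, h0, dualAlphaOne_C,
        LieCochains.counitRight_tmul, map_smul, ← G.dualAlphaOne_one A, dualAlphaOne_apply,
        dualAlphaOne_apply, pairingOne_translate, map_one, mul_one]
  -- For this `w` the left side of `hZ` is evaluated at 1 ⊗ u, where f(G(0, s)) = f ∘ s is paired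
  -- with u, and the right side is the pairing of f with S(u).
  obtain ⟨w, hw1, hw2⟩ := LieCochains.exists_leftComul_eq u
  rw [← hw2, ← hZ, hw1, twist_tmul, map_one]
  congr 2
  exact congrArg (subst s) (G.translate_one A f).symm

end Twist

end FormalGroupLaw

/-! ### Assembly -/

namespace FormalGroupLaw

open MvPowerSeries

variable {R : Type u} [CommRing R] [IsDomain R] [CharZero R] {m : ℕ} (G : FormalGroupLaw R m)

theorem alphaTildeOne_antipode : ∃ s, G.IsInverseSeries s ∧ ∀ f : G.OTilde, ∃ g : G.OTilde,
    g.1 = subst (fun j => MvPowerSeries.map (algebraMap R (FractionRing R)) (s j)) f.1 ∧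
    ∀ u : G.U, G.alphaTildeOne g u = G.alphaTildeOne f (LieCochains.antipode R G.LieAlg u) := by
  obtain ⟨h0, hinv⟩ := G.isInverseSeries_inverseSeries
  refine ⟨G.inverseSeries, ⟨h0, hinv⟩, fun f => ?_⟩
  have hs0 : ∀ j, constantCoeff
      (MvPowerSeries.map (algebraMap R (FractionRing R)) (G.inverseSeries j)) = 0 := fun j => by
    rw [constantCoeff_map, h0, map_zero]
  have hinv' : ∀ j, G.eval (FractionRing R) (fun i => X i)
      (fun j => MvPowerSeries.map (algebraMap R (FractionRing R)) (G.inverseSeries j)) j = 0 := by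
    intro j
    have h := congrArg (MvPowerSeries.map (algebraMap R (FractionRing R))) (hinv j)
    rw [eval, map_subst (hasSubst_pairBlocks_X h0), map_zero, seriesOver,
      Algebra.algebraMap_self, map_id, RingHom.id_apply] at h
    rw [eval, seriesOver, ← h]
    congr 1
    funext ⟨b, k⟩
    fin_cases b
    · exact (map_X _ k).symm
    · rfl
  refine ⟨⟨_, subst_mem_modifiedSeries (fun j => map_mem_modifiedSeries _) hs0 f.2⟩, rfl,
    fun u => algebraMap_inj ?_⟩
  rw [algebraMap_alphaTildeOne, algebraMap_alphaTildeOne]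
  exact G.dualAlphaOne_subst_inverse hs0 hinv' f.1 u

theorem alphaIsHopfIso : G.AlphaIsHopfIso where
  bijective := G.alphaTildeOne_bijective
  pairing := G.alphaTildeOne_ι
  unit := G.alphaTildeOne_one
  mul := G.alphaTildeOne_mul
  counit := G.alphaTildeOne_apply_one
  comul := G.alphaTildeOne_comul
  antipode := G.alphaTildeOne_antipode
  filtration := G.alphaTildeOne_filtration

/-- The identity is pulled back from the inhomogeneous complex of `U` along the injective map
`alphaTilde`; associativity of G has entered through the algebra of distributions. -/
lemma cobarTildeD_cobarTildeD (n : ℕ) : G.cobarTildeD (n + 1) ∘ₗ G.cobarTildeD n = 0 := by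
  refine LinearMap.ext fun f => (G.alphaTilde_bijective (n + 2)).1 ?_
  have h1 := LinearMap.congr_fun (G.alphaTilde_comm (n + 1)) (G.cobarTildeD n f)
  have h2 := LinearMap.congr_fun (G.alphaTilde_comm n) f
  have h3 := LinearMap.congr_fun (LieCochains.inhomD_inhomD R G.LieAlg n) (G.alphaTilde n f)
  refine h1.trans ((congrArg (G.inhomD (n + 1)) h2).trans (h3.trans ?_))
  rw [LinearMap.zero_apply, LinearMap.zero_apply, map_zero]

lemma cobarD_cobarD (n : ℕ) : G.cobarD R (n + 1) ∘ₗ G.cobarD R n = 0 := by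
  refine LinearMap.ext fun f => G.incl_injective (n + 2) ?_
  have h1 := LinearMap.congr_fun (G.incl_comm (n + 1)) (G.cobarD R n f)
  have h2 := LinearMap.congr_fun (G.incl_comm n) f
  have h3 := LinearMap.congr_fun (G.cobarTildeD_cobarTildeD n) (G.incl n f)
  refine h1.trans ((congrArg (G.cobarTildeD (n + 1)) h2).trans (h3.trans ?_))
  rw [LinearMap.zero_apply, LinearMap.zero_apply, map_zero]

lemma phi_eq (n : ℕ) :
    G.phi n = G.kappa n ∘ₗ G.nu n ∘ₗ G.iota n ∘ₗ G.alphaTilde n ∘ₗ G.incl n := by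
  rw [phi, alphaTilde_comp_incl]

lemma phi_comm (n : ℕ) : G.phi (n + 1) ∘ₗ G.cobarD R n = G.ceD n ∘ₗ G.phi n := by
  refine LinearMap.ext fun f => ?_
  rw [phi_eq, phi_eq]
  have h1 := LinearMap.congr_fun (G.incl_comm n) f
  have h2 := LinearMap.congr_fun (G.alphaTilde_comm n) (G.incl n f)
  have h3 := LinearMap.congr_fun (LieCochains.iota_comm (L := G.LieAlg) R n)
    (G.alphaTilde n (G.incl n f))
  have h4 := LinearMap.congr_fun (LieCochains.nu_comm R G.lieBasis n)
    (G.iota n (G.alphaTilde n (G.incl n f)))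
  have h5 := LinearMap.congr_fun (LieCochains.kappa_comm R G.lieBasis n)
    (G.nu n (G.iota n (G.alphaTilde n (G.incl n f))))
  change G.kappa (n + 1) (G.nu (n + 1) (G.iota (n + 1) (G.alphaTilde (n + 1)
    (G.incl (n + 1) (G.cobarD R n f))))) = _
  refine (congrArg (fun x => G.kappa (n + 1) (G.nu (n + 1) (G.iota (n + 1)
    (G.alphaTilde (n + 1) x)))) h1).trans ?_
  refine (congrArg (fun x => G.kappa (n + 1) (G.nu (n + 1) (G.iota (n + 1) x))) h2).trans ?_
  refine (congrArg (fun x => G.kappa (n + 1) (G.nu (n + 1) x)) h3).trans ?_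
  exact (congrArg (fun x => G.kappa (n + 1) x) h4).trans h5

end FormalGroupLaw

end

theorem mainTheorem3 {R : Type u} [CommRing R] [IsDomain R] [CharZero R] {m : ℕ}
    (G : FormalGroupLaw R m) :
    -- `α̃^* : Õ(G) → U(𝔤)^*` is an isomorphism of complete Hopf algebras
    G.AlphaIsHopfIso ∧
    -- the maps in degree `n` extend `α̃^*` and `α^*` as their tensor powers
    (∀ (n : ℕ) (f : Fin n → G.OTilde) (u : Fin n → G.U),
      G.alphaTilde n (G.pureTensorTilde f) (PiTensorProduct.tprod R u) =
        ∏ i, G.alphaTildeOne (f i) (u i)) ∧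
    (∀ (n : ℕ) (f : Fin n → MvPowerSeries (Fin m) R) (u : Fin n → G.U),
      G.alphaStar n (FormalGroupLaw.pureTensor f) (PiTensorProduct.tprod R u) =
        ∏ i, G.alphaStarOne (f i) (u i)) ∧
    -- `α̃^*` restricts to `α^*`
    (∀ n : ℕ, G.alphaTilde n ∘ₗ G.incl n = G.alphaStar n) ∧
    ∃ -- the six sequences of cochains are complexes
      (hK : ∀ n, G.cobarD R (n + 1) ∘ₗ G.cobarD R n = 0)
      (hKt : ∀ n, G.cobarTildeD (n + 1) ∘ₗ G.cobarTildeD n = 0)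
      (hU : ∀ n, G.inhomD (n + 1) ∘ₗ G.inhomD n = 0)
      (hUh : ∀ n, G.homD (n + 1) ∘ₗ G.homD n = 0)
      (hV : ∀ n, G.koszulD (n + 1) ∘ₗ G.koszulD n = 0)
      (hC : ∀ n, G.ceD (n + 1) ∘ₗ G.ceD n = 0)
      -- the maps commute with the differentials
      (cIncl : ∀ n, G.incl (n + 1) ∘ₗ G.cobarD R n = G.cobarTildeD n ∘ₗ G.incl n)
      (cAlpha : ∀ n, G.alphaTilde (n + 1) ∘ₗ G.cobarTildeD n = G.inhomD n ∘ₗ G.alphaTilde n)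
      (cIota : ∀ n, G.iota (n + 1) ∘ₗ G.inhomD n = G.homD n ∘ₗ G.iota n)
      (cNu : ∀ n, G.nu (n + 1) ∘ₗ G.homD n = G.koszulD n ∘ₗ G.nu n)
      (cKappa : ∀ n, G.kappa (n + 1) ∘ₗ G.koszulD n = G.ceD n ∘ₗ G.kappa n)
      (cPhi : ∀ n, G.phi (n + 1) ∘ₗ G.cobarD R n = G.ceD n ∘ₗ G.phi n),
      -- the factors are isomorphisms of complexes, respectively a quasi-isomorphism
      IsIso (G.alphaTildeHom hKt hU cAlpha) ∧
      IsIso (G.iotaHom hU hUh cIota) ∧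
      QuasiIso (G.nuHom hUh hV cNu) ∧
      IsIso (G.kappaHom hV hC cKappa) ∧
      -- the composite is a quasi-isomorphism
      QuasiIso (G.alphaTildeHom hKt hU cAlpha ≫ G.iotaHom hU hUh cIota ≫
        G.nuHom hUh hV cNu ≫ G.kappaHom hV hC cKappa) ∧
      -- it restricts to the morphism of complexes `φ` on the cochains of `G`
      G.phiHom hK hC cPhi =
        G.inclHom hK hKt cIncl ≫ G.alphaTildeHom hKt hU cAlpha ≫
          G.iotaHom hU hUh cIota ≫ G.nuHom hUh hV cNu ≫ G.kappaHom hV hC cKappa := by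
  obtain ⟨lam, hlam⟩ := G.exists_lieProj
  have hU : ∀ n, G.inhomD (n + 1) ∘ₗ G.inhomD n = 0 := LieCochains.inhomD_inhomD R G.LieAlg
  have hUh : ∀ n, G.homD (n + 1) ∘ₗ G.homD n = 0 := LieCochains.homD_homD R G.LieAlg
  have hV : ∀ n, G.koszulD (n + 1) ∘ₗ G.koszulD n = 0 :=
    LieCochains.koszulHomD_koszulHomD (b := G.lieBasis) lam hlam
  have hC : ∀ n, G.ceD (n + 1) ∘ₗ G.ceD n = 0 := LieCochains.ceD_ceD (b := G.lieBasis) lam hlam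
  have cIota : ∀ n, G.iota (n + 1) ∘ₗ G.inhomD n = G.homD n ∘ₗ G.iota n :=
    LieCochains.iota_comm R
  have cNu : ∀ n, G.nu (n + 1) ∘ₗ G.homD n = G.koszulD n ∘ₗ G.nu n :=
    LieCochains.nu_comm R G.lieBasis
  have cKappa : ∀ n, G.kappa (n + 1) ∘ₗ G.koszulD n = G.ceD n ∘ₗ G.kappa n :=
    LieCochains.kappa_comm R G.lieBasis
  have i1 : IsIso (G.alphaTildeHom G.cobarTildeD_cobarTildeD hU G.alphaTilde_comm) :=
    isIso_toHom (X := fun n => G.KTilde n) (Y := G.InhomCochain) _ _ _ _ G.alphaTilde_bijective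
  have i2 : IsIso (G.iotaHom hU hUh cIota) :=
    isIso_toHom (X := G.InhomCochain) (Y := G.HomCochain) _ _ _ _ fun n =>
      (LieCochains.iota R G.LieAlg n).bijective
  have i3 : QuasiIso (G.nuHom hUh hV cNu) := G.quasiIso_nuHom hUh hV cNu
  have i4 : IsIso (G.kappaHom hV hC cKappa) :=
    isIso_toHom (X := G.KoszulCochain) (Y := G.LieCochain) _ _ _ _ fun n =>
      (LieCochains.kappa R G.LieAlg n).bijective
  refine ⟨G.alphaIsHopfIso, G.alphaTilde_pureTensor, G.alphaStar_pureTensor,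
    G.alphaTilde_comp_incl, G.cobarD_cobarD, G.cobarTildeD_cobarTildeD, hU, hUh, hV, hC,
    G.incl_comm, G.alphaTilde_comm, cIota, cNu, cKappa, G.phi_comm, i1, i2, i3, i4,
    inferInstance, ?_⟩
  refine HomologicalComplex.hom_ext _ _ fun n => ?_
  refine (toHom_f (X := G.K) (Y := G.LieCochain) _ _ _ _ n).trans ?_
  rw [G.phi_eq n]
  refine Eq.symm ?_
  simp only [HomologicalComplex.comp_f]
  have e1 : (G.inclHom G.cobarD_cobarD G.cobarTildeD_cobarTildeD G.incl_comm).f n =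
    ModuleCat.ofHom (G.incl n) := toHom_f (X := G.K) (Y := fun n => G.KTilde n) _ _ _ _ n
  have e2 : (G.alphaTildeHom G.cobarTildeD_cobarTildeD hU G.alphaTilde_comm).f n =
    ModuleCat.ofHom (G.alphaTilde n) :=
    toHom_f (X := fun n => G.KTilde n) (Y := G.InhomCochain) _ _ _ _ n
  have e3 : (G.iotaHom hU hUh cIota).f n = ModuleCat.ofHom (G.iota n) :=
    toHom_f (X := G.InhomCochain) (Y := G.HomCochain) _ _ _ _ n
  have e4 : (G.nuHom hUh hV cNu).f n = ModuleCat.ofHom (G.nu n) :=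
    toHom_f (X := G.HomCochain) (Y := G.KoszulCochain) _ _ _ _ n
  have e5 : (G.kappaHom hV hC cKappa).f n = ModuleCat.ofHom (G.kappa n) :=
    toHom_f (X := G.KoszulCochain) (Y := G.LieCochain) _ _ _ _ n
  rw [e1, e2, e3, e4, e5]
  rfl
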